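/- **Setting.** Consider an episodic MDP with state space $\mathcal S$, action space $\mathcal A$, horizon $H\ge 1$, transitions $P_1,\dots,P_H$, fixed initial state $s_1$ and unknown true reward $r^{\rm true}=(r^{\rm true}_h)_{h\le H}$, $r^{\rm true}_h:\mathcal S\times\mathcal A\to[0,1]$. For a policy $\pi$ and a reward $r$ let $V^\pi_r=\mathbb E_\pi[\sum_h r_h(s_h,a_h)]$, $V^\pi=V^\pi_{r^{\rm true}}$, $Q^{\star,r}_h(s,a)=\sup_\pi \mathbb E_\pi[\sum_{\ell\ge h}r_\ell(s_\ell,a_\ell)\mid s_h=s,a_h=a]$ and $(\mathcal T^r_hQ_{h+1})(s,a)=r_h(s,a)+\mathbb E_{s'\sim P_h(\cdot|s,a)}[\max_{a'}Q_{h+1}(s',a')]$, with $Q_{H+1}\equiv0$ always. Let $\mathcal R=\mathcal R_1\times\dots\times\mathcal R_H$ with $\mathcal R_h\subseteq(\mathcal S\times\mathcal A\to[0,1])$ and $\mathcal Q=\mathcal Q_1\times\dots\times\mathcal Q_H$ with $\mathcal Q_h\subseteq(\mathcal S\times\mathcal A\to[0,H])$ be classes of measurable functions, where maxima over actions of elements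 of $\mathcal Q_h$ are attained by measurable selections. $\mathcal N_\rho(\mathcal F)$ is the smallest cardinality of a $\rho$-cover of $\mathcal F$ in sup-norm with centers in $\mathcal F$ (for $\mathcal Q$ and $\mathcal R$: as classes of functions of $(h,s,a)$). Assume $r^{\rm true}\in\mathcal R$; $Q^{\star,r}\in\mathcal Q$ for all $r\in\mathcal R$; and $\mathcal T^r_h\mathcal Q_{h+1}\subseteq\mathcal Q_h$ for all $r\in\mathcal R$, $h\le H$. For $\varepsilon'>0$ let $d_{\rm GEC}(\varepsilon')$ be the smallest $d\ge 0$ such that for all $r^1,\dots,r^K\in\mathcal R$, $Q^1,\dots,Q^K\in\mathcal Q$ and greedy policies $\pi^k$ of $Q^k$, $$\sum_{k=1}^K \big(Q^k_1(s_1,\pi^k_1(s_1))-V^{\pi^k}_{r^k}\big)\le\inf_{\mu>0}\Big\{\frac\mu2\sum_{k=1}^K\sum_{i=1}^{k-1}\mathbb E_{\pi^i}\Big[\sum_{h=1}^H\big(Q^k_h-\mathcal T^{r^k}_hQ^k_{h+1}\big)^2(s_h,a_h)\Big]+\frac d{2\mu}\Big\}+\sqrt{dHK}+\varepsilon'HK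 .$$ **Algorithm (OPT-AIL).** Given $N$ i.i.d. trajectories of an expert policy $\pi^E$ and an initial policy $\pi^0$, for $k=1,\dots,K$: (i) roll out a trajectory $\tau^{k-1}=(s^{k-1}_h,a^{k-1}_h)_{h\le H}$ of $\pi^{k-1}$; (ii) choose $r^k\in\mathcal R$ from the information available so far; (iii) choose $Q^k\in\mathcal Q$ as an approximate minimizer of $$\mathcal L^k(Q)=\sum_{h=1}^H\Big(\mathcal E^k_h(Q_h,Q_{h+1})-\inf_{Q'_h\in\mathcal Q_h}\mathcal E^k_h(Q'_h,Q_{h+1})\Big)-\lambda\max_aQ_1(s_1,a),$$ where $\mathcal E^k_h(q,Q_{h+1})=\sum_{i=0}^{k-1}\big(q(s^i_h,a^i_h)-r^k_h(s^i_h,a^i_h)-\max_{a'}Q_{h+1}(s^i_{h+1},a')\big)^2$; (iv) let $\pi^k$ be a greedy policy of $Q^k$. The output $\bar\pi$ is drawn uniformly from $\pi^1,\dots,\pi^K$ (and then followed for the whole episode), so $V^{\bar\pi}=\frac1K\sum_{k=1}^KV^{\pi^k}$. The choices in (ii) and (iii) may be randomized. Let $\widehat V^{\pi^k}_r=\sum_hr_h(s^k_h,a^k_h)$,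 where also $\tau^K$ is rolled out with $\pi^K$, let $\widehat V^{\pi^E}_r$ be the average reward of the expert trajectories, and put $$\varepsilon^r_{\rm opt}=\frac1K\sup_{r\in\mathcal R}\sum_{k=1}^K\Big(\widehat V^{\pi^k}_{r^k}-\widehat V^{\pi^E}_{r^k}-\big(\widehat V^{\pi^k}_r-\widehat V^{\pi^E}_r\big)\Big),\qquad \varepsilon^Q_{\rm opt}=\max_{1\le k\le K}\Big(\mathcal L^k(Q^k)-\inf_{Q\in\mathcal Q}\mathcal L^k(Q)\Big).$$ **Theorem 1.** There are absolute constants $c_1,c_2,c_N,c_K>0$ such that the following holds. Let $\varepsilon,\delta\in(0,1]$, let $d\ge1$ be any number with $d\ge d_{\rm GEC}(\varepsilon/(6H))$, let $\rho=c_2\varepsilon^2/(H^3d+H)$, let the covering numbers below be finite, and run OPT-AIL with $$\lambda=c_1\sqrt{\frac{KH^3\log\big(4KH\,\mathcal N_\rho(\mathcal Q)\mathcal N_\rho(\mathcal R)/\delta\big)+K^2H^3\rho}{d}} .$$ If $$N\ge c_N\frac{H^2\log(\max_h\mathcal N_\rho(\mathcal R_h)/\delta)}{\varepsilon^2},\qquad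 K\ge c_K\frac{H^4d\log\big(Hd\max_h\mathcal N_\rho(\mathcal Q_h)\mathcal N_\rho(\mathcal R_h)/(\delta\varepsilon)\big)+H^2\log(1/\delta)}{\varepsilon^2},$$ then with probability at least $1-\delta$, $$V^{\pi^E}-V^{\bar\pi}\le\varepsilon+\varepsilon^r_{\rm opt}+\varepsilon^Q_{\rm opt}/\lambda .$$ -/

import Mathlib

open MeasureTheory ProbabilityTheory

noncomputable section

namespace OptAil

variable {S A : Type*} [MeasurableSpace S] [MeasurableSpace A]

/-- An episodic MDP with horizon `H`, transition kernels `P_1, …, P_H`, (unknown) true reward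
functions with values in `[0, 1]` and a fixed initial state. Steps are indexed by `Fin H`, so the
step `h ∈ {1, …, H}` is the index `h - 1`. -/
structure MDP (S A : Type*) [MeasurableSpace S] [MeasurableSpace A] (H : ℕ) where
  P : Fin H → Kernel (S × A) S
  markov : ∀ h, IsMarkovKernel (P h)
  reward : Fin H → S × A → ℝ
  reward_measurable : ∀ h, Measurable (reward h)
  reward_mem : ∀ h x, reward h x ∈ Set.Icc (0 : ℝ) 1
  s₁ : S

/-- A non-stationary (stochastic) policy. -/
structure Policy (S A : Type*) [MeasurableSpace S] [MeasurableSpace A] (H : ℕ) where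
  kernel : Fin H → Kernel S A
  markov : ∀ h, IsMarkovKernel (kernel h)

/-- A deterministic non-stationary policy. -/
structure DetPolicy (S A : Type*) [MeasurableSpace S] [MeasurableSpace A] (H : ℕ) where
  act : Fin H → S → A
  measurable_act : ∀ h, Measurable (act h)

/-- A deterministic policy, regarded as a stochastic one. -/
def DetPolicy.toPolicy {H : ℕ} (π : DetPolicy S A H) : Policy S A H where
  kernel h := Kernel.deterministic (π.act h) (π.measurable_act h)
  markov _ := inferInstance

/-- The law of the `n`-step trajectory `(s_1, a_1, …, s_n, a_n)` started in a given state, where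
`a_h ∼ π_h(s_h)` and `s_{h+1} ∼ P_h(s_h, a_h)`. -/
def trajKernel : (n : ℕ) → (Fin n → Kernel (S × A) S) → (Fin n → Kernel S A) →
    Kernel S (Fin n → S × A)
  | 0, _, _ => Kernel.deterministic (fun _ => Fin.elim0) measurable_const
  | n + 1, P, π =>
      (Kernel.id ×ₖ ((π 0 ⊗ₖ P 0) ⊗ₖ
        (trajKernel n (fun j => P j.succ) (fun j => π j.succ)).comap
          (fun p : S × (A × S) => p.2.2) (measurable_snd.comp measurable_snd))).map
        (fun x : S × ((A × S) × (Fin n → S × A)) =>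
          (Fin.cons (x.1, x.2.1.1) x.2.2 : Fin (n + 1) → S × A))

/-- The entries of a family over the steps `h + 1, …, H`, those strictly after `h`. -/
def tailFrom {H : ℕ} {X : Type*} (h : Fin H) (f : Fin H → X) : Fin (H - (h.1 + 1)) → X :=
  fun j => f ⟨h.1 + 1 + j.1, by omega⟩

/-- The cumulative reward `∑_h r_h(s_h, a_h)` of a trajectory. -/
def pathReward {n : ℕ} (r : Fin n → S × A → ℝ) (τ : Fin n → S × A) : ℝ :=
  ∑ h, r h (τ h)

/-- The law of the trajectory that the policy `π` generates in the MDP. -/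
def MDP.trajLaw {H : ℕ} (M : MDP S A H) (π : Policy S A H) : Measure (Fin H → S × A) :=
  trajKernel H M.P π.kernel M.s₁

/-- The policy value `V^π_r`. -/
def MDP.value {H : ℕ} (M : MDP S A H) (π : Policy S A H) (r : Fin H → S × A → ℝ) : ℝ :=
  ∫ τ, pathReward r τ ∂(M.trajLaw π)

/-- The value under `r` of the mixture of `π^1, …, π^K`: one of these policies is drawn uniformly
at random and is then followed for the whole episode. -/
def MDP.mixValue {H : ℕ} (M : MDP S A H) (K : ℕ) (π : ℕ → Policy S A H)
    (r : Fin H → S × A → ℝ) : ℝ :=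
  ∫ τ, pathReward r τ ∂((K : ENNReal)⁻¹ • ∑ k ∈ Finset.Icc 1 K, M.trajLaw (π k))

/-- The Q-value function
`Q^{π,r}_h(s, a) = E_π[∑_{ℓ ≥ h} r_ℓ(s_ℓ, a_ℓ) | s_h = s, a_h = a]`. -/
def MDP.qValue {H : ℕ} (M : MDP S A H) (π : Policy S A H) (r : Fin H → S × A → ℝ)
    (h : Fin H) (x : S × A) : ℝ :=
  r h x + ∫ s', ∫ τ, pathReward (tailFrom h r) τ
    ∂(trajKernel (H - (h.1 + 1)) (tailFrom h M.P) (tailFrom h π.kernel) s') ∂(M.P h x)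

/-- The optimal Q-value function `Q^{⋆,r}_h(s, a) = sup_π Q^{π,r}_h(s, a)`. -/
def MDP.optQ {H : ℕ} (M : MDP S A H) (r : Fin H → S × A → ℝ) (h : Fin H) (x : S × A) : ℝ :=
  ⨆ π : Policy S A H, M.qValue π r h x

/-- `Q_{h+1}`, with the convention `Q_{H+1} = 0`. -/
def nextQ {H : ℕ} (Q : Fin H → S × A → ℝ) (h : Fin H) : S × A → ℝ :=
  if hh : h.1 + 1 < H then Q ⟨h.1 + 1, hh⟩ else fun _ => 0

/-- The Bellman operator
`(T^r_h Q_{h+1})(s, a) = r_h(s, a) + E_{s' ∼ P_h(s, a)}[max_{a'} Q_{h+1}(s', a')]`. -/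
def MDP.bellman {H : ℕ} (M : MDP S A H) (r : Fin H → S × A → ℝ) (Q : Fin H → S × A → ℝ)
    (h : Fin H) (x : S × A) : ℝ :=
  r h x + ∫ s', (⨆ a', nextQ Q h (s', a')) ∂(M.P h x)

/-- `π` is a greedy policy of `Q`: `π_h(s) ∈ argmax_a Q_h(s, a)`. -/
def IsGreedy {H : ℕ} (Q : Fin H → S × A → ℝ) (π : DetPolicy S A H) : Prop :=
  ∀ h s a, Q h (s, a) ≤ Q h (s, π.act h s)

/-- Each `R_h` consists of (measurable) functions `S × A → [0, 1]`. -/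
def IsRewardClass {H : ℕ} (R : Fin H → Set (S × A → ℝ)) : Prop :=
  ∀ h, ∀ r ∈ R h, Measurable r ∧ ∀ x, r x ∈ Set.Icc (0 : ℝ) 1

/-- Each `Q_h` consists of (measurable) functions `S × A → [0, H]` for which the maximum over
actions is attained, at an action that is a measurable function of the state, so that greedy
policies exist. -/
def IsQClass {H : ℕ} (𝒬 : Fin H → Set (S × A → ℝ)) : Prop :=
  ∀ h, ∀ q ∈ 𝒬 h, Measurable q ∧ (∀ x, q x ∈ Set.Icc (0 : ℝ) H) ∧
    ∃ g : S → A, Measurable g ∧ ∀ s a, q (s, a) ≤ q (s, g s)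

/-- Realizability of the reward class. -/
def RewardRealizable {H : ℕ} (M : MDP S A H) (R : Fin H → Set (S × A → ℝ)) : Prop :=
  ∀ h, M.reward h ∈ R h

/-- Realizability of the Q-value class. -/
def QRealizable {H : ℕ} (M : MDP S A H) (R 𝒬 : Fin H → Set (S × A → ℝ)) : Prop :=
  ∀ r : Fin H → S × A → ℝ, (∀ h, r h ∈ R h) → ∀ h, M.optQ r h ∈ 𝒬 h

/-- Bellman completeness of the Q-value class. -/
def BellmanComplete {H : ℕ} (M : MDP S A H) (R 𝒬 : Fin H → Set (S × A → ℝ)) : Prop :=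
  ∀ r : Fin H → S × A → ℝ, (∀ h, r h ∈ R h) →
    ∀ Q : Fin H → S × A → ℝ, (∀ h, Q h ∈ 𝒬 h) → ∀ h, M.bellman r Q h ∈ 𝒬 h

/-- The inequality defining the generalized eluder coefficient, for all sequences of `K` rewards
and Q-value functions and their greedy policies. The infimum over `μ` is written as a universal
quantifier. -/
def GECBound {H : ℕ} [NeZero H] (M : MDP S A H) (R 𝒬 : Fin H → Set (S × A → ℝ))
    (K : ℕ) (ε d : ℝ) : Prop :=
  ∀ (r Q : Fin K → Fin H → S × A → ℝ) (π : Fin K → DetPolicy S A H),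
    (∀ k h, r k h ∈ R h) → (∀ k h, Q k h ∈ 𝒬 h) → (∀ k, IsGreedy (Q k) (π k)) →
    ∀ μ : ℝ, 0 < μ →
      ∑ k, (Q k 0 (M.s₁, (π k).act 0 M.s₁) - M.value (π k).toPolicy (r k)) ≤
        μ / 2 * ∑ k, ∑ i ∈ Finset.univ.filter (fun i => i < k),
            (∫ τ, ∑ h, (Q k h (τ h) - M.bellman (r k) (Q k) h (τ h)) ^ 2
              ∂(M.trajLaw (π i).toPolicy))
          + d / (2 * μ) + Real.sqrt (d * H * K) + ε * H * K

/-- The generalized eluder coefficient: the smallest `d ≥ 0` for which the above inequality holds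
(for sequences of length `K`, `d = H K` always is admissible). -/
def dGEC {H : ℕ} [NeZero H] (M : MDP S A H) (R 𝒬 : Fin H → Set (S × A → ℝ))
    (K : ℕ) (ε : ℝ) : ℝ :=
  sInf {d : ℝ | 0 ≤ d ∧ GECBound M R 𝒬 K ε d}

/-- The `ε`-covering number of a function class, in the sup-distance and with centers in the
class; it is `⊤` if there is no finite cover. -/
def coveringNumber {X : Type*} (ε : ℝ) (F : Set (X → ℝ)) : ℕ∞ :=
  ⨅ (F' : Finset (X → ℝ)) (_ : (F' : Set (X → ℝ)) ⊆ F)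
    (_ : ∀ f ∈ F, ∃ f' ∈ F', ∀ x, |f x - f' x| ≤ ε), (F'.card : ℕ∞)

/-- The covering number as a real number (used only where it is finite). -/
def covNum {X : Type*} (ε : ℝ) (F : Set (X → ℝ)) : ℝ := ((coveringNumber ε F).toNat : ℝ)

/-- The product class `F_1 × ⋯ × F_H`, as a class of functions of `(h, s, a)`. -/
def prodClass {H : ℕ} (F : Fin H → Set (S × A → ℝ)) : Set (Fin H × (S × A) → ℝ) :=
  {f | ∀ h, (fun x => f (h, x)) ∈ F h}

/-- `max_{a'} Q_{h+1}(s_{h+1}, a')` along a trajectory, which is `0` in the last step. -/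
def nextMax {H : ℕ} (Q : Fin H → S × A → ℝ) (h : Fin H) (τ : Fin H → S × A) : ℝ :=
  if hh : h.1 + 1 < H then ⨆ a', Q ⟨h.1 + 1, hh⟩ ((τ ⟨h.1 + 1, hh⟩).1, a') else 0

/-- The squared loss `E_h(q, Q_{h+1}; D^k, r)` on the dataset `D^k = {τ^0, …, τ^{k-1}}`. -/
def sqLoss {H : ℕ} (D : ℕ → Fin H → S × A) (k : ℕ) (r : Fin H → S × A → ℝ) (h : Fin H)
    (q : S × A → ℝ) (Q : Fin H → S × A → ℝ) : ℝ :=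
  ∑ i ∈ Finset.range k, (q (D i h) - r h (D i h) - nextMax Q h (D i)) ^ 2

/-- The estimated squared Bellman error `BE^k(Q)`. -/
def bellmanError {H : ℕ} (𝒬 : Fin H → Set (S × A → ℝ)) (D : ℕ → Fin H → S × A) (k : ℕ)
    (r : Fin H → S × A → ℝ) (Q : Fin H → S × A → ℝ) : ℝ :=
  ∑ h, (sqLoss D k r h (Q h) Q - ⨅ q : 𝒬 h, sqLoss D k r h q.1 Q)

/-- The optimism-regularized objective `BE^k(Q) - lam * max_a Q_1(s_1, a)`. -/
def objective {H : ℕ} [NeZero H] (M : MDP S A H) (𝒬 : Fin H → Set (S × A → ℝ))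
    (D : ℕ → Fin H → S × A) (lam : ℝ) (k : ℕ) (r : Fin H → S × A → ℝ)
    (Q : Fin H → S × A → ℝ) : ℝ :=
  bellmanError 𝒬 D k r Q - lam * ⨆ a, Q 0 (M.s₁, a)

/-- An execution of OPT-AIL with `N` expert trajectories and `K` iterations on a probability space.
The `σ`-algebra `ℱ k` is the information that the learner has when it chooses `r^k, Q^k, π^k`: it
contains the expert data, the trajectories `τ^0, …, τ^{k-1}` and possibly internal randomness of
the two optimization procedures. How accurately these solve their problems is measured by
`rewardOptError` and `qOptError` below. -/
structure Run {Ω : Type*} [mΩ : MeasurableSpace Ω] (μ : Measure Ω) {H : ℕ} (M : MDP S A H)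
    (R 𝒬 : Fin H → Set (S × A → ℝ)) (πE π₀ : Policy S A H) (N K : ℕ) where
  ℱ : Filtration ℕ mΩ
  /-- the expert trajectories: i.i.d. samples from the expert policy -/
  expert : Fin N → Ω → Fin H → S × A
  expert_measurable : ∀ j, Measurable[ℱ 0] (expert j)
  expert_indep : iIndepFun expert μ
  expert_law : ∀ j, μ.map (expert j) = M.trajLaw πE
  /-- the rewards `r^1, …, r^K` -/
  r : ℕ → Ω → Fin H → S × A → ℝ
  r_mem : ∀ k ∈ Finset.Icc 1 K, ∀ ω h, r k ω h ∈ R h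
  r_measurable : ∀ k ∈ Finset.Icc 1 K, ∀ h,
    Measurable[(ℱ k).prod inferInstance] (fun p : Ω × (S × A) => r k p.1 h p.2)
  /-- the Q-value functions `Q^1, …, Q^K` -/
  Q : ℕ → Ω → Fin H → S × A → ℝ
  Q_mem : ∀ k ∈ Finset.Icc 1 K, ∀ ω h, Q k ω h ∈ 𝒬 h
  Q_measurable : ∀ k ∈ Finset.Icc 1 K, ∀ h,
    Measurable[(ℱ k).prod inferInstance] (fun p : Ω × (S × A) => Q k p.1 h p.2)
  /-- the greedy policies `π^1, …, π^K` -/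
  greedy : ℕ → Ω → DetPolicy S A H
  isGreedy : ∀ k ∈ Finset.Icc 1 K, ∀ ω, IsGreedy (Q k ω) (greedy k ω)
  greedy_measurable : ∀ k ∈ Finset.Icc 1 K, ∀ h,
    Measurable[(ℱ k).prod inferInstance] (fun p : Ω × S => (greedy k p.1).act h p.2)
  /-- the trajectories `τ^0, …, τ^K`: given the past, `τ^k` is generated by `π^k` -/
  τ : ℕ → Ω → Fin H → S × A
  τ_measurable : ∀ k ≤ K, Measurable[ℱ (k + 1)] (τ k)
  τ_law_zero : ∀ E : Set (Fin H → S × A), MeasurableSet E →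
    μ⟦τ 0 ⁻¹' E | ℱ 0⟧ =ᵐ[μ] fun _ => (M.trajLaw π₀).real E
  τ_law : ∀ k ∈ Finset.Icc 1 K, ∀ E : Set (Fin H → S × A), MeasurableSet E →
    μ⟦τ k ⁻¹' E | ℱ k⟧ =ᵐ[μ] fun ω => (M.trajLaw (greedy k ω).toPolicy).real E

section Run

variable {Ω : Type*} [mΩ : MeasurableSpace Ω] {μ : Measure Ω} {H : ℕ} {M : MDP S A H}
  {R 𝒬 : Fin H → Set (S × A → ℝ)} {πE π₀ : Policy S A H} {N K : ℕ}

/-- The empirical value of the expert policy under `r`. -/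
def Run.expertValue (run : Run μ M R 𝒬 πE π₀ N K) (ω : Ω) (r : Fin H → S × A → ℝ) : ℝ :=
  1 / (N : ℝ) * ∑ j, pathReward r (run.expert j ω)

/-- The estimated loss `L^k(r)`: the estimated value of `π^k` minus that of the expert policy. -/
def Run.loss (run : Run μ M R 𝒬 πE π₀ N K) (ω : Ω) (k : ℕ) (r : Fin H → S × A → ℝ) : ℝ :=
  pathReward r (run.τ k ω) - run.expertValue ω r

/-- The reward optimization error `ε^r_opt` (average regret) of the execution. -/
def Run.rewardOptError (run : Run μ M R 𝒬 πE π₀ N K) (ω : Ω) : ℝ :=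
  1 / (K : ℝ) * ⨆ r : {r : Fin H → S × A → ℝ // ∀ h, r h ∈ R h},
    ∑ k ∈ Finset.Icc 1 K, (run.loss ω k (run.r k ω) - run.loss ω k r.1)

/-- The Q-value optimization error `ε^Q_opt` of the execution: the largest optimality gap of
`Q^k` in the `k`-th optimization problem, over the iterations `k = 1, …, K`. -/
def Run.qOptError [NeZero H] (run : Run μ M R 𝒬 πE π₀ N K) (lam : ℝ) (ω : Ω) : ℝ :=
  ⨆ k : Finset.Icc 1 K,
    (objective M 𝒬 (fun i => run.τ i ω) lam k.1 (run.r k.1 ω) (run.Q k.1 ω) -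
      ⨅ Q : {Q : Fin H → S × A → ℝ // ∀ h, Q h ∈ 𝒬 h},
        objective M 𝒬 (fun i => run.τ i ω) lam k.1 (run.r k.1 ω) Q.1)

/-- The imitation gap of the output policy, the uniform mixture of `π^1, …, π^K`, with respect to
the true reward. -/
def Run.imitationGap (run : Run μ M R 𝒬 πE π₀ N K) (ω : Ω) : ℝ :=
  M.value πE M.reward - M.mixValue K (fun k => (run.greedy k ω).toPolicy) M.reward

end Run

end OptAil

end

open MeasureTheory ProbabilityTheory

noncomputable section

set_option linter.unusedSectionVars false

namespace OptAil

/-! ### Laws of trajectories and the Markov property. -/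

section

variable {S A : Type*} [MeasurableSpace S] [MeasurableSpace A]

/-! Adding and subtracting values splits the imitation gap into four averages over `k`
(`Run.imitationGap_le`): the empirical regret of the rewards `r^k` against the true reward, which is
at most `ε^r_opt` because the true reward lies in `R`; the sampling error of the expert data; the
sampling error of the rollouts; and the policy regret `V^{πE} - V^{π^k}`, both values taken under
`r^k`.

The policy regret (`sum_value_sub_value_le`) rests on optimism. By Bellman completeness and
realizability, `Q^{⋆,r^k}` is a fixed point in the class, so its estimated Bellman error is at most
`H β` on a good event. Comparing `Q^k` with it in the regularized objective gives `V^{πE} ≤ max_a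
Q^k_1(s₁, a) + (H β + ε^Q_opt - BE^k(Q^k)) / lam`. The eluder inequality with `μ = 1 / lam` bounds
`max_a Q^k_1 - V^{π^k}` by expected squared Bellman errors on earlier policies. On the same event
these are at most `2 BE^k(Q^k) + 2 H β`, so the estimated Bellman errors cancel exactly. What
remains is of order `K H β / lam + d lam`, and `lam` balances the two.

All concentration comes from one device: `exp x ≤ 1 + x + x²` for `|x| ≤ 1`, products of
conditionally sub-normalized exponentials, and Markov's inequality. For the Bellman errors it yields
a fast rate, since the excess squared loss has mean `v`, the expected squared residual, and second
moment at most `9 H² v`. Half of the mean thus pays for the fluctuation and `β` carries only a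
logarithm, plus a discretization error proportional to `K H ρ`.

Sample-size conditions whose logarithms may vanish force a separate treatment of classes that a
single center covers; there the estimates are deterministic
(`Run.imitationGap_le_of_covNum_lt_two`). -/

theorem measurable_consStep {n : ℕ} : Measurable (fun x : S × ((A × S) × (Fin n → S × A)) =>
    (Fin.cons (x.1, x.2.1.1) x.2.2 : Fin (n + 1) → S × A)) := by
  refine measurable_pi_iff.2 fun i => ?_
  refine Fin.cases ?_ (fun j => ?_) i
  · simp only [Fin.cons_zero]; fun_prop
  · simp only [Fin.cons_succ]; fun_prop

theorem isMarkovKernel_trajKernel : ∀ (n : ℕ) (P : Fin n → Kernel (S × A) S)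
    (π : Fin n → Kernel S A), (∀ h, IsMarkovKernel (P h)) → (∀ h, IsMarkovKernel (π h)) →
    IsMarkovKernel (trajKernel n P π)
  | 0, _, _, _, _ => by unfold trajKernel; infer_instance
  | n + 1, P, π, hP, hπ => by
    have := isMarkovKernel_trajKernel n (fun j => P j.succ) (fun j => π j.succ)
      (fun j => hP _) (fun j => hπ _)
    have := hP 0
    have := hπ 0
    unfold trajKernel
    exact Kernel.IsMarkovKernel.map _ measurable_consStep

instance (H : ℕ) (M : MDP S A H) (π : Policy S A H) : IsProbabilityMeasure (M.trajLaw π) := by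
  have := isMarkovKernel_trajKernel H M.P π.kernel M.markov π.markov
  unfold MDP.trajLaw; infer_instance

/-- The Dirac factor in the recursion only carries the start state along; integrating it out leaves
the iterated integral over action, next state and remaining trajectory. -/
theorem lintegral_trajKernel_succ {n : ℕ} (P : Fin (n + 1) → Kernel (S × A) S)
    (π : Fin (n + 1) → Kernel S A) (hP : ∀ h, IsMarkovKernel (P h))
    (hπ : ∀ h, IsMarkovKernel (π h)) {F : (Fin (n + 1) → S × A) → ENNReal} (hF : Measurable F)
    (s : S) :
    ∫⁻ τ, F τ ∂(trajKernel (n + 1) P π s) =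
      ∫⁻ a, ∫⁻ s', ∫⁻ τ, F (Fin.cons (s, a) τ)
        ∂(trajKernel n (fun j => P j.succ) (fun j => π j.succ) s') ∂(P 0 (s, a)) ∂(π 0 s) := by
  have := isMarkovKernel_trajKernel n (fun j => P j.succ) (fun j => π j.succ)
      (fun j => hP _) (fun j => hπ _)
  have := hP 0
  have := hπ 0
  have hm : Measurable fun x : S × ((A × S) × (Fin n → S × A)) =>
      F (Fin.cons (x.1, x.2.1.1) x.2.2) := hF.comp measurable_consStep
  have hm2 : Measurable fun y : (A × S) × (Fin n → S × A) =>
      F (Fin.cons (s, y.1.1) y.2) := hm.comp (measurable_prodMk_left (x := s))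
  simp only [trajKernel]
  rw [Kernel.map_apply _ measurable_consStep, lintegral_map hF measurable_consStep,
    Kernel.prod_apply, Kernel.id_apply, lintegral_prod _ hm.aemeasurable]
  rw [lintegral_dirac' _ (by exact hm.lintegral_prod_right')]
  rw [Kernel.lintegral_compProd _ _ _ hm2, Kernel.lintegral_compProd]
  · rfl
  · exact hm2.lintegral_kernel_prod_right' (κ := Kernel.prodMkLeft S
      ((trajKernel n (fun j => P j.succ) (fun j => π j.succ)).comap
        (fun p : (A × S) => p.2) measurable_snd) |>.comap (fun z : A × S => (s, z)) (by fun_prop))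

theorem integral_trajKernel_succ {n : ℕ} (P : Fin (n + 1) → Kernel (S × A) S)
    (π : Fin (n + 1) → Kernel S A) (hP : ∀ h, IsMarkovKernel (P h))
    (hπ : ∀ h, IsMarkovKernel (π h)) {F : (Fin (n + 1) → S × A) → ℝ} (hF : Measurable F)
    {C : ℝ} (hC : ∀ τ, |F τ| ≤ C) (s : S) :
    ∫ τ, F τ ∂(trajKernel (n + 1) P π s) =
      ∫ a, ∫ s', ∫ τ, F (Fin.cons (s, a) τ)
        ∂(trajKernel n (fun j => P j.succ) (fun j => π j.succ) s') ∂(P 0 (s, a)) ∂(π 0 s) := by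
  have := isMarkovKernel_trajKernel n (fun j => P j.succ) (fun j => π j.succ)
      (fun j => hP _) (fun j => hπ _)
  have := hP 0
  have := hπ 0
  have hm : Measurable fun x : S × ((A × S) × (Fin n → S × A)) =>
      F (Fin.cons (x.1, x.2.1.1) x.2.2) := hF.comp measurable_consStep
  have hm2 : Measurable fun y : (A × S) × (Fin n → S × A) =>
      F (Fin.cons (s, y.1.1) y.2) := hm.comp (measurable_prodMk_left (x := s))
  have hint : ∀ (ν : Measure (S × (A × S) × (Fin n → S × A))) [IsFiniteMeasure ν],
      Integrable (fun x => F (Fin.cons (x.1, x.2.1.1) x.2.2)) ν := fun ν _ =>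
    Integrable.of_bound hm.aestronglyMeasurable C (Filter.Eventually.of_forall fun x => hC _)
  have hint2 : ∀ (ν : Measure ((A × S) × (Fin n → S × A))) [IsFiniteMeasure ν],
      Integrable (fun x => F (Fin.cons (s, x.1.1) x.2)) ν := fun ν _ =>
    Integrable.of_bound hm2.aestronglyMeasurable C (Filter.Eventually.of_forall fun x => hC _)
  simp only [trajKernel]
  rw [Kernel.map_apply _ measurable_consStep,
    integral_map measurable_consStep.aemeasurable hF.aestronglyMeasurable,
    Kernel.prod_apply, Kernel.id_apply, integral_prod _ (hint _)]
  rw [integral_dirac' _ _ (by exact hm.stronglyMeasurable.integral_prod_right')]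
  rw [ProbabilityTheory.integral_compProd (hint2 _), ProbabilityTheory.integral_compProd]
  · rfl
  · refine Integrable.of_bound (C := C) ?_ (Filter.Eventually.of_forall fun x => ?_)
    · exact (hm2.stronglyMeasurable.integral_kernel_prod_right' (κ := Kernel.prodMkLeft S
      ((trajKernel n (fun j => P j.succ) (fun j => π j.succ)).comap
        (fun p : (A × S) => p.2) measurable_snd) |>.comap (fun z : A × S => (s, z)) (by fun_prop))).aestronglyMeasurable
    · refine (norm_integral_le_of_norm_le_const (Filter.Eventually.of_forall fun x => hC _)).trans ?_
      simp

/-- A kernel is measurable in the start state for one fixed policy, but the greedy policies of a run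
are random. Joint measurability in the parameter and the state is what makes their trajectory laws
legitimate conditional laws. -/
theorem measurable_trajKernel_deterministic {Θ : Type*} [MeasurableSpace Θ] :
    ∀ (n : ℕ) (P : Fin n → Kernel (S × A) S), (∀ h, IsMarkovKernel (P h)) →
      ∀ (act : Θ → Fin n → S → A) (hact : ∀ θ h, Measurable (act θ h)),
        (∀ h, Measurable fun p : Θ × S => act p.1 h p.2) →
        Measurable fun p : Θ × S =>
          trajKernel n P (fun h => Kernel.deterministic (act p.1 h) (hact p.1 h)) p.2
  | 0, P, hP, act, hact, hact' => by
    simp only [trajKernel]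
    exact (Kernel.measurable _).comp measurable_snd
  | n + 1, P, hP, act, hact, hact' => by
    have ih := measurable_trajKernel_deterministic n (fun j => P j.succ) (fun j => hP _)
      (fun θ j => act θ j.succ) (fun θ j => hact _ _) (fun j => hact' _)
    have := hP 0
    have hmk := fun θ : Θ => isMarkovKernel_trajKernel n (fun j => P j.succ)
      (fun j => Kernel.deterministic (act θ j.succ) (hact θ j.succ)) (fun j => hP _)
      (fun j => inferInstance)
    let κ : Kernel (Θ × S) (Fin n → S × A) := ⟨_, ih⟩
    have hκ : IsMarkovKernel κ := ⟨fun p => (hmk p.1).isProbabilityMeasure _⟩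
    refine Measure.measurable_of_measurable_coe _ fun E hE => ?_
    have h1 : Measurable fun q : ((Θ × S) × S) × (Fin n → S × A) =>
        (Fin.cons (q.1.1.2, act q.1.1.1 0 q.1.1.2) q.2 : Fin (n + 1) → S × A) := by
      refine measurable_consStep.comp
        (f := fun q : ((Θ × S) × S) × (Fin n → S × A) =>
          (q.1.1.2, ((act q.1.1.1 0 q.1.1.2, q.1.2), q.2))) ?_
      have := hact' 0
      fun_prop
    have h2 : Measurable fun q : ((Θ × S) × S) × (Fin n → S × A) => E.indicator
        (fun _ => (1 : ENNReal))
        (Fin.cons (q.1.1.2, act q.1.1.1 0 q.1.1.2) q.2 : Fin (n + 1) → S × A) :=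
      (measurable_const.indicator hE).comp h1
    have h3 := h2.lintegral_kernel_prod_right'
      (κ := κ.comap (fun z : (Θ × S) × S => (z.1.1, z.2)) (by fun_prop))
    have h4 : Measurable fun p : Θ × S => (p.2, act p.1 0 p.2) := measurable_snd.prodMk (hact' 0)
    have h5 := h3.lintegral_kernel_prod_right' (κ := (P 0).comap _ h4)
    convert h5 using 2 with p
    rw [← lintegral_indicator_one hE, lintegral_trajKernel_succ _ _ hP (fun h => inferInstance)
      (measurable_one.indicator hE), Kernel.deterministic_apply, lintegral_dirac']
    · rfl
    · have h6 : Measurable fun y : (A × S) × (Fin n → S × A) => E.indicator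
          (fun _ => (1 : ENNReal)) (Fin.cons (p.2, y.1.1) y.2 : Fin (n + 1) → S × A) :=
        (measurable_const.indicator hE).comp (measurable_consStep.comp
          (f := fun y : (A × S) × (Fin n → S × A) => (p.2, (y.1, y.2))) (by fun_prop))
      have h7 := h6.lintegral_kernel_prod_right'
        (κ := κ.comap (fun z : A × S => (p.1, z.2)) (by fun_prop))
      exact h7.lintegral_kernel_prod_right' (κ := (P 0).comap (fun a => (p.2, a)) (by fun_prop))

theorem lintegral_trajKernel_succ_congr {n : ℕ} (P : Fin (n + 1) → Kernel (S × A) S)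
    (π : Fin (n + 1) → Kernel S A) (hP : ∀ h, IsMarkovKernel (P h))
    (hπ : ∀ h, IsMarkovKernel (π h)) {F G : (Fin (n + 1) → S × A) → ENNReal} (hF : Measurable F)
    (hG : Measurable G) (s : S)
    (h : ∀ a s', ∫⁻ τ, F (Fin.cons (s, a) τ)
        ∂(trajKernel n (fun j => P j.succ) (fun j => π j.succ) s') =
      ∫⁻ τ, G (Fin.cons (s, a) τ)
        ∂(trajKernel n (fun j => P j.succ) (fun j => π j.succ) s')) :
    ∫⁻ τ, F τ ∂(trajKernel (n + 1) P π s) = ∫⁻ τ, G τ ∂(trajKernel (n + 1) P π s) := by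
  rw [lintegral_trajKernel_succ P π hP hπ hF, lintegral_trajKernel_succ P π hP hπ hG]
  simp only [h]

/-- The first state of a trajectory is the initial state. -/
theorem lintegral_trajKernel_initial {n : ℕ} (P : Fin (n + 1) → Kernel (S × A) S)
    (π : Fin (n + 1) → Kernel S A) (hP : ∀ h, IsMarkovKernel (P h))
    (hπ : ∀ h, IsMarkovKernel (π h)) {F : S → ENNReal} (hF : Measurable F) (s : S) :
    ∫⁻ τ, F (τ 0).1 ∂(trajKernel (n + 1) P π s) = F s := by
  have := isMarkovKernel_trajKernel n (fun j => P j.succ) (fun j => π j.succ)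
      (fun j => hP _) (fun j => hπ _)
  have := hP 0
  have := hπ 0
  rw [lintegral_trajKernel_succ P π hP hπ (by fun_prop)]
  simp

/-- The Markov property: given `(s_h, a_h)`, the next state is distributed as `P_h(s_h, a_h)`. -/
theorem lintegral_trajKernel_next : ∀ (n : ℕ) (P : Fin n → Kernel (S × A) S)
    (π : Fin n → Kernel S A), (∀ h, IsMarkovKernel (P h)) → (∀ h, IsMarkovKernel (π h)) →
    ∀ (h : Fin n) (hh : h.1 + 1 < n) (Φ : (S × A) × S → ENNReal), Measurable Φ → ∀ s : S,
    ∫⁻ τ, Φ (τ h, (τ ⟨h.1 + 1, hh⟩).1) ∂(trajKernel n P π s) =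
      ∫⁻ τ, ∫⁻ s', Φ (τ h, s') ∂(P h (τ h)) ∂(trajKernel n P π s)
  | 0, _, _, _, _, h, _, _, _, _ => h.elim0
  | n + 1, P, π, hP, hπ, h, hh, Φ, hΦ, s => by
    have hm1 : Measurable fun τ : Fin (n + 1) → S × A => Φ (τ h, (τ ⟨h.1 + 1, hh⟩).1) := by
      fun_prop
    have hm2 : Measurable fun τ : Fin (n + 1) → S × A => ∫⁻ s', Φ (τ h, s') ∂(P h (τ h)) := by
      have := hP h
      exact (hΦ.lintegral_kernel_prod_right' (κ := P h)).comp (measurable_pi_apply h)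
    obtain ⟨j, hj⟩ := h
    cases j with
    | succ j =>
      refine lintegral_trajKernel_succ_congr P π hP hπ hm1 hm2 s fun a s' => ?_
      exact lintegral_trajKernel_next n (fun j => P j.succ) (fun j => π j.succ)
        (fun j => hP _) (fun j => hπ _) ⟨j, by omega⟩ (by simp at hh ⊢; omega) Φ hΦ s'
    | zero =>
      obtain _ | m := n
      · simp at hh
      have hM := isMarkovKernel_trajKernel (m + 1) (fun j => P j.succ) (fun j => π j.succ)
        (fun j => hP _) (fun j => hπ _)
      have := hP 0
      have := hπ 0
      rw [lintegral_trajKernel_succ P π hP hπ hm1, lintegral_trajKernel_succ P π hP hπ hm2]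
      refine lintegral_congr fun a => ?_
      -- At the first step, `s_{h+1}` is the start state of the shorter trajectory, which equals
      -- `s'` almost surely.
      have h1 : ∀ s', ∫⁻ τ, Φ ((s, a), (τ 0).1)
          ∂(trajKernel (m + 1) (fun j => P j.succ) (fun j => π j.succ) s') = Φ ((s, a), s') :=
        fun s' => lintegral_trajKernel_initial (fun j => P j.succ) (fun j => π j.succ)
          (fun j => hP _) (fun j => hπ _) (F := fun t => Φ ((s, a), t)) (by fun_prop) s'
      have h2 : ∫⁻ s', ∫⁻ τ, (∫⁻ t, Φ ((s, a), t) ∂(P 0 (s, a)))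
          ∂(trajKernel (m + 1) (fun j => P j.succ) (fun j => π j.succ) s') ∂(P 0 (s, a)) =
          ∫⁻ t, Φ ((s, a), t) ∂(P 0 (s, a)) := by simp
      exact (lintegral_congr h1).trans h2.symm

/-- The Markov property as a disintegration, so that it also applies to integrals of real functions
of mixed sign. -/
theorem map_trajLaw_next {H : ℕ} (M : MDP S A H) (π : Policy S A H) (h : Fin H)
    (hh : h.1 + 1 < H) :
    (M.trajLaw π).map (fun τ => (τ h, (τ ⟨h.1 + 1, hh⟩).1)) =
      ((M.trajLaw π).map (fun τ => τ h)) ⊗ₘ (M.P h) := by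
  have := M.markov h
  have : IsProbabilityMeasure ((M.trajLaw π).map (fun τ => τ h)) :=
    Measure.isProbabilityMeasure_map (measurable_pi_apply h).aemeasurable
  refine Measure.ext_of_lintegral _ fun Φ hΦ => ?_
  rw [lintegral_map hΦ (by fun_prop), Measure.lintegral_compProd hΦ,
    lintegral_map (hΦ.lintegral_kernel_prod_right' (κ := M.P h)) (by fun_prop)]
  exact lintegral_trajKernel_next H M.P π.kernel M.markov π.markov h hh Φ hΦ M.s₁

/-- The conditional mean of a function of the next state can be replaced inside an expectation. -/
theorem integral_mul_next_sub {H : ℕ} (M : MDP S A H) (π : Policy S A H) (h : Fin H)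
    (hh : h.1 + 1 < H) {g : S × A → ℝ} {V : S → ℝ} (hg : Measurable g) (hV : Measurable V)
    {C D : ℝ} (hgC : ∀ x, |g x| ≤ C) (hVD : ∀ s, |V s| ≤ D) :
    ∫ τ, g (τ h) * (V (τ ⟨h.1 + 1, hh⟩).1 - ∫ s', V s' ∂(M.P h (τ h))) ∂(M.trajLaw π) = 0 := by
  have := M.markov h
  have : IsProbabilityMeasure ((M.trajLaw π).map (fun τ => τ h)) :=
    Measure.isProbabilityMeasure_map (measurable_pi_apply h).aemeasurable
  have hI : Measurable fun x => ∫ s', V s' ∂(M.P h x) :=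
    (StronglyMeasurable.integral_kernel_prod_right' (κ := M.P h)
      (f := fun p : (S × A) × S => V p.2) (by fun_prop)).measurable
  have hIb : ∀ x, |∫ s', V s' ∂(M.P h x)| ≤ D := fun x => by
    simpa using norm_integral_le_of_norm_le_const (μ := M.P h x) (f := V) (C := D)
      (Filter.Eventually.of_forall hVD)
  have hm : Measurable fun p : (S × A) × S => g p.1 * (V p.2 - ∫ s', V s' ∂(M.P h p.1)) :=
    (hg.comp measurable_fst).mul ((hV.comp measurable_snd).sub (hI.comp measurable_fst))
  have e1 : ∫ τ, g (τ h) * (V (τ ⟨h.1 + 1, hh⟩).1 - ∫ s', V s' ∂(M.P h (τ h))) ∂(M.trajLaw π) =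
      ∫ p, g p.1 * (V p.2 - ∫ s', V s' ∂(M.P h p.1))
        ∂((M.trajLaw π).map (fun τ => (τ h, (τ ⟨h.1 + 1, hh⟩).1))) := by
    rw [integral_map (by fun_prop) hm.aestronglyMeasurable]
  rw [e1, map_trajLaw_next, Measure.integral_compProd]
  · refine integral_eq_zero_of_ae (Filter.Eventually.of_forall fun x => ?_)
    have hVi : Integrable V (M.P h x) :=
      Integrable.of_bound hV.aestronglyMeasurable D (Filter.Eventually.of_forall hVD)
    simp [integral_const_mul, integral_sub hVi (integrable_const _)]
  · refine Integrable.of_bound hm.aestronglyMeasurable (C * (D + D))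
      (Filter.Eventually.of_forall fun p => ?_)
    rw [Real.norm_eq_abs, abs_mul]
    have hC0 := (abs_nonneg _).trans (hgC p.1)
    exact mul_le_mul (hgC _) ((abs_sub _ _).trans (add_le_add (hVD _) (hIb _)))
      (abs_nonneg _) hC0

end

/-! ### Values, Q-values and the Bellman optimality equation. -/

section

variable {S A : Type*} [MeasurableSpace S] [MeasurableSpace A]

/-- Measurable functions with values in `[0, 1]`, one for each step. -/
def IsUnitReward {n : ℕ} (r : Fin n → S × A → ℝ) : Prop :=
  ∀ h, Measurable (r h) ∧ ∀ x, r h x ∈ Set.Icc (0 : ℝ) 1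

theorem IsRewardClass.isUnitReward {H : ℕ} {R : Fin H → Set (S × A → ℝ)} (hR : IsRewardClass R)
    {r : Fin H → S × A → ℝ} (hr : ∀ h, r h ∈ R h) : IsUnitReward r := fun h => hR h _ (hr h)

theorem IsUnitReward.tailFrom {H : ℕ} {r : Fin H → S × A → ℝ} (hr : IsUnitReward r) (h : Fin H) :
    IsUnitReward (tailFrom h r) := fun _ => hr _

theorem measurable_pathReward {n : ℕ} {r : Fin n → S × A → ℝ} (hr : IsUnitReward r) :
    Measurable (pathReward r) := by
  unfold pathReward
  exact Finset.measurable_sum _ fun h _ => (hr h).1.comp (measurable_pi_apply h)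

theorem pathReward_nonneg {n : ℕ} {r : Fin n → S × A → ℝ} (hr : IsUnitReward r)
    (τ : Fin n → S × A) : 0 ≤ pathReward r τ :=
  Finset.sum_nonneg fun h _ => ((hr h).2 _).1

theorem pathReward_le {n : ℕ} {r : Fin n → S × A → ℝ} (hr : IsUnitReward r)
    (τ : Fin n → S × A) : pathReward r τ ≤ n := by
  refine (Finset.sum_le_sum fun h _ => ((hr h).2 (τ h)).2).trans ?_
  simp

theorem abs_pathReward_le {n : ℕ} {r : Fin n → S × A → ℝ} (hr : IsUnitReward r)
    (τ : Fin n → S × A) : |pathReward r τ| ≤ n := by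
  rw [abs_of_nonneg (pathReward_nonneg hr τ)]
  exact pathReward_le hr τ

theorem abs_pathReward_sub_le {n : ℕ} {r r' : Fin n → S × A → ℝ} {ρ : ℝ}
    (hρ : ∀ h x, |r h x - r' h x| ≤ ρ) (τ : Fin n → S × A) :
    |pathReward r τ - pathReward r' τ| ≤ n * ρ := by
  unfold pathReward
  rw [← Finset.sum_sub_distrib]
  refine (Finset.abs_sum_le_sum_abs _ _).trans
    ((Finset.sum_le_sum fun h _ => hρ h (τ h)).trans ?_)
  simp

theorem integrable_pathReward {n : ℕ} {r : Fin n → S × A → ℝ} (hr : IsUnitReward r)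
    (ν : Measure (Fin n → S × A)) [IsFiniteMeasure ν] : Integrable (pathReward r) ν :=
  Integrable.of_bound (measurable_pathReward hr).aestronglyMeasurable n
    (Filter.Eventually.of_forall (abs_pathReward_le hr))

theorem value_nonneg {H : ℕ} (M : MDP S A H) (π : Policy S A H) {r : Fin H → S × A → ℝ}
    (hr : IsUnitReward r) : 0 ≤ M.value π r := integral_nonneg (pathReward_nonneg hr)

theorem abs_value_sub_le {H : ℕ} (M : MDP S A H) (π : Policy S A H) {r r' : Fin H → S × A → ℝ}
    (hr : IsUnitReward r) (hr' : IsUnitReward r') {ρ : ℝ} (hρ : ∀ h x, |r h x - r' h x| ≤ ρ) :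
    |M.value π r - M.value π r'| ≤ H * ρ := by
  unfold MDP.value
  rw [← integral_sub (integrable_pathReward hr _) (integrable_pathReward hr' _)]
  have := norm_integral_le_of_norm_le_const (μ := M.trajLaw π) (C := H * ρ)
    (f := fun τ => pathReward r τ - pathReward r' τ)
    (Filter.Eventually.of_forall (abs_pathReward_sub_le hρ))
  simpa using this

/-- The expected cumulative reward over `n` steps from a given state. -/
def trajValue (n : ℕ) (P : Fin n → Kernel (S × A) S) (π : Fin n → Kernel S A)
    (r : Fin n → S × A → ℝ) (s : S) : ℝ :=
  ∫ τ, pathReward r τ ∂(trajKernel n P π s)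

theorem trajValue_nonneg {n : ℕ} (P : Fin n → Kernel (S × A) S) (π : Fin n → Kernel S A)
    {r : Fin n → S × A → ℝ} (hr : IsUnitReward r) (s : S) : 0 ≤ trajValue n P π r s :=
  integral_nonneg (pathReward_nonneg hr)

theorem trajValue_le {n : ℕ} (P : Fin n → Kernel (S × A) S) (π : Fin n → Kernel S A)
    (hP : ∀ h, IsMarkovKernel (P h)) (hπ : ∀ h, IsMarkovKernel (π h))
    {r : Fin n → S × A → ℝ} (hr : IsUnitReward r) (s : S) : trajValue n P π r s ≤ n := by
  have := isMarkovKernel_trajKernel n P π hP hπ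
  refine (integral_mono (integrable_pathReward hr _) (integrable_const _)
    (pathReward_le hr)).trans ?_
  simp

/-- The length is a variable `m` with `m = n + 1` because the lemma is applied at lengths such as `H
- (h + 1)`, which are successors only up to a proof. -/
theorem trajValue_succ {m n : ℕ} (hmn : m = n + 1) (P : Fin m → Kernel (S × A) S)
    (π : Fin m → Kernel S A) (hP : ∀ h, IsMarkovKernel (P h))
    (hπ : ∀ h, IsMarkovKernel (π h)) {r : Fin m → S × A → ℝ} (hr : IsUnitReward r) (s : S) :
    trajValue m P π r s = ∫ a, (r ⟨0, by omega⟩ (s, a) +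
      ∫ s', trajValue n (fun j => P ⟨j + 1, by omega⟩) (fun j => π ⟨j + 1, by omega⟩)
        (fun j => r ⟨j + 1, by omega⟩) s' ∂(P ⟨0, by omega⟩ (s, a))) ∂(π ⟨0, by omega⟩ s) := by
  subst hmn
  have hM := isMarkovKernel_trajKernel n (fun j => P j.succ) (fun j => π j.succ)
      (fun j => hP _) (fun j => hπ _)
  have := hP 0
  have hr' : IsUnitReward (fun j : Fin n => r j.succ) := fun j => hr j.succ
  unfold trajValue
  rw [integral_trajKernel_succ P π hP hπ (measurable_pathReward hr) (abs_pathReward_le hr)]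
  refine integral_congr_ae (Filter.Eventually.of_forall fun a => ?_)
  have h1 : ∀ s', ∫ τ, pathReward r (Fin.cons (s, a) τ)
      ∂(trajKernel n (fun j => P j.succ) (fun j => π j.succ) s') = r 0 (s, a) +
      ∫ τ, pathReward (fun j : Fin n => r j.succ) τ
      ∂(trajKernel n (fun j => P j.succ) (fun j => π j.succ) s') := fun s' => by
    simp only [pathReward, Fin.sum_univ_succ, Fin.cons_zero, Fin.cons_succ]
    exact (integral_add (integrable_const _) (integrable_pathReward hr' _)).trans (by simp [pathReward])
  simp only [h1]
  refine (integral_add (integrable_const _) ?_).trans ?_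
  · refine Integrable.of_bound (C := n) ?_ (Filter.Eventually.of_forall fun s' => ?_)
    · exact (StronglyMeasurable.integral_kernel_prod_right'
        (κ := trajKernel n (fun j => P j.succ) (fun j => π j.succ))
        (f := fun p : S × (Fin n → S × A) => pathReward (fun j : Fin n => r j.succ) p.2)
        ((measurable_pathReward hr').comp measurable_snd).stronglyMeasurable).aestronglyMeasurable
    · have h2 := trajValue_nonneg (fun j : Fin n => P j.succ) (fun j => π j.succ) hr' s'
      have h3 := trajValue_le (fun j : Fin n => P j.succ) (fun j => π j.succ)
        (fun j => hP _) (fun j => hπ _) hr' s'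
      exact (abs_of_nonneg h2).trans_le h3
  · simp; rfl

theorem qValue_eq {H : ℕ} (M : MDP S A H) (π : Policy S A H) (r : Fin H → S × A → ℝ)
    (h : Fin H) (x : S × A) : M.qValue π r h x = r h x +
      ∫ s', trajValue _ (tailFrom h M.P) (tailFrom h π.kernel) (tailFrom h r) s' ∂(M.P h x) := rfl

theorem tailFrom_succ {H : ℕ} {X : Type*} (f : Fin H → X) (h : Fin H) (hh : h.1 + 1 < H) :
    (fun j : Fin (H - (h.1 + 1 + 1)) => tailFrom h f ⟨j.1 + 1, by omega⟩) =
      tailFrom (⟨h.1 + 1, hh⟩ : Fin H) f := by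
  funext j
  exact congrArg f (Fin.ext (by simp only []; omega))

theorem tailFrom_zero {H : ℕ} {X : Type*} (f : Fin H → X) (hi : 0 < H) :
    (fun j : Fin (H - (0 + 1)) => f ⟨j.1 + 1, by omega⟩) = tailFrom (⟨0, hi⟩ : Fin H) f := by
  funext j
  exact congrArg f (Fin.ext (by simp only []; omega))

theorem trajValue_tailFrom {H : ℕ} (M : MDP S A H) (π : Policy S A H) {r : Fin H → S × A → ℝ}
    (hr : IsUnitReward r) (h : Fin H) (hh : h.1 + 1 < H) (s : S) :
    trajValue _ (tailFrom h M.P) (tailFrom h π.kernel) (tailFrom h r) s =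
      ∫ a, M.qValue π r ⟨h.1 + 1, hh⟩ (s, a) ∂(π.kernel ⟨h.1 + 1, hh⟩ s) := by
  have e : H - (h.1 + 1) = (H - (h.1 + 1 + 1)) + 1 := by omega
  rw [trajValue_succ e (tailFrom h M.P) (tailFrom h π.kernel) (fun _ => M.markov _)
    (fun _ => π.markov _) (hr.tailFrom h)]
  rw [tailFrom_succ M.P h hh, tailFrom_succ π.kernel h hh, tailFrom_succ r h hh]
  rfl

theorem trajValue_tailFrom_last {H : ℕ} (M : MDP S A H) (π : Policy S A H)
    (r : Fin H → S × A → ℝ) (h : Fin H) (hh : ¬ h.1 + 1 < H) (s : S) :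
    trajValue _ (tailFrom h M.P) (tailFrom h π.kernel) (tailFrom h r) s = 0 := by
  have : IsEmpty (Fin (H - (h.1 + 1))) := by
    rw [show H - (h.1 + 1) = 0 by omega]; infer_instance
  simp [trajValue, pathReward]

theorem value_eq_integral_qValue {H : ℕ} (M : MDP S A H) (π : Policy S A H)
    {r : Fin H → S × A → ℝ} (hr : IsUnitReward r) (h : Fin H) (h0 : h.1 = 0) :
    M.value π r = ∫ a, M.qValue π r h (M.s₁, a) ∂(π.kernel h M.s₁) := by
  obtain ⟨i, hi⟩ := h
  simp only at h0
  subst h0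
  have e : H = (H - (0 + 1)) + 1 := by omega
  have := trajValue_succ e M.P π.kernel M.markov π.markov hr M.s₁
  refine Eq.trans this ?_
  rw [tailFrom_zero M.P hi, tailFrom_zero π.kernel hi, tailFrom_zero r hi]
  rfl

theorem qValue_nonneg {H : ℕ} (M : MDP S A H) (π : Policy S A H) {r : Fin H → S × A → ℝ}
    (hr : IsUnitReward r) (h : Fin H) (x : S × A) : 0 ≤ M.qValue π r h x :=
  add_nonneg ((hr h).2 x).1 (integral_nonneg fun _ => trajValue_nonneg _ _ (hr.tailFrom h) _)

/-- A crude bound, needed only so that the supremum defining `optQ` is over a bounded set. -/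
theorem qValue_le {H : ℕ} (M : MDP S A H) (π : Policy S A H) {r : Fin H → S × A → ℝ}
    (hr : IsUnitReward r) (h : Fin H) (x : S × A) : M.qValue π r h x ≤ 1 + H := by
  have := M.markov h
  refine add_le_add ((hr h).2 x).2 ?_
  refine (integral_mono_of_nonneg (g := fun _ => (H : ℝ)) (Filter.Eventually.of_forall fun _ =>
    trajValue_nonneg _ _ (hr.tailFrom h) _) (integrable_const _)
    (Filter.Eventually.of_forall fun s => ?_)).trans (by simp)
  refine (trajValue_le _ _ (fun _ => M.markov _) (fun _ => π.markov _) (hr.tailFrom h) s).trans ?_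
  simp only [Nat.cast_le]
  exact Nat.sub_le _ _

theorem qValue_le_optQ {H : ℕ} (M : MDP S A H) (π : Policy S A H) {r : Fin H → S × A → ℝ}
    (hr : IsUnitReward r) (h : Fin H) (x : S × A) : M.qValue π r h x ≤ M.optQ r h x :=
  le_ciSup (f := fun π => M.qValue π r h x)
    ⟨1 + H, by rintro _ ⟨π, rfl⟩; exact qValue_le M π hr h x⟩ π

theorem iSup_eq_of_isMax {α : Type*} {f : α → ℝ} {a : α} (h : ∀ b, f b ≤ f a) : ⨆ b, f b = f a :=
  le_antisymm (@ciSup_le _ _ _ ⟨a⟩ _ _ h) (le_ciSup ⟨f a, by rintro _ ⟨b, rfl⟩; exact h b⟩ a)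

section QClass

variable {H : ℕ} {R 𝒬 : Fin H → Set (S × A → ℝ)}

theorem IsQClass.le_iSup (h𝒬 : IsQClass 𝒬) {h : Fin H} {q : S × A → ℝ} (hq : q ∈ 𝒬 h) (s : S)
    (a : A) : q (s, a) ≤ ⨆ a', q (s, a') := by
  obtain ⟨g, -, hg⟩ := (h𝒬 h q hq).2.2
  rw [iSup_eq_of_isMax (hg s)]; exact hg s a

theorem IsQClass.measurable_iSup (h𝒬 : IsQClass 𝒬) {h : Fin H} {q : S × A → ℝ} (hq : q ∈ 𝒬 h) :
    Measurable fun s => ⨆ a, q (s, a) := by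
  obtain ⟨g, hgm, hg⟩ := (h𝒬 h q hq).2.2
  simp only [fun s => iSup_eq_of_isMax (hg s)]
  exact (h𝒬 h q hq).1.comp (measurable_id.prodMk hgm)

theorem IsQClass.iSup_mem (h𝒬 : IsQClass 𝒬) {h : Fin H} {q : S × A → ℝ} (hq : q ∈ 𝒬 h) (s : S) :
    ⨆ a, q (s, a) ∈ Set.Icc (0 : ℝ) H := by
  obtain ⟨g, hgm, hg⟩ := (h𝒬 h q hq).2.2
  rw [iSup_eq_of_isMax (hg s)]
  exact (h𝒬 h q hq).2.1 _

theorem IsQClass.abs_iSup_sub_le (h𝒬 : IsQClass 𝒬) {h : Fin H} {q q' : S × A → ℝ} (hq : q ∈ 𝒬 h)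
    (hq' : q' ∈ 𝒬 h) {ρ : ℝ} (hρ : ∀ x, |q x - q' x| ≤ ρ) (s : S) :
    |(⨆ a, q (s, a)) - ⨆ a, q' (s, a)| ≤ ρ := by
  obtain ⟨g, -, hg⟩ := (h𝒬 h q hq).2.2
  obtain ⟨g', -, hg'⟩ := (h𝒬 h q' hq').2.2
  rw [iSup_eq_of_isMax (hg s), iSup_eq_of_isMax (hg' s), abs_le]
  have h1 := abs_le.1 (hρ (s, g s))
  have h2 := abs_le.1 (hρ (s, g' s))
  constructor
  · linarith [hg s (g' s)]
  · linarith [hg' s (g s)]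

/-- `max_a Q_{h+1}(s, a)`, with the convention `Q_{H+1} = 0`. -/
def nextV (Q : Fin H → S × A → ℝ) (h : Fin H) (s : S) : ℝ := ⨆ a, nextQ Q h (s, a)

theorem nextV_of_lt (Q : Fin H → S × A → ℝ) (h : Fin H) (hh : h.1 + 1 < H) :
    nextV Q h = fun s => ⨆ a, Q ⟨h.1 + 1, hh⟩ (s, a) := by
  funext s; simp [nextV, nextQ, hh]

theorem nextV_of_not_lt (Q : Fin H → S × A → ℝ) (h : Fin H) (hh : ¬ h.1 + 1 < H) :
    nextV Q h = fun _ => 0 := by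
  funext s; simp [nextV, nextQ, hh]

theorem IsQClass.measurable_nextV (h𝒬 : IsQClass 𝒬) {Q : Fin H → S × A → ℝ}
    (hQ : ∀ h, Q h ∈ 𝒬 h) (h : Fin H) : Measurable (nextV Q h) := by
  by_cases hh : h.1 + 1 < H
  · rw [nextV_of_lt Q h hh]; exact h𝒬.measurable_iSup (hQ _)
  · rw [nextV_of_not_lt Q h hh]; exact measurable_const

theorem IsQClass.nextV_mem (h𝒬 : IsQClass 𝒬) {Q : Fin H → S × A → ℝ}
    (hQ : ∀ h, Q h ∈ 𝒬 h) (h : Fin H) (s : S) : nextV Q h s ∈ Set.Icc (0 : ℝ) H := by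
  by_cases hh : h.1 + 1 < H
  · rw [nextV_of_lt Q h hh]; exact h𝒬.iSup_mem (hQ _) s
  · rw [nextV_of_not_lt Q h hh]; simp

theorem IsQClass.abs_nextV_sub_le (h𝒬 : IsQClass 𝒬) {Q Q' : Fin H → S × A → ℝ}
    (hQ : ∀ h, Q h ∈ 𝒬 h) (hQ' : ∀ h, Q' h ∈ 𝒬 h) {ρ : ℝ} (hρ0 : 0 ≤ ρ)
    (hρ : ∀ h x, |Q h x - Q' h x| ≤ ρ) (h : Fin H) (s : S) :
    |nextV Q h s - nextV Q' h s| ≤ ρ := by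
  by_cases hh : h.1 + 1 < H
  · rw [nextV_of_lt Q h hh, nextV_of_lt Q' h hh]
    exact h𝒬.abs_iSup_sub_le (hQ _) (hQ' _) (hρ _) s
  · rw [nextV_of_not_lt Q h hh, nextV_of_not_lt Q' h hh]; simpa

theorem bellman_eq (M : MDP S A H) (r Q : Fin H → S × A → ℝ) (h : Fin H) (x : S × A) :
    M.bellman r Q h x = r h x + ∫ s, nextV Q h s ∂(M.P h x) := rfl

theorem IsQClass.integrable_nextV (h𝒬 : IsQClass 𝒬) {Q : Fin H → S × A → ℝ}
    (hQ : ∀ h, Q h ∈ 𝒬 h) (h : Fin H) (ν : Measure S) [IsFiniteMeasure ν] :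
    Integrable (nextV Q h) ν :=
  Integrable.of_bound (h𝒬.measurable_nextV hQ h).aestronglyMeasurable H
    (Filter.Eventually.of_forall fun s => by
      rw [Real.norm_eq_abs, abs_of_nonneg (h𝒬.nextV_mem hQ h s).1]; exact (h𝒬.nextV_mem hQ h s).2)

/-- A policy does no better than the optimal Q-value function, one step ahead. -/
theorem qValue_le_bellman_optQ (h𝒬 : IsQClass 𝒬) (M : MDP S A H) {r : Fin H → S × A → ℝ}
    (hr : IsUnitReward r) (hopt : ∀ h, M.optQ r h ∈ 𝒬 h) (π : Policy S A H) (h : Fin H)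
    (x : S × A) : M.qValue π r h x ≤ M.bellman r (M.optQ r) h x := by
  have := M.markov h
  rw [qValue_eq, bellman_eq]
  refine add_le_add le_rfl ?_
  refine integral_mono_of_nonneg (Filter.Eventually.of_forall fun _ =>
    trajValue_nonneg _ _ (hr.tailFrom h) _) (h𝒬.integrable_nextV hopt h _)
    (Filter.Eventually.of_forall fun s => ?_)
  by_cases hh : h.1 + 1 < H
  · rw [trajValue_tailFrom M π hr h hh, nextV_of_lt _ h hh]
    have := π.markov ⟨h.1 + 1, hh⟩
    refine (integral_mono_of_nonneg (Filter.Eventually.of_forall fun _ => qValue_nonneg M π hr _ _)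
      (integrable_const _) (Filter.Eventually.of_forall fun a =>
      (qValue_le_optQ M π hr _ _).trans (h𝒬.le_iSup (hopt _) s a))).trans ?_
    simp
  · rw [trajValue_tailFrom_last M π r h hh, nextV_of_not_lt _ h hh]

/-- The optimal Q-value function is a fixed point of the Bellman operator. -/
theorem optQ_eq_bellman (h𝒬 : IsQClass 𝒬) (M : MDP S A H) {r : Fin H → S × A → ℝ}
    (hr : IsUnitReward r) (hopt : ∀ h, M.optQ r h ∈ 𝒬 h) (h : Fin H) :
    M.optQ r h = M.bellman r (M.optQ r) h := by
  choose g hgm hg using fun h => (h𝒬 h _ (hopt h)).2.2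
  let π : DetPolicy S A H := ⟨g, hgm⟩
  -- A real supremum over an empty type would be `0`; the greedy policy of `optQ`, measurable
  -- because `optQ` lies in the class, shows that policies exist.
  have hle : ∀ h x, M.optQ r h x ≤ M.bellman r (M.optQ r) h x := fun h x =>
    @ciSup_le _ _ _ ⟨π.toPolicy⟩ _ _ fun π => qValue_le_bellman_optQ h𝒬 M hr hopt π h x
  -- Backward induction on the number of remaining steps: the policy greedy for `optQ` attains the
  -- Bellman backup of `optQ`, and hence the supremum, at every step simultaneously.
  have key : ∀ k (h : Fin H), H - h.1 = k → ∀ x,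
      M.qValue π.toPolicy r h x = M.bellman r (M.optQ r) h x := by
    intro k
    induction k with
    | zero => intro h hk; omega
    | succ k ih =>
      intro h hk x
      rw [qValue_eq, bellman_eq]
      congr 2
      funext s
      by_cases hh : h.1 + 1 < H
      · have e : ∀ a, M.qValue π.toPolicy r ⟨h.1 + 1, hh⟩ (s, a) =
            M.optQ r ⟨h.1 + 1, hh⟩ (s, a) := fun a =>
          le_antisymm (qValue_le_optQ M _ hr _ _)
            ((hle _ _).trans (ih ⟨h.1 + 1, hh⟩ (by simp only; omega) _).ge)
        rw [trajValue_tailFrom M _ hr h hh, nextV_of_lt _ h hh]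
        simp only [e]
        rw [iSup_eq_of_isMax (hg _ s)]
        have hmeas : Measurable fun a => M.optQ r ⟨h.1 + 1, hh⟩ (s, a) :=
          (h𝒬 _ _ (hopt _)).1.comp measurable_prodMk_left
        exact (integral_dirac' (fun a => M.optQ r ⟨h.1 + 1, hh⟩ (s, a)) _
          hmeas.stronglyMeasurable)
      · rw [trajValue_tailFrom_last M _ r h hh, nextV_of_not_lt _ h hh]
  funext x
  exact le_antisymm (hle h x) ((key _ h rfl x).ge.trans (qValue_le_optQ M _ hr h x))

theorem value_le_iSup_optQ (h𝒬 : IsQClass 𝒬) (M : MDP S A H) {r : Fin H → S × A → ℝ}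
    (hr : IsUnitReward r) (hopt : ∀ h, M.optQ r h ∈ 𝒬 h) (π : Policy S A H) (h : Fin H)
    (h0 : h.1 = 0) : M.value π r ≤ ⨆ a, M.optQ r h (M.s₁, a) := by
  have := π.markov h
  rw [value_eq_integral_qValue M π hr h h0]
  refine (integral_mono_of_nonneg (Filter.Eventually.of_forall fun _ => qValue_nonneg M π hr _ _)
      (integrable_const _) (Filter.Eventually.of_forall fun a =>
      (qValue_le_optQ M π hr _ _).trans (h𝒬.le_iSup (hopt _) M.s₁ a))).trans ?_
  simp

end QClass

end

/-! ### Exponential moments and products along a filtration. -/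

section

section CondLaw

variable {Ω T : Type*}

/-- From `exp x ≤ 1 + x + x²` on `|x| ≤ 1`, the moment generating function is at most `1 + (mean +
second moment) ≤ exp c`. All the concentration bounds below come from this estimate. -/
theorem lintegral_exp_sub_le_one [MeasurableSpace T] (ν : Measure T) [IsProbabilityMeasure ν]
    {f : T → ℝ} (hf : Measurable f) (hf1 : ∀ t, |f t| ≤ 1) {c : ℝ}
    (hc : ∫ t, f t ∂ν + ∫ t, f t ^ 2 ∂ν ≤ c) :
    ∫⁻ t, ENNReal.ofReal (Real.exp (f t - c)) ∂ν ≤ 1 := by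
  have hi : Integrable f ν :=
    Integrable.of_bound hf.aestronglyMeasurable 1 (Filter.Eventually.of_forall hf1)
  have hi2 : Integrable (fun t => f t ^ 2) ν :=
    Integrable.of_bound (hf.pow_const 2).aestronglyMeasurable 1
      (Filter.Eventually.of_forall fun t => by
        rw [Real.norm_eq_abs, abs_pow]; exact pow_le_one₀ (abs_nonneg _) (hf1 t))
  have hi3 : Integrable (fun t => 1 + f t + f t ^ 2) ν := ((integrable_const _).add hi).add hi2
  have h0 : ∀ t, Real.exp (f t) ≤ 1 + f t + f t ^ 2 := fun t => by
    have := (abs_le.1 (Real.abs_exp_sub_one_sub_id_le (hf1 t))).2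
    linarith
  have h0' : ∀ t, 0 ≤ 1 + f t + f t ^ 2 := fun t => (Real.exp_pos _).le.trans (h0 t)
  have h1 : ∫ t, (1 + f t + f t ^ 2) ∂ν ≤ Real.exp c := by
    rw [integral_add (f := fun t => 1 + f t) ((integrable_const _).add hi) hi2,
      integral_add (integrable_const _) hi]
    simp only [integral_const, probReal_univ, smul_eq_mul, one_mul]
    linarith [Real.add_one_le_exp c]
  calc ∫⁻ t, ENNReal.ofReal (Real.exp (f t - c)) ∂ν
      = ∫⁻ t, ENNReal.ofReal (Real.exp (-c)) * ENNReal.ofReal (Real.exp (f t)) ∂ν := by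
        refine lintegral_congr fun t => ?_
        rw [← ENNReal.ofReal_mul (Real.exp_pos _).le, ← Real.exp_add]; ring_nf
    _ = ENNReal.ofReal (Real.exp (-c)) * ∫⁻ t, ENNReal.ofReal (Real.exp (f t)) ∂ν :=
        lintegral_const_mul _ (by fun_prop)
    _ ≤ ENNReal.ofReal (Real.exp (-c)) * ∫⁻ t, ENNReal.ofReal (1 + f t + f t ^ 2) ∂ν := by
        gcongr with t; exact h0 t
    _ = ENNReal.ofReal (Real.exp (-c)) * ENNReal.ofReal (∫ t, (1 + f t + f t ^ 2) ∂ν) := by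
        rw [ofReal_integral_eq_lintegral_ofReal hi3 (Filter.Eventually.of_forall h0')]
    _ ≤ ENNReal.ofReal (Real.exp (-c)) * ENNReal.ofReal (Real.exp c) := by gcongr
    _ = 1 := by rw [← ENNReal.ofReal_mul (Real.exp_pos _).le, ← Real.exp_add]; simp

theorem map_prodMk_eq_compProd {Ω' : Type*} [MeasurableSpace Ω] [MeasurableSpace Ω']
    [MeasurableSpace T] {μ : Measure Ω} [IsFiniteMeasure μ] {p : Ω → Ω'} (hp : Measurable p)
    {τ : Ω → T} (hτ : Measurable τ) (κ : Kernel Ω' T) [IsMarkovKernel κ]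
    (h : ∀ B E, MeasurableSet B → MeasurableSet E →
      μ (p ⁻¹' B ∩ τ ⁻¹' E) = ∫⁻ ω in p ⁻¹' B, κ (p ω) E ∂μ) :
    μ.map (fun ω => (p ω, τ ω)) = (μ.map p) ⊗ₘ κ := by
  refine Measure.ext_prod fun {B E} hB hE => ?_
  rw [Measure.map_apply (hp.prodMk hτ) (hB.prod hE), Measure.compProd_apply_prod hB hE,
    setLIntegral_map hB (κ.measurable_coe hE) hp, ← h B E hB hE]
  rfl

/-- The conditional law is an explicit kernel, so the joint law of `(ω, τ ω)`, with `ω` seen through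
the smaller `σ`-algebra `m`, is a composition product: it suffices to compare on rectangles, where
the claim is the defining property of conditional expectation. No regularity of `Ω` or `T` is
needed. -/
theorem lintegral_eq_of_condLaw {m mΩ : MeasurableSpace Ω} {mT : MeasurableSpace T}
    {μ : Measure Ω} [IsFiniteMeasure μ] (hm : m ≤ mΩ) {τ : Ω → T}
    (hτ : Measurable τ) {ν : Ω → Measure T} (hν : ∀ ω, IsProbabilityMeasure (ν ω))
    (hνm : Measurable[m] ν)
    (hlaw : ∀ E, MeasurableSet E → μ⟦τ ⁻¹' E | m⟧ =ᵐ[μ] fun ω => (ν ω).real E)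
    {F : Ω × T → ENNReal} (hF : Measurable[m.prod mT] F) :
    ∫⁻ ω, F (ω, τ ω) ∂μ = ∫⁻ ω, ∫⁻ t, F (ω, t) ∂(ν ω) ∂μ := by
  let κ : @Kernel Ω T m mT := @Kernel.mk Ω T m mT ν hνm
  have hκ : @IsMarkovKernel Ω T m mT κ := ⟨hν⟩
  have hp : @Measurable Ω Ω mΩ m id := fun s hs => hm s hs
  have key := @map_prodMk_eq_compProd Ω T Ω mΩ m mT μ _ id hp τ hτ κ hκ ?_
  · have h1 := @lintegral_map Ω (Ω × T) mΩ (m.prod mT) μ F (fun ω => (id ω, τ ω)) hF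
      (Measurable.prodMk hp hτ)
    have h2 := @Measure.lintegral_compProd Ω T m mT (@Measure.map Ω Ω mΩ m id μ) κ _ _ F hF
    have h3 := @lintegral_map Ω Ω mΩ m μ (fun ω => ∫⁻ t, F (ω, t) ∂(ν ω)) id
      (@Measurable.lintegral_kernel_prod_right' Ω T m mT κ _ F hF) hp
    have h4 : @lintegral (Ω × T) (m.prod mT)
        (@Measure.map Ω (Ω × T) mΩ (m.prod mT) (fun ω => (id ω, τ ω)) μ) F =
        ∫⁻ ω, ∫⁻ t, F (ω, t) ∂(ν ω) ∂μ := by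
      rw [key]; exact h2.trans h3
    exact h1.symm.trans h4
  · intro B E hB hE
    have hB' : MeasurableSet B := hm B hB
    have e1 := setIntegral_condExp (μ := μ) hm
      (f := (τ ⁻¹' E).indicator (fun _ => (1 : ℝ)))
      ((integrable_const _).indicator (hτ hE)) hB
    have e2 : ∫ ω in B, (ν ω).real E ∂μ = μ.real (B ∩ τ ⁻¹' E) := by
      rw [← setIntegral_congr_ae hB' ((hlaw E hE).mono fun ω hω _ => hω), e1,
        setIntegral_indicator (hτ hE)]
      simp
    have hmeas : Measurable fun ω => ν ω E :=
      ((Measure.measurable_coe hE).comp (hνm.mono hm le_rfl))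
    have e3 : ∫ ω in B, (ν ω).real E ∂μ = (∫⁻ ω in B, ν ω E ∂μ).toReal := by
      simp only [Measure.real]
      rw [integral_toReal hmeas.aemeasurable
        (Filter.Eventually.of_forall fun ω => measure_lt_top _ _)]
    have h1 : ∫⁻ ω in B, ν ω E ∂μ ≠ ⊤ := by
      refine ((setLIntegral_mono (g := fun _ => 1) measurable_const fun ω _ => prob_le_one).trans_lt ?_).ne
      simp
    exact ((ENNReal.toReal_eq_toReal_iff' h1 (measure_ne_top _ _)).1 (e3.symm.trans e2)).symm

/-- The product of conditionally sub-normalized factors has expectation at most one. -/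
theorem lintegral_prod_le_one {mΩ : MeasurableSpace Ω} {mT : MeasurableSpace T}
    {μ : Measure Ω} [IsProbabilityMeasure μ] {ℱ : Filtration ℕ mΩ} {τ : ℕ → Ω → T}
    {ν : ℕ → Ω → Measure T} {n : ℕ} (hτ : ∀ i < n, Measurable[ℱ (i + 1)] (τ i))
    (hν : ∀ i ω, IsProbabilityMeasure (ν i ω)) (hνm : ∀ i < n, Measurable[ℱ i] (ν i))
    (hlaw : ∀ i < n, ∀ E, MeasurableSet E →
      μ⟦τ i ⁻¹' E | ℱ i⟧ =ᵐ[μ] fun ω => (ν i ω).real E)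
    {G : ℕ → Ω × T → ENNReal} (hG : ∀ i < n, Measurable[(ℱ i).prod mT] (G i))
    (hG1 : ∀ i < n, ∀ ω, ∫⁻ t, G i (ω, t) ∂(ν i ω) ≤ 1) :
    Measurable[ℱ n] (fun ω => ∏ i ∈ Finset.range n, G i (ω, τ i ω)) ∧
      ∫⁻ ω, ∏ i ∈ Finset.range n, G i (ω, τ i ω) ∂μ ≤ 1 := by
  induction n with
  | zero =>
    refine ⟨?_, ?_⟩
    · simp only [Finset.range_zero, Finset.prod_empty]; exact @measurable_const _ _ _ (ℱ 0) _
    · simp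
  | succ n ih =>
    obtain ⟨ih1, ih2⟩ := ih (fun i hi => hτ i (by omega)) (fun i hi => hνm i (by omega))
      (fun i hi => hlaw i (by omega)) (fun i hi => hG i (by omega)) (fun i hi => hG1 i (by omega))
    have hle : ℱ n ≤ ℱ (n + 1) := ℱ.mono (Nat.le_succ n)
    have hid : @Measurable Ω Ω (ℱ (n + 1)) (ℱ n) id := fun s hs => hle s hs
    simp only [Finset.prod_range_succ]
    refine ⟨?_, ?_⟩
    · refine Measurable.fun_mul (ih1.mono hle le_rfl) ?_
      exact (hG n (by omega)).comp
        (Measurable.prodMk hid (hτ n (by omega)))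
    · have hτ' : Measurable (τ n) := (hτ n (by omega)).mono (ℱ.le _) le_rfl
      have hfst : @Measurable (Ω × T) Ω ((ℱ n).prod mT) (ℱ n) Prod.fst :=
        @measurable_fst Ω T (ℱ n) mT
      have hW : Measurable[(ℱ n).prod mT] (fun q : Ω × T =>
          (∏ i ∈ Finset.range n, G i (q.1, τ i q.1)) * G n q) :=
        Measurable.fun_mul (ih1.comp hfst) (hG n (by omega))
      -- The first `n` factors are known at time `n`, so integrating out `τ n` affects only the last
      -- factor, whose conditional mean is at most one.
      have := lintegral_eq_of_condLaw (ℱ.le n) hτ' (hν n) (hνm n (by omega)) (hlaw n (by omega)) hW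
      refine this.trans_le (le_trans (lintegral_mono fun ω => ?_) ih2)
      have hs : Measurable fun t => G n (ω, t) :=
        (hG n (by omega)).comp (@measurable_prodMk_left Ω T (ℱ n) mT ω)
      simp only
      rw [lintegral_const_mul _ hs]
      exact mul_le_of_le_one_right' (hG1 n (by omega) ω)

end CondLaw

end

/-! ### Concentration of the rollouts. -/

section

section Tools

/-- Markov's inequality, scaled for a sum of `c` exponentials of mean at most one: it performs a
union bound and produces the term `log (c / δ)` in one stroke. -/
theorem measure_ge_le_of_lintegral_le {Ω : Type*} [MeasurableSpace Ω] {μ : Measure Ω}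
    {Φ : Ω → ENNReal} (hΦ : AEMeasurable Φ μ) {c δ : ℝ} (hc : 0 < c) (hδ : 0 < δ)
    (h : ∫⁻ ω, Φ ω ∂μ ≤ ENNReal.ofReal c) :
    μ {ω | ENNReal.ofReal (c / δ) ≤ Φ ω} ≤ ENNReal.ofReal δ := by
  have hcd : 0 < c / δ := by positivity
  refine (meas_ge_le_lintegral_div hΦ (by simpa using hcd) ENNReal.ofReal_ne_top).trans ?_
  refine (ENNReal.div_le_div_right h _).trans ?_
  rw [← ENNReal.ofReal_div_of_pos hcd]
  apply le_of_eq
  congr 1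
  field_simp

theorem prod_ofReal_exp {ι : Type*} (s : Finset ι) (f : ι → ℝ) :
    ∏ i ∈ s, ENNReal.ofReal (Real.exp (f i)) = ENNReal.ofReal (Real.exp (∑ i ∈ s, f i)) := by
  rw [Real.exp_sum, ENNReal.ofReal_prod_of_nonneg fun i _ => (Real.exp_pos _).le]

theorem measurable_integral_of_measurable {Ω T : Type*} {m : MeasurableSpace Ω}
    {mT : MeasurableSpace T} {ν : Ω → Measure T} (hν : ∀ ω, IsProbabilityMeasure (ν ω))
    (hνm : Measurable ν) {f : Ω × T → ℝ} (hf : Measurable f) :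
    Measurable fun ω => ∫ t, f (ω, t) ∂(ν ω) := by
  let κ : Kernel Ω T := ⟨ν, hνm⟩
  have : IsMarkovKernel κ := ⟨hν⟩
  exact (StronglyMeasurable.integral_kernel_prod_right' (κ := κ) hf.stronglyMeasurable).measurable

end Tools

variable {S A : Type*} [MeasurableSpace S] [MeasurableSpace A]
variable {Ω : Type*} [mΩ : MeasurableSpace Ω] {μ : Measure Ω} {H : ℕ} {M : MDP S A H}
  {R 𝒬 : Fin H → Set (S × A → ℝ)} {πE π₀ : Policy S A H} {N K : ℕ}

/-- The policy that generates the trajectory `τ^i`. -/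
def Run.rollout (run : Run μ M R 𝒬 πE π₀ N K) (i : ℕ) (ω : Ω) : Policy S A H :=
  if i = 0 then π₀ else (run.greedy i ω).toPolicy

/-- The conditional law of the trajectory `τ^i`. -/
def Run.law (run : Run μ M R 𝒬 πE π₀ N K) (i : ℕ) (ω : Ω) : Measure (Fin H → S × A) :=
  M.trajLaw (run.rollout i ω)

instance (run : Run μ M R 𝒬 πE π₀ N K) (i : ℕ) (ω : Ω) : IsProbabilityMeasure (run.law i ω) := by
  unfold Run.law; infer_instance

theorem Run.law_of_pos (run : Run μ M R 𝒬 πE π₀ N K) {i : ℕ} (hi : 0 < i) (ω : Ω) :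
    run.law i ω = M.trajLaw (run.greedy i ω).toPolicy := by
  simp [Run.law, Run.rollout, hi.ne']

theorem Run.measurable_law (run : Run μ M R 𝒬 πE π₀ N K) {i : ℕ} (hi : i < K + 1) :
    Measurable[run.ℱ i] (run.law i) := by
  obtain rfl | hi0 := Nat.eq_zero_or_pos i
  · have : run.law 0 = fun _ => M.trajLaw π₀ := by funext ω; simp [Run.law, Run.rollout]
    rw [this]
    exact @measurable_const _ _ _ (run.ℱ 0) _
  · have e : run.law i = fun ω => M.trajLaw (run.greedy i ω).toPolicy := by
      funext ω; exact run.law_of_pos hi0 ω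
    rw [e]
    have h1 := @measurable_trajKernel_deterministic S A _ _ Ω (run.ℱ i) H M.P M.markov
      (fun ω => (run.greedy i ω).act) (fun ω => (run.greedy i ω).measurable_act)
      (fun h => run.greedy_measurable i (by simp; omega) h)
    have h2 := h1.comp (@measurable_prodMk_right Ω S (run.ℱ i) _ M.s₁)
    simp only [MDP.trajLaw, DetPolicy.toPolicy]
    exact h2

theorem Run.condExp_law (run : Run μ M R 𝒬 πE π₀ N K) {i : ℕ} (hi : i < K + 1)
    (E : Set (Fin H → S × A)) (hE : MeasurableSet E) :
    μ⟦run.τ i ⁻¹' E | run.ℱ i⟧ =ᵐ[μ] fun ω => (run.law i ω).real E := by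
  obtain rfl | hi0 := Nat.eq_zero_or_pos i
  · simpa [Run.law, Run.rollout] using run.τ_law_zero E hE
  · simp only [run.law_of_pos hi0]
    exact run.τ_law i (by simp; omega) E hE

theorem Run.lintegral_prod_le_one [IsProbabilityMeasure μ] (run : Run μ M R 𝒬 πE π₀ N K) {n : ℕ}
    (hn : n ≤ K + 1) {G : ℕ → Ω × (Fin H → S × A) → ENNReal}
    (hG : ∀ i < n, Measurable[(run.ℱ i).prod MeasurableSpace.pi] (G i))
    (hG1 : ∀ i < n, ∀ ω, ∫⁻ t, G i (ω, t) ∂(run.law i ω) ≤ 1) :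
    Measurable (fun ω => ∏ i ∈ Finset.range n, G i (ω, run.τ i ω)) ∧
      ∫⁻ ω, ∏ i ∈ Finset.range n, G i (ω, run.τ i ω) ∂μ ≤ 1 := by
  have := OptAil.lintegral_prod_le_one (ℱ := run.ℱ) (τ := run.τ) (ν := run.law) (n := n) (G := G)
    (fun i hi => run.τ_measurable i (by omega)) (fun i ω => inferInstance)
    (fun i hi => run.measurable_law (by omega)) (fun i hi => run.condExp_law (by omega)) hG hG1
  exact ⟨this.1.mono (run.ℱ.le _) le_rfl, this.2⟩

/-- The sampled values concentrate around the values of the policies, for adapted rewards. -/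
theorem Run.measure_pathReward_deviation_le [IsProbabilityMeasure μ] (hR : IsRewardClass R)
    (hreal : RewardRealizable M R) (run : Run μ M R 𝒬 πE π₀ N K) {s δ : ℝ} (hs : 0 < s)
    (hsH : s * H ≤ 1) (hδ : 0 < δ) :
    μ {ω | K * s * H ^ 2 + Real.log (1 / δ) / s ≤ ∑ k ∈ Finset.Icc 1 K,
      ((pathReward M.reward (run.τ k ω) - pathReward (run.r k ω) (run.τ k ω)) -
        (M.value (run.greedy k ω).toPolicy M.reward -
          M.value (run.greedy k ω).toPolicy (run.r k ω)))} ≤ ENNReal.ofReal δ := by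
  have hrew : IsUnitReward M.reward := hR.isUnitReward hreal
  have hrk : ∀ k ∈ Finset.Icc 1 K, ∀ ω, IsUnitReward (run.r k ω) := fun k hk ω =>
    hR.isUnitReward (run.r_mem k hk ω)
  let F : ℕ → Ω × (Fin H → S × A) → ℝ := fun k p =>
    pathReward M.reward p.2 - pathReward (run.r k p.1) p.2
  have hFm : ∀ k ∈ Finset.Icc 1 K, Measurable[(run.ℱ k).prod MeasurableSpace.pi] (F k) := by
    intro k hk
    have h1 : Measurable[(run.ℱ k).prod MeasurableSpace.pi]
        fun p : Ω × (Fin H → S × A) => pathReward M.reward p.2 :=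
      (measurable_pathReward hrew).comp (@measurable_snd _ _ (run.ℱ k) _)
    have h2 : Measurable[(run.ℱ k).prod MeasurableSpace.pi]
        fun p : Ω × (Fin H → S × A) => pathReward (run.r k p.1) p.2 := by
      unfold pathReward
      refine Finset.measurable_sum _ fun h _ => ?_
      exact (run.r_measurable k hk h).comp (Measurable.prodMk (@measurable_fst _ _ (run.ℱ k) _)
        ((measurable_pi_apply h).comp (@measurable_snd _ _ (run.ℱ k) _)))
    exact h1.sub h2
  have hFb : ∀ k ∈ Finset.Icc 1 K, ∀ p, |F k p| ≤ H := fun k hk p => by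
    have a1 := pathReward_nonneg hrew p.2
    have a2 := pathReward_le hrew p.2
    have a3 := pathReward_nonneg (hrk k hk p.1) p.2
    have a4 := pathReward_le (hrk k hk p.1) p.2
    rw [abs_le]; constructor <;> simp only [F] <;> linarith
  -- The product over the filtration starts with `τ^0`, which does not enter the deviation; its
  -- factor is made trivial. The term `s² H²` bounds the second moment of `s F`.
  let Y : ℕ → Ω × (Fin H → S × A) → ℝ := fun k p => if k = 0 then 0 else
    s * F k p - (s * ∫ t, F k (p.1, t) ∂(run.law k p.1) + s ^ 2 * H ^ 2)
  have hmem : ∀ k, k < K + 1 → k ≠ 0 → k ∈ Finset.Icc 1 K := fun k h1 h2 => by simp; omega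
  have hG : ∀ k < K + 1, Measurable[(run.ℱ k).prod MeasurableSpace.pi]
      fun p => ENNReal.ofReal (Real.exp (Y k p)) := by
    intro k hk
    refine ENNReal.measurable_ofReal.comp (Real.measurable_exp.comp ?_)
    by_cases hk0 : k = 0
    · simp only [Y, hk0, if_true]; exact @measurable_const _ _ _ ((run.ℱ k).prod _) _
    · simp only [Y, hk0, if_false]
      have hk' := hmem k hk hk0
      refine Measurable.sub ((hFm k hk').const_mul s) (Measurable.add_const (Measurable.const_mul ?_ s) _)
      exact (@measurable_integral_of_measurable _ _ (run.ℱ k) _ _ (fun ω => inferInstance)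
        (run.measurable_law hk) _ (hFm k hk')).comp (@measurable_fst _ _ (run.ℱ k) _)
  have hG1 : ∀ k < K + 1, ∀ ω,
      ∫⁻ t, ENNReal.ofReal (Real.exp (Y k (ω, t))) ∂(run.law k ω) ≤ 1 := by
    intro k hk ω
    by_cases hk0 : k = 0
    · simp [Y, hk0]
    · simp only [Y, hk0, if_false]
      have hk' := hmem k hk hk0
      have hsec : Measurable fun t => F k (ω, t) :=
        (hFm k hk').comp (@measurable_prodMk_left Ω _ (run.ℱ k) _ ω)
      refine lintegral_exp_sub_le_one _ (f := fun t => s * F k (ω, t)) (hsec.const_mul s)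
        (fun t => ?_) ?_
      · rw [abs_mul, abs_of_pos hs]
        exact (mul_le_mul_of_nonneg_left (hFb k hk' _) hs.le).trans hsH
      · rw [integral_const_mul]
        gcongr
        refine (integral_mono_of_nonneg (Filter.Eventually.of_forall fun t => sq_nonneg _)
          (integrable_const (s ^ 2 * H ^ 2 : ℝ)) (Filter.Eventually.of_forall fun t => ?_)).trans
          (by simp)
        simp only [mul_pow]
        gcongr s ^ 2 * ?_
        exact sq_le_sq' (abs_le.1 (hFb k hk' _)).1 (abs_le.1 (hFb k hk' _)).2
  obtain ⟨hm, hle⟩ := run.lintegral_prod_le_one le_rfl hG hG1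
  simp only [prod_ofReal_exp] at hm hle
  refine le_trans (measure_mono fun ω hω => ?_) (measure_ge_le_of_lintegral_le hm.aemeasurable
    one_pos hδ (hle.trans (by simp)))
  simp only [Set.mem_ofPred_eq] at hω ⊢
  have e : ∑ i ∈ Finset.range (K + 1), Y i (ω, run.τ i ω) = s * ∑ k ∈ Finset.Icc 1 K,
    ((pathReward M.reward (run.τ k ω) - pathReward (run.r k ω) (run.τ k ω)) -
      (M.value (run.greedy k ω).toPolicy M.reward -
        M.value (run.greedy k ω).toPolicy (run.r k ω))) - K * (s ^ 2 * H ^ 2) := by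
    have e1 : Finset.range (K + 1) = insert 0 (Finset.Icc 1 K) := by
      ext i; simp; omega
    rw [e1, Finset.sum_insert (by simp), Finset.mul_sum]
    have e2 : (K : ℝ) * (s ^ 2 * H ^ 2) = ∑ k ∈ Finset.Icc 1 K, (s ^ 2 * H ^ 2 : ℝ) := by simp
    rw [e2, ← Finset.sum_sub_distrib]
    simp only [Y, if_true, zero_add]
    refine Finset.sum_congr rfl fun k hk => ?_
    have hk0 : 0 < k := by simp at hk; omega
    rw [if_neg hk0.ne', run.law_of_pos hk0]
    have : ∫ t, F k (ω, t) ∂(M.trajLaw (run.greedy k ω).toPolicy) =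
        M.value (run.greedy k ω).toPolicy M.reward -
        M.value (run.greedy k ω).toPolicy (run.r k ω) :=
      integral_sub (integrable_pathReward hrew _) (integrable_pathReward (hrk k hk ω) _)
    rw [this]
    simp only [F]; ring
  refine ENNReal.ofReal_le_ofReal ?_
  rw [e, ← Real.log_le_iff_le_exp (by positivity)]
  have := mul_le_mul_of_nonneg_left hω hs.le
  have e3 : s * (K * s * H ^ 2 + Real.log (1 / δ) / s) =
    K * (s ^ 2 * H ^ 2) + Real.log (1 / δ) := by field_simp
  linarith

end

/-! ### Fast-rate concentration of the Bellman errors. -/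

section

variable {S A : Type*} [MeasurableSpace S] [MeasurableSpace A]
variable {H : ℕ} {R 𝒬 : Fin H → Set (S × A → ℝ)}

theorem nextMax_eq (Q : Fin H → S × A → ℝ) (h : Fin H) (τ : Fin H → S × A) :
    nextMax Q h τ = if hh : h.1 + 1 < H then nextV Q h (τ ⟨h.1 + 1, hh⟩).1 else 0 := by
  unfold nextMax
  split_ifs with hh
  · rw [nextV_of_lt Q h hh]
  · rfl

theorem IsQClass.nextMax_mem (h𝒬 : IsQClass 𝒬) {Q : Fin H → S × A → ℝ} (hQ : ∀ h, Q h ∈ 𝒬 h)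
    (h : Fin H) (τ : Fin H → S × A) : nextMax Q h τ ∈ Set.Icc (0 : ℝ) H := by
  rw [nextMax_eq]
  split_ifs with hh
  · exact h𝒬.nextV_mem hQ h _
  · simp

theorem IsQClass.abs_nextMax_sub_le (h𝒬 : IsQClass 𝒬) {Q Q' : Fin H → S × A → ℝ}
    (hQ : ∀ h, Q h ∈ 𝒬 h) (hQ' : ∀ h, Q' h ∈ 𝒬 h) {ρ : ℝ} (hρ0 : 0 ≤ ρ)
    (hρ : ∀ h x, |Q h x - Q' h x| ≤ ρ) (h : Fin H) (τ : Fin H → S × A) :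
    |nextMax Q h τ - nextMax Q' h τ| ≤ ρ := by
  rw [nextMax_eq, nextMax_eq]
  split_ifs with hh
  · exact h𝒬.abs_nextV_sub_le hQ hQ' hρ0 hρ h _
  · simpa

theorem IsQClass.measurable_nextMax (h𝒬 : IsQClass 𝒬) {Q : Fin H → S × A → ℝ}
    (hQ : ∀ h, Q h ∈ 𝒬 h) (h : Fin H) : Measurable (nextMax Q h) := by
  have e : nextMax Q h = fun τ => if hh : h.1 + 1 < H then nextV Q h (τ ⟨h.1 + 1, hh⟩).1 else 0 :=
    funext (nextMax_eq Q h)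
  rw [e]
  split_ifs with hh
  · exact (h𝒬.measurable_nextV hQ h).comp (measurable_fst.comp (measurable_pi_apply _))
  · exact measurable_const

/-- The conditional mean of the maximal Q-value in the next step. -/
def MDP.nextMean (M : MDP S A H) (Q : Fin H → S × A → ℝ) (h : Fin H) (x : S × A) : ℝ :=
  ∫ s, nextV Q h s ∂(M.P h x)

theorem bellman_eq_add (M : MDP S A H) (r Q : Fin H → S × A → ℝ) (h : Fin H) (x : S × A) :
    M.bellman r Q h x = r h x + M.nextMean Q h x := rfl

theorem IsQClass.nextMean_mem (h𝒬 : IsQClass 𝒬) (M : MDP S A H) {Q : Fin H → S × A → ℝ}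
    (hQ : ∀ h, Q h ∈ 𝒬 h) (h : Fin H) (x : S × A) : M.nextMean Q h x ∈ Set.Icc (0 : ℝ) H := by
  have := M.markov h
  refine ⟨integral_nonneg fun s => (h𝒬.nextV_mem hQ h s).1, ?_⟩
  refine (integral_mono (h𝒬.integrable_nextV hQ h _) (integrable_const (H : ℝ))
    fun s => (h𝒬.nextV_mem hQ h s).2).trans (by simp)

theorem IsQClass.abs_nextMean_sub_le (h𝒬 : IsQClass 𝒬) (M : MDP S A H) {Q Q' : Fin H → S × A → ℝ}
    (hQ : ∀ h, Q h ∈ 𝒬 h) (hQ' : ∀ h, Q' h ∈ 𝒬 h) {ρ : ℝ} (hρ0 : 0 ≤ ρ)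
    (hρ : ∀ h x, |Q h x - Q' h x| ≤ ρ) (h : Fin H) (x : S × A) :
    |M.nextMean Q h x - M.nextMean Q' h x| ≤ ρ := by
  have := M.markov h
  unfold MDP.nextMean
  rw [← integral_sub (h𝒬.integrable_nextV hQ h _) (h𝒬.integrable_nextV hQ' h _)]
  have := norm_integral_le_of_norm_le_const (μ := M.P h x) (C := ρ)
    (f := fun s => nextV Q h s - nextV Q' h s)
    (Filter.Eventually.of_forall (h𝒬.abs_nextV_sub_le hQ hQ' hρ0 hρ h))
  simpa using this

/-- The Bellman noise `max_a Q_{h+1}(s_{h+1}, a) - E[max_a Q_{h+1}(s_{h+1}, a) | s_h, a_h]`. -/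
def MDP.noise (M : MDP S A H) (Q : Fin H → S × A → ℝ) (h : Fin H) (τ : Fin H → S × A) : ℝ :=
  nextMax Q h τ - M.nextMean Q h (τ h)

theorem IsQClass.abs_noise_le (h𝒬 : IsQClass 𝒬) (M : MDP S A H) {Q : Fin H → S × A → ℝ}
    (hQ : ∀ h, Q h ∈ 𝒬 h) (h : Fin H) (τ : Fin H → S × A) : |M.noise Q h τ| ≤ H := by
  have h1 := h𝒬.nextMax_mem hQ h τ
  have h2 := h𝒬.nextMean_mem M hQ h (τ h)
  rw [MDP.noise, abs_le]
  constructor <;> linarith [h1.1, h1.2, h2.1, h2.2]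

theorem IsQClass.measurable_nextMean (h𝒬 : IsQClass 𝒬) (M : MDP S A H) {Q : Fin H → S × A → ℝ}
    (hQ : ∀ h, Q h ∈ 𝒬 h) (h : Fin H) : Measurable (M.nextMean Q h) := by
  have := M.markov h
  exact (StronglyMeasurable.integral_kernel_prod_right' (κ := M.P h)
    (f := fun p : (S × A) × S => nextV Q h p.2)
    ((h𝒬.measurable_nextV hQ h).comp measurable_snd).stronglyMeasurable).measurable

theorem IsQClass.measurable_noise (h𝒬 : IsQClass 𝒬) (M : MDP S A H) {Q : Fin H → S × A → ℝ}
    (hQ : ∀ h, Q h ∈ 𝒬 h) (h : Fin H) : Measurable (M.noise Q h) :=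
  (h𝒬.measurable_nextMax hQ h).sub ((h𝒬.measurable_nextMean M hQ h).comp (measurable_pi_apply h))

theorem IsQClass.integral_mul_noise (h𝒬 : IsQClass 𝒬) (M : MDP S A H) (π : Policy S A H)
    {Q : Fin H → S × A → ℝ} (hQ : ∀ h, Q h ∈ 𝒬 h) (h : Fin H) {g : S × A → ℝ} (hg : Measurable g)
    {C : ℝ} (hgC : ∀ x, |g x| ≤ C) : ∫ τ, g (τ h) * M.noise Q h τ ∂(M.trajLaw π) = 0 := by
  by_cases hh : h.1 + 1 < H
  · have := integral_mul_next_sub M π h hh hg (h𝒬.measurable_nextV hQ h) hgC (D := H)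
      (fun s => by rw [abs_of_nonneg (h𝒬.nextV_mem hQ h s).1]; exact (h𝒬.nextV_mem hQ h s).2)
    simp only [MDP.noise, nextMax_eq, hh, dif_pos]
    exact this
  · have : ∀ τ, M.noise Q h τ = 0 := fun τ => by
      simp [MDP.noise, nextMax_eq, hh, MDP.nextMean, nextV_of_not_lt]
    simp [this]

/-- The excess squared loss of `q` over the Bellman backup of `Q`, on one trajectory. -/
def MDP.excess (M : MDP S A H) (q : S × A → ℝ) (r Q : Fin H → S × A → ℝ) (h : Fin H)
    (τ : Fin H → S × A) : ℝ :=
  (q (τ h) - r h (τ h) - nextMax Q h τ) ^ 2 -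
    (M.bellman r Q h (τ h) - r h (τ h) - nextMax Q h τ) ^ 2

/-- The Bellman residual of `q` against `Q`. -/
def MDP.resid (M : MDP S A H) (q : S × A → ℝ) (r Q : Fin H → S × A → ℝ) (h : Fin H)
    (x : S × A) : ℝ := q x - M.bellman r Q h x

/-- The reward cancels, and the cross term pairs the residual, a function of `(s_h, a_h)`, with
noise that is centered given `(s_h, a_h)`. The expected excess is therefore the expected squared
residual. -/
theorem excess_eq (M : MDP S A H) (q : S × A → ℝ) (r Q : Fin H → S × A → ℝ) (h : Fin H)
    (τ : Fin H → S × A) : M.excess q r Q h τ =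
      M.resid q r Q h (τ h) ^ 2 - 2 * (M.resid q r Q h (τ h) * M.noise Q h τ) := by
  simp only [MDP.excess, MDP.resid, MDP.noise, bellman_eq_add]
  ring

theorem IsQClass.abs_resid_le (h𝒬 : IsQClass 𝒬) (M : MDP S A H) {r Q : Fin H → S × A → ℝ}
    {h : Fin H} {q : S × A → ℝ} (hq : q ∈ 𝒬 h) (hB : M.bellman r Q h ∈ 𝒬 h) (x : S × A) :
    |M.resid q r Q h x| ≤ H := by
  have h1 := (h𝒬 h q hq).2.1 x
  have h2 := (h𝒬 h _ hB).2.1 x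
  rw [MDP.resid, abs_le]
  constructor <;> linarith [h1.1, h1.2, h2.1, h2.2]

theorem IsQClass.measurable_resid (h𝒬 : IsQClass 𝒬) (M : MDP S A H) {r Q : Fin H → S × A → ℝ}
    {h : Fin H} {q : S × A → ℝ} (hq : q ∈ 𝒬 h) (hB : M.bellman r Q h ∈ 𝒬 h) :
    Measurable (M.resid q r Q h) := (h𝒬 h q hq).1.sub (h𝒬 h _ hB).1

theorem abs_excess_le {g ξ b : ℝ} (hg : |g| ≤ b) (hξ : |ξ| ≤ b) :
    |g ^ 2 - 2 * (g * ξ)| ≤ 3 * b ^ 2 := by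
  have hb := (abs_nonneg _).trans hg
  have e : g ^ 2 - 2 * (g * ξ) = g * (g - 2 * ξ) := by ring
  rw [e, abs_mul]
  have : |g - 2 * ξ| ≤ 3 * b := by
    rw [abs_le] at *; constructor <;> linarith [hg.1, hg.2, hξ.1, hξ.2]
  calc |g| * |g - 2 * ξ| ≤ b * (3 * b) := mul_le_mul hg this (abs_nonneg _) hb
    _ = _ := by ring

/-- The excess is `g (g - 2ξ)`, so its square is controlled by `g²`, the very quantity that is its
mean. This self-bounding variance is the source of the fast rate. -/
theorem sq_excess_le {g ξ b : ℝ} (hg : |g| ≤ b) (hξ : |ξ| ≤ b) :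
    (g ^ 2 - 2 * (g * ξ)) ^ 2 ≤ 9 * b ^ 2 * g ^ 2 := by
  have e : (g ^ 2 - 2 * (g * ξ)) ^ 2 = g ^ 2 * (g - 2 * ξ) ^ 2 := by ring
  rw [e]
  have : |g - 2 * ξ| ≤ 3 * b := by
    rw [abs_le] at *; constructor <;> linarith [hg.1, hg.2, hξ.1, hξ.2]
  have h2 : (g - 2 * ξ) ^ 2 ≤ (3 * b) ^ 2 := sq_le_sq' (abs_le.1 this).1 (abs_le.1 this).2
  nlinarith [sq_nonneg g]

/-- With `v` the expected squared residual, scaling the excess by `-t` gives the exponent bound `-t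
v + 9 H² t² v`. The minimizer `t = 1 / (18 H²)` leaves `-v / (36 H²)`, half of the scaled mean. -/
theorem IsQClass.lintegral_exp_excess_le (h𝒬 : IsQClass 𝒬) (M : MDP S A H) (π : Policy S A H)
    {r Q : Fin H → S × A → ℝ} (hQ : ∀ h, Q h ∈ 𝒬 h) {h : Fin H}
    {q : S × A → ℝ} (hq : q ∈ 𝒬 h) (hB : M.bellman r Q h ∈ 𝒬 h) :
    ∫⁻ τ, ENNReal.ofReal (Real.exp (-(1 / (18 * (H : ℝ) ^ 2)) * M.excess q r Q h τ -
      -(1 / (36 * (H : ℝ) ^ 2) * ∫ τ', M.resid q r Q h (τ' h) ^ 2 ∂(M.trajLaw π))))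
        ∂(M.trajLaw π) ≤ 1 := by
  have hH : (0 : ℝ) < H := by exact_mod_cast h.pos
  have hgm := h𝒬.measurable_resid M hq hB
  have hg1 : ∀ τ : Fin H → S × A, |M.resid q r Q h (τ h)| ≤ H := fun τ =>
    h𝒬.abs_resid_le M hq hB (τ h)
  have hξ := h𝒬.abs_noise_le M hQ h
  have hξm := h𝒬.measurable_noise M hQ h
  have hgm' : Measurable fun τ : Fin H → S × A => M.resid q r Q h (τ h) :=
    hgm.comp (measurable_pi_apply h)
  have hEm : Measurable (M.excess q r Q h) := by
    rw [funext (excess_eq M q r Q h)]; fun_prop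
  have hEb : ∀ τ, |M.excess q r Q h τ| ≤ 3 * (H : ℝ) ^ 2 := fun τ => by
    rw [excess_eq]; exact abs_excess_le (hg1 τ) (hξ τ)
  have hv : Integrable (fun τ : Fin H → S × A => M.resid q r Q h (τ h) ^ 2) (M.trajLaw π) :=
    Integrable.of_bound (hgm'.pow_const 2).aestronglyMeasurable ((H : ℝ) ^ 2)
      (Filter.Eventually.of_forall fun τ => by
        rw [Real.norm_eq_abs, abs_pow]; exact pow_le_pow_left₀ (abs_nonneg _) (hg1 τ) 2)
  have hgξ : Integrable (fun τ : Fin H → S × A => M.resid q r Q h (τ h) * M.noise Q h τ)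
      (M.trajLaw π) :=
    Integrable.of_bound (hgm'.mul hξm).aestronglyMeasurable ((H : ℝ) * H)
      (Filter.Eventually.of_forall fun τ => by
        rw [Real.norm_eq_abs, abs_mul]
        exact mul_le_mul (hg1 τ) (hξ τ) (abs_nonneg _) hH.le)
  have e1 : ∫ τ, M.excess q r Q h τ ∂(M.trajLaw π) =
      ∫ τ, M.resid q r Q h (τ h) ^ 2 ∂(M.trajLaw π) := by
    simp only [excess_eq]
    rw [integral_sub hv (hgξ.const_mul 2), integral_const_mul,
      h𝒬.integral_mul_noise M π hQ h hgm (h𝒬.abs_resid_le M hq hB)]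
    simp
  refine lintegral_exp_sub_le_one _ (hEm.const_mul _) (fun τ => ?_) ?_
  · rw [abs_mul, abs_neg, abs_of_pos (by positivity), div_mul_eq_mul_div, one_mul,
      div_le_one (by positivity)]
    have := hEb τ
    nlinarith [sq_nonneg (H : ℝ)]
  · rw [integral_const_mul, e1]
    have h2 : ∫ τ, (-(1 / (18 * (H : ℝ) ^ 2)) * M.excess q r Q h τ) ^ 2 ∂(M.trajLaw π) ≤
        ∫ τ, 1 / (36 * (H : ℝ) ^ 2) * M.resid q r Q h (τ h) ^ 2 ∂(M.trajLaw π) := by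
      refine integral_mono_of_nonneg (Filter.Eventually.of_forall fun _ => sq_nonneg _)
        (hv.const_mul _) (Filter.Eventually.of_forall fun τ => ?_)
      have h3 := sq_excess_le (hg1 τ) (hξ τ)
      simp only [excess_eq, mul_pow]
      calc (-(1 / (18 * (H : ℝ) ^ 2))) ^ 2 *
            (M.resid q r Q h (τ h) ^ 2 - 2 * (M.resid q r Q h (τ h) * M.noise Q h τ)) ^ 2
          ≤ (-(1 / (18 * (H : ℝ) ^ 2))) ^ 2 * (9 * H ^ 2 * M.resid q r Q h (τ h) ^ 2) := by gcongr
        _ = 1 / (36 * (H : ℝ) ^ 2) * M.resid q r Q h (τ h) ^ 2 := by field_simp; ring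
    rw [integral_const_mul] at h2
    have e3 : (1 / (18 * (H : ℝ) ^ 2)) = 2 * (1 / (36 * (H : ℝ) ^ 2)) := by field_simp; norm_num
    refine (add_le_add le_rfl h2).trans (le_of_eq ?_)
    rw [e3]; ring

variable {Ω : Type*} [mΩ : MeasurableSpace Ω] {μ : Measure Ω} {M : MDP S A H}
  {πE π₀ : Policy S A H} {N K : ℕ}

/-- The squared Bellman residual in expectation over the law of the trajectory `τ^i`. -/
def Run.residMean (run : Run μ M R 𝒬 πE π₀ N K) (q : S × A → ℝ) (r Q : Fin H → S × A → ℝ)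
    (h : Fin H) (i : ℕ) (ω : Ω) : ℝ := ∫ t, M.resid q r Q h (t h) ^ 2 ∂(run.law i ω)

/-- Concentration of the excess squared loss, uniformly over a finite family. -/
theorem Run.measure_excess_deviation_le [IsProbabilityMeasure μ] (h𝒬 : IsQClass 𝒬)
    (run : Run μ M R 𝒬 πE π₀ N K) {ι : Type*} (C : Finset ι)
    (f r Q : ι → Fin H → S × A → ℝ) (hf : ∀ c ∈ C, ∀ h, f c h ∈ 𝒬 h)
    (hQ : ∀ c ∈ C, ∀ h, Q c h ∈ 𝒬 h)
    (hB : ∀ c ∈ C, ∀ h, M.bellman (r c) (Q c) h ∈ 𝒬 h) {δ : ℝ} (hδ : 0 < δ)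
    (hpos : 0 < K * H * C.card) :
    μ {ω | ∃ k ∈ Finset.Icc 1 K, ∃ h, ∃ c ∈ C,
      ∑ i ∈ Finset.range k, M.excess (f c h) (r c) (Q c) h (run.τ i ω) ≤
        1 / 2 * ∑ i ∈ Finset.range k, run.residMean (f c h) (r c) (Q c) h i ω -
          18 * H ^ 2 * Real.log (K * H * C.card / δ)} ≤ ENNReal.ofReal δ := by
  have hHn : 0 < H := by by_contra hc; simp at hc; subst hc; simp at hpos
  have hH : (0 : ℝ) < H := by exact_mod_cast hHn
  have hKHC : (0 : ℝ) < K * H * C.card := by exact_mod_cast hpos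
  let Y : Fin H → ι → ℕ → Ω × (Fin H → S × A) → ℝ := fun h c i p =>
    -(1 / (18 * (H : ℝ) ^ 2)) * M.excess (f c h) (r c) (Q c) h p.2 -
      -(1 / (36 * (H : ℝ) ^ 2) * run.residMean (f c h) (r c) (Q c) h i p.1)
  have key : ∀ k ∈ Finset.Icc 1 K, ∀ h, ∀ c ∈ C,
      Measurable (fun ω => ENNReal.ofReal (Real.exp
        (∑ i ∈ Finset.range k, Y h c i (ω, run.τ i ω)))) ∧
      ∫⁻ ω, ENNReal.ofReal (Real.exp (∑ i ∈ Finset.range k, Y h c i (ω, run.τ i ω))) ∂μ ≤ 1 := by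
    intro k hk h c hc
    have hkK : k ≤ K + 1 := by simp at hk; omega
    have hrm := h𝒬.measurable_resid M (hf c hc h) (hB c hc h)
    have hEm : Measurable (M.excess (f c h) (r c) (Q c) h) := by
      have hξm := h𝒬.measurable_noise M (hQ c hc) h
      have hgm' : Measurable fun τ : Fin H → S × A => M.resid (f c h) (r c) (Q c) h (τ h) :=
        hrm.comp (measurable_pi_apply h)
      rw [funext (excess_eq M (f c h) (r c) (Q c) h)]; fun_prop
    simp only [← prod_ofReal_exp]
    refine run.lintegral_prod_le_one hkK (G := fun i p => ENNReal.ofReal (Real.exp (Y h c i p)))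
      (fun i hi => ?_) (fun i hi ω => ?_)
    · refine ENNReal.measurable_ofReal.comp (Real.measurable_exp.comp ?_)
      have hv : Measurable[run.ℱ i] (run.residMean (f c h) (r c) (Q c) h i) :=
        @measurable_integral_of_measurable _ _ (run.ℱ i) _ _ (fun ω => inferInstance)
          (run.measurable_law (by omega)) (fun p => M.resid (f c h) (r c) (Q c) h (p.2 h) ^ 2)
          ((hrm.comp ((measurable_pi_apply h).comp (@measurable_snd _ _ (run.ℱ i) _))).pow_const 2)
      exact Measurable.sub ((hEm.comp (@measurable_snd _ _ (run.ℱ i) _)).const_mul _)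
        ((hv.comp (@measurable_fst _ _ (run.ℱ i) _)).const_mul _).neg
    · exact h𝒬.lintegral_exp_excess_le M (run.rollout i ω) (hQ c hc) (hf c hc h) (hB c hc h)
  -- The union bound over iterations, steps and family members is done inside the expectation: one
  -- Markov inequality for the sum of all `K H |C|` exponentials.
  have hΦm : Measurable fun ω => ∑ k ∈ Finset.Icc 1 K, ∑ h, ∑ c ∈ C,
      ENNReal.ofReal (Real.exp (∑ i ∈ Finset.range k, Y h c i (ω, run.τ i ω))) :=
    Finset.measurable_sum _ fun k hk => Finset.measurable_sum _ fun h _ =>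
      Finset.measurable_sum _ fun c hc => (key k hk h c hc).1
  have hΦ : ∫⁻ ω, ∑ k ∈ Finset.Icc 1 K, ∑ h, ∑ c ∈ C,
      ENNReal.ofReal (Real.exp (∑ i ∈ Finset.range k, Y h c i (ω, run.τ i ω))) ∂μ ≤
      ENNReal.ofReal (K * H * C.card) := by
    rw [lintegral_finsetSum _ fun k hk => Finset.measurable_sum _ fun h _ =>
      Finset.measurable_sum _ fun c hc => (key k hk h c hc).1]
    have : ∀ k ∈ Finset.Icc 1 K, ∫⁻ ω, ∑ h, ∑ c ∈ C,
      ENNReal.ofReal (Real.exp (∑ i ∈ Finset.range k, Y h c i (ω, run.τ i ω))) ∂μ ≤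
        (H * C.card : ENNReal) := fun k hk => by
      rw [lintegral_finsetSum _ fun h _ =>
        Finset.measurable_sum _ fun c hc => (key k hk h c hc).1]
      have : ∀ h ∈ (Finset.univ : Finset (Fin H)), ∫⁻ ω, ∑ c ∈ C,
        ENNReal.ofReal (Real.exp (∑ i ∈ Finset.range k, Y h c i (ω, run.τ i ω))) ∂μ ≤
          (C.card : ENNReal) := fun h _ => by
        rw [lintegral_finsetSum _ fun c hc => (key k hk h c hc).1]
        exact (Finset.sum_le_sum fun c hc => (key k hk h c hc).2).trans (by simp)
      exact (Finset.sum_le_sum this).trans (by simp)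
    refine (Finset.sum_le_sum this).trans (le_of_eq ?_)
    rw [ENNReal.ofReal_mul (by positivity), ENNReal.ofReal_mul (by positivity)]
    simp [mul_assoc]
  refine le_trans (measure_mono fun ω hω => ?_)
    (measure_ge_le_of_lintegral_le hΦm.aemeasurable hKHC hδ hΦ)
  obtain ⟨k, hk, h, c, hc, hω⟩ := hω
  have e : Real.log (K * H * C.card / δ) ≤ ∑ i ∈ Finset.range k, Y h c i (ω, run.τ i ω) := by
    simp only [Y]
    rw [Finset.sum_sub_distrib, ← Finset.mul_sum, Finset.sum_neg_distrib, ← Finset.mul_sum]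
    have h18 : (0 : ℝ) < 1 / (18 * (H : ℝ) ^ 2) := by positivity
    have := mul_le_mul_of_nonneg_left hω h18.le
    have e3 : 1 / (18 * (H : ℝ) ^ 2) * (1 / 2 * ∑ i ∈ Finset.range k,
        run.residMean (f c h) (r c) (Q c) h i ω - 18 * H ^ 2 * Real.log (K * H * C.card / δ)) =
        1 / (36 * (H : ℝ) ^ 2) * ∑ i ∈ Finset.range k,
        run.residMean (f c h) (r c) (Q c) h i ω - Real.log (K * H * C.card / δ) := by
      field_simp; ring
    linarith
  have e' : K * H * C.card / δ ≤ Real.exp (∑ i ∈ Finset.range k, Y h c i (ω, run.τ i ω)) :=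
    (Real.log_le_iff_le_exp (by positivity)).1 e
  refine (ENNReal.ofReal_le_ofReal e').trans ?_
  refine le_trans ?_ (Finset.single_le_sum (f := fun k => ∑ h, ∑ c ∈ C,
      ENNReal.ofReal (Real.exp (∑ i ∈ Finset.range k, Y h c i (ω, run.τ i ω))))
      (fun _ _ => zero_le) hk)
  refine le_trans ?_ (Finset.single_le_sum (f := fun h => ∑ c ∈ C,
      ENNReal.ofReal (Real.exp (∑ i ∈ Finset.range k, Y h c i (ω, run.τ i ω))))
      (fun _ _ => zero_le) (Finset.mem_univ h))
  exact Finset.single_le_sum (f := fun c =>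
      ENNReal.ofReal (Real.exp (∑ i ∈ Finset.range k, Y h c i (ω, run.τ i ω))))
      (fun _ _ => zero_le) hc

end

/-! ### Covers, discretization and the estimated Bellman error. -/

section

section Covering

variable {X : Type*}

/-- `F'` is a `ρ`-cover of `F` in sup-distance, with centers in `F`. -/
def IsCover (ρ : ℝ) (F : Set (X → ℝ)) (F' : Finset (X → ℝ)) : Prop :=
  (F' : Set (X → ℝ)) ⊆ F ∧ ∀ f ∈ F, ∃ f' ∈ F', ∀ x, |f x - f' x| ≤ ρ

theorem IsCover.coveringNumber_le {ρ : ℝ} {F : Set (X → ℝ)} {F' : Finset (X → ℝ)}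
    (h : IsCover ρ F F') : coveringNumber ρ F ≤ F'.card :=
  iInf_le_of_le F' (iInf_le_of_le h.1 (iInf_le_of_le h.2 le_rfl))

theorem IsCover.coveringNumber_ne_top {ρ : ℝ} {F : Set (X → ℝ)} {F' : Finset (X → ℝ)}
    (h : IsCover ρ F F') : coveringNumber ρ F ≠ ⊤ :=
  ne_top_of_le_ne_top (ENat.natCast_ne_top _) h.coveringNumber_le

theorem IsCover.covNum_le {ρ : ℝ} {F : Set (X → ℝ)} {F' : Finset (X → ℝ)}
    (h : IsCover ρ F F') : covNum ρ F ≤ F'.card := by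
  unfold covNum
  exact_mod_cast ENat.toNat_le_of_le_natCast h.coveringNumber_le

/-- The infimum defining the covering number is attained because its values are integers: some cover
has fewer than `coveringNumber ρ F + 1` elements. -/
theorem exists_isCover {ρ : ℝ} {F : Set (X → ℝ)} (h : coveringNumber ρ F ≠ ⊤) :
    ∃ F', IsCover ρ F F' ∧ (F'.card : ℝ) = covNum ρ F := by
  have h1 : ∃ F' : Finset (X → ℝ), IsCover ρ F F' ∧ (F'.card : ℕ∞) ≤ coveringNumber ρ F := by
    have hlt : coveringNumber ρ F < coveringNumber ρ F + 1 := ENat.lt_add_one_iff h |>.2 le_rfl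
    conv at hlt => lhs; unfold coveringNumber
    simp only [iInf_lt_iff] at hlt
    obtain ⟨F', hF, hc, hlt⟩ := hlt
    exact ⟨F', ⟨hF, hc⟩, (ENat.lt_add_one_iff h).1 hlt⟩
  obtain ⟨F', hF, hle⟩ := h1
  refine ⟨F', hF, ?_⟩
  have : coveringNumber ρ F = F'.card := le_antisymm hF.coveringNumber_le hle
  simp [covNum, this]

theorem one_le_covNum {ρ : ℝ} {F : Set (X → ℝ)} (h : coveringNumber ρ F ≠ ⊤) (hF : F.Nonempty) :
    1 ≤ covNum ρ F := by
  obtain ⟨F', hc, he⟩ := exists_isCover h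
  obtain ⟨f, hf⟩ := hF
  obtain ⟨f', hf', -⟩ := hc.2 f hf
  rw [← he]
  exact_mod_cast Finset.card_pos.2 ⟨f', hf'⟩

/-- If a single center suffices, then any two functions of the class are `2ρ`-close. -/
theorem abs_sub_le_of_covNum_lt_two {ρ : ℝ} {F : Set (X → ℝ)} (h : coveringNumber ρ F ≠ ⊤)
    (h2 : covNum ρ F < 2) {f g : X → ℝ} (hf : f ∈ F) (hg : g ∈ F) (x : X) :
    |f x - g x| ≤ 2 * ρ := by
  obtain ⟨F', hc, he⟩ := exists_isCover h
  rw [← he] at h2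
  have hcard : F'.card ≤ 1 := by
    have : F'.card < 2 := by exact_mod_cast h2
    omega
  obtain ⟨f', hf', hff⟩ := hc.2 f hf
  obtain ⟨g', hg', hgg⟩ := hc.2 g hg
  have := Finset.card_le_one.1 hcard f' hf' g' hg'
  subst this
  have h1 := abs_le.1 (hff x)
  have h2 := abs_le.1 (hgg x)
  rw [abs_le]; constructor <;> linarith [h1.1, h1.2, h2.1, h2.2]

variable {S A : Type*}

theorem exists_isCover_prodClass {H : ℕ} {ρ : ℝ} {F : Fin H → Set (S × A → ℝ)}
    (h : ∀ i, coveringNumber ρ (F i) ≠ ⊤) :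
    ∃ F', IsCover ρ (prodClass F) F' ∧ (F'.card : ℝ) ≤ ∏ i, covNum ρ (F i) := by
  classical
  choose C hC hcard using fun i => exists_isCover (h i)
  refine ⟨(Fintype.piFinset C).image fun c p => c p.1 p.2, ⟨?_, ?_⟩, ?_⟩
  · intro f hf
    simp only [Finset.coe_image, Set.mem_image, Finset.mem_coe, Fintype.mem_piFinset] at hf
    obtain ⟨c, hc, rfl⟩ := hf
    exact fun i => (hC i).1 (hc i)
  · intro f hf
    choose c hc hcf using fun i => (hC i).2 _ (hf i)
    exact ⟨fun p => c p.1 p.2, Finset.mem_image.2 ⟨c, Fintype.mem_piFinset.2 hc, rfl⟩,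
      fun p => hcf p.1 p.2⟩
  · simp only [← hcard]
    exact_mod_cast Finset.card_image_le.trans (Fintype.card_piFinset C).le

theorem coveringNumber_prodClass_ne_top {H : ℕ} {ρ : ℝ} {F : Fin H → Set (S × A → ℝ)}
    (h : ∀ i, coveringNumber ρ (F i) ≠ ⊤) : coveringNumber ρ (prodClass F) ≠ ⊤ :=
  (exists_isCover_prodClass h).choose_spec.1.coveringNumber_ne_top

theorem covNum_prodClass_le {H : ℕ} {ρ : ℝ} {F : Fin H → Set (S × A → ℝ)}
    (h : ∀ i, coveringNumber ρ (F i) ≠ ⊤) : covNum ρ (prodClass F) ≤ ∏ i, covNum ρ (F i) := by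
  obtain ⟨F', h1, h2⟩ := exists_isCover_prodClass h
  exact h1.covNum_le.trans h2

end Covering

variable {S A : Type*} [MeasurableSpace S] [MeasurableSpace A]
variable {H : ℕ} {R 𝒬 : Fin H → Set (S × A → ℝ)}

theorem abs_sq_sub_sq_le {g g' b ρ : ℝ} (hg : |g| ≤ b) (hg' : |g'| ≤ b) (h : |g - g'| ≤ 3 * ρ) :
    |g ^ 2 - g' ^ 2| ≤ 6 * b * ρ := by
  have e : g ^ 2 - g' ^ 2 = (g - g') * (g + g') := by ring
  have h2 : |g + g'| ≤ 2 * b := (abs_add_le _ _).trans (by linarith)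
  have h3 : 0 ≤ 3 * ρ := (abs_nonneg _).trans h
  rw [e, abs_mul]
  calc |g - g'| * |g + g'| ≤ 3 * ρ * (2 * b) := mul_le_mul h h2 (abs_nonneg _) h3
    _ = _ := by ring

theorem abs_mul_sub_mul_le {g g' ξ ξ' b ρ : ℝ} (hg' : |g'| ≤ b) (hξ : |ξ| ≤ b)
    (h : |g - g'| ≤ 3 * ρ) (h' : |ξ - ξ'| ≤ 2 * ρ) :
    |g * ξ - g' * ξ'| ≤ 5 * b * ρ := by
  have e : g * ξ - g' * ξ' = (g - g') * ξ + g' * (ξ - ξ') := by ring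
  have h3 : 0 ≤ 3 * ρ := (abs_nonneg _).trans h
  have hb : 0 ≤ b := (abs_nonneg _).trans hξ
  rw [e]
  refine (abs_add_le _ _).trans ?_
  rw [abs_mul, abs_mul]
  calc |g - g'| * |ξ| + |g'| * |ξ - ξ'| ≤ 3 * ρ * b + b * (2 * ρ) :=
        add_le_add (mul_le_mul h hξ (abs_nonneg _) h3) (mul_le_mul hg' h' (abs_nonneg _) hb)
    _ = _ := by ring

section Discretization

variable (h𝒬 : IsQClass 𝒬) (M : MDP S A H) {r r' Q Q' : Fin H → S × A → ℝ}
  (hQ : ∀ h, Q h ∈ 𝒬 h) (hQ' : ∀ h, Q' h ∈ 𝒬 h) {ρ : ℝ} (hρ0 : 0 ≤ ρ)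
  (hQρ : ∀ h x, |Q h x - Q' h x| ≤ ρ) (hrρ : ∀ h x, |r h x - r' h x| ≤ ρ)
  {h : Fin H} {q q' : S × A → ℝ} (hq : q ∈ 𝒬 h) (hq' : q' ∈ 𝒬 h) (hqρ : ∀ x, |q x - q' x| ≤ ρ)
  (hB : M.bellman r Q h ∈ 𝒬 h) (hB' : M.bellman r' Q' h ∈ 𝒬 h)

include h𝒬 hQ hQ' hρ0 hQρ hrρ hqρ in
theorem abs_resid_sub_le (x : S × A) :
    |M.resid q r Q h x - M.resid q' r' Q' h x| ≤ 3 * ρ := by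
  have h1 := abs_le.1 (h𝒬.abs_nextMean_sub_le M hQ hQ' hρ0 hQρ h x)
  have h2 := abs_le.1 (hrρ h x)
  have h3 := abs_le.1 (hqρ x)
  simp only [MDP.resid, bellman_eq_add]
  rw [abs_le]; constructor <;> linarith [h1.1, h1.2, h2.1, h2.2, h3.1, h3.2]

include h𝒬 hQ hQ' hρ0 hQρ in
theorem abs_noise_sub_le (τ : Fin H → S × A) :
    |M.noise Q h τ - M.noise Q' h τ| ≤ 2 * ρ := by
  have h1 := abs_le.1 (h𝒬.abs_nextMean_sub_le M hQ hQ' hρ0 hQρ h (τ h))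
  have h2 := abs_le.1 (h𝒬.abs_nextMax_sub_le hQ hQ' hρ0 hQρ h τ)
  simp only [MDP.noise]
  rw [abs_le]; constructor <;> linarith [h1.1, h1.2, h2.1, h2.2]

include h𝒬 hQ hQ' hρ0 hQρ hrρ hqρ hq hq' hB hB' in
theorem abs_resid_sq_sub_le (x : S × A) :
    |M.resid q r Q h x ^ 2 - M.resid q' r' Q' h x ^ 2| ≤ 6 * H * ρ :=
  abs_sq_sub_sq_le (h𝒬.abs_resid_le M hq hB x) (h𝒬.abs_resid_le M hq' hB' x)
    (abs_resid_sub_le h𝒬 M hQ hQ' hρ0 hQρ hrρ hqρ x)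

include h𝒬 hQ hQ' hρ0 hQρ hrρ hqρ hq hq' hB hB' in
theorem abs_excess_sub_le (τ : Fin H → S × A) :
    |M.excess q r Q h τ - M.excess q' r' Q' h τ| ≤ 16 * H * ρ := by
  -- The constant is `16 = 6 + 2 * 5`: the squared residual moves by `6 H ρ`, and the doubled cross
  -- term by `2 * 5 H ρ`.
  have h1 := abs_le.1 (abs_resid_sq_sub_le h𝒬 M hQ hQ' hρ0 hQρ hrρ hq hq' hqρ hB hB' (τ h))
  have h2 := abs_le.1 (abs_mul_sub_mul_le (h𝒬.abs_resid_le M hq' hB' (τ h))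
    (h𝒬.abs_noise_le M hQ h τ) (abs_resid_sub_le h𝒬 M hQ hQ' hρ0 hQρ hrρ hqρ (τ h))
    (abs_noise_sub_le h𝒬 M hQ hQ' hρ0 hQρ τ))
  rw [excess_eq, excess_eq, abs_le]
  constructor <;> linarith [h1.1, h1.2, h2.1, h2.2]

include h𝒬 hQ hQ' hρ0 hQρ hrρ hqρ hq hq' hB hB' in
theorem integral_resid_sq_sub_le (ν : Measure (Fin H → S × A)) [IsProbabilityMeasure ν] :
    ∫ t, M.resid q r Q h (t h) ^ 2 ∂ν - ∫ t, M.resid q' r' Q' h (t h) ^ 2 ∂ν ≤ 6 * H * ρ := by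
  have hint : ∀ {q r Q}, q ∈ 𝒬 h → M.bellman r Q h ∈ 𝒬 h →
      Integrable (fun t : Fin H → S × A => M.resid q r Q h (t h) ^ 2) ν := fun hq hB =>
    Integrable.of_bound (((h𝒬.measurable_resid M hq hB).comp
      (measurable_pi_apply h)).pow_const 2).aestronglyMeasurable ((H : ℝ) ^ 2)
      (Filter.Eventually.of_forall fun τ => by
        rw [Real.norm_eq_abs, abs_pow]
        exact pow_le_pow_left₀ (abs_nonneg _) (h𝒬.abs_resid_le M hq hB _) 2)
  rw [← integral_sub (hint hq hB) (hint hq' hB')]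
  refine (integral_mono ((hint hq hB).sub (hint hq' hB')) (integrable_const (6 * H * ρ : ℝ))
    fun t => ?_).trans (by simp)
  exact (abs_le.1 (abs_resid_sq_sub_le h𝒬 M hQ hQ' hρ0 hQρ hrρ hq hq' hqρ hB hB' (t h))).2

end Discretization

variable {Ω : Type*} [mΩ : MeasurableSpace Ω] {μ : Measure Ω} {M : MDP S A H}
  {πE π₀ : Policy S A H} {N K : ℕ}

/-- Concentration of the excess squared loss, uniformly over the function classes. -/
theorem Run.measure_uniform_excess_deviation_le [IsProbabilityMeasure μ] (h𝒬 : IsQClass 𝒬)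
    (hcomp : BellmanComplete M R 𝒬) (run : Run μ M R 𝒬 πE π₀ N K) {ρ δ : ℝ} (hρ : 0 ≤ ρ)
    (hδ : 0 < δ) (hcR : ∀ h, coveringNumber ρ (R h) ≠ ⊤) (hcQ : ∀ h, coveringNumber ρ (𝒬 h) ≠ ⊤) :
    μ {ω | ∃ k ∈ Finset.Icc 1 K, ∃ h, ∃ q ∈ 𝒬 h, ∃ Q : Fin H → S × A → ℝ, (∀ h, Q h ∈ 𝒬 h) ∧
      ∃ r : Fin H → S × A → ℝ, (∀ h, r h ∈ R h) ∧
      ∑ i ∈ Finset.range k, M.excess q r Q h (run.τ i ω) <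
        1 / 2 * ∑ i ∈ Finset.range k, run.residMean q r Q h i ω -
          (18 * H ^ 2 * Real.log (K * H * (covNum ρ (prodClass 𝒬) * covNum ρ (prodClass 𝒬) *
            covNum ρ (prodClass R)) / δ) + 19 * K * H * ρ)} ≤ ENNReal.ofReal δ := by
  obtain ⟨CQ, hCQ, hCQn⟩ := exists_isCover (coveringNumber_prodClass_ne_top hcQ)
  obtain ⟨CR, hCR, hCRn⟩ := exists_isCover (coveringNumber_prodClass_ne_top hcR)
  rw [← hCQn, ← hCRn]
  have hcard : (((CQ ×ˢ CQ) ×ˢ CR).card : ℝ) = CQ.card * CQ.card * CR.card := by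
    rw [Finset.card_product, Finset.card_product]; push_cast; ring
  by_cases hpos : 0 < K * H * ((CQ ×ˢ CQ) ×ˢ CR).card
  · refine le_trans (measure_mono fun ω hω => ?_)
      (run.measure_excess_deviation_le h𝒬 ((CQ ×ˢ CQ) ×ˢ CR)
        (fun c h x => c.1.1 (h, x)) (fun c h x => c.2 (h, x)) (fun c h x => c.1.2 (h, x))
        ?_ ?_ ?_ hδ hpos)
    · obtain ⟨k, hk, h, q, hq, Q, hQ, r, hr, hω⟩ := hω
      -- Only step `h` of the competitor matters, so `q` is placed into slot `h` of `Q` to reuse the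
      -- cover of the product class. This second use of that cover is why its cardinality enters
      -- squared.
      have hU : (fun p : Fin H × (S × A) => Function.update Q h q p.1 p.2) ∈ prodClass 𝒬 := by
        intro i
        by_cases hi : i = h
        · subst hi; simpa using hq
        · simpa [hi] using hQ i
      obtain ⟨cq, hcq, hcq'⟩ := hCQ.2 _ hU
      obtain ⟨cQ, hcQ, hcQ'⟩ := hCQ.2 (fun p => Q p.1 p.2) hQ
      obtain ⟨cr, hcr, hcr'⟩ := hCR.2 (fun p => r p.1 p.2) hr
      have hqρ : ∀ x, |q x - cq (h, x)| ≤ ρ := fun x => by simpa using hcq' (h, x)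
      have hQρ : ∀ i x, |Q i x - cQ (i, x)| ≤ ρ := fun i x => hcQ' (i, x)
      have hrρ : ∀ i x, |r i x - cr (i, x)| ≤ ρ := fun i x => hcr' (i, x)
      have mq := hCQ.1 hcq
      have mQ := hCQ.1 hcQ
      have mr := hCR.1 hcr
      have hB := hcomp r hr Q hQ h
      have hB' := hcomp _ mr _ mQ h
      refine ⟨k, hk, h, ((cq, cQ), cr), ?_, ?_⟩
      · simp [hcq, hcQ, hcr]
      have hkK : (k : ℝ) ≤ K := by exact_mod_cast (Finset.mem_Icc.1 hk).2
      have h1 : ∑ i ∈ Finset.range k, M.excess (fun x => cq (h, x)) (fun h x => cr (h, x))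
          (fun h x => cQ (h, x)) h (run.τ i ω) ≤
          ∑ i ∈ Finset.range k, (M.excess q r Q h (run.τ i ω) + 16 * H * ρ) :=
        Finset.sum_le_sum fun i _ => by
          have := (abs_le.1 (abs_excess_sub_le h𝒬 M hQ mQ hρ hQρ hrρ hq (mq h) hqρ hB hB'
            (run.τ i ω))).1
          linarith
      have h2 : ∑ i ∈ Finset.range k, run.residMean q r Q h i ω ≤
          ∑ i ∈ Finset.range k, (run.residMean (fun x => cq (h, x)) (fun h x => cr (h, x))
          (fun h x => cQ (h, x)) h i ω + 6 * H * ρ) :=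
        Finset.sum_le_sum fun i _ => by
          have := integral_resid_sq_sub_le h𝒬 M hQ mQ hρ hQρ hrρ hq (mq h) hqρ hB hB'
            (run.law i ω)
          unfold Run.residMean
          linarith
      simp only [Finset.sum_add_distrib, Finset.sum_const, Finset.card_range, nsmul_eq_mul]
        at h1 h2
      -- Here `19 = 16 + 6 / 2`: the change of the excess plus half the change of the squared
      -- residual.
      have h3 : (k : ℝ) * (19 * H * ρ) ≤ K * (19 * H * ρ) :=
        mul_le_mul_of_nonneg_right hkK (by positivity)
      rw [hcard]
      simp only
      linarith
    · intro c hc h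
      exact hCQ.1 (Finset.mem_product.1 (Finset.mem_product.1 hc).1).1 h
    · intro c hc h
      exact hCQ.1 (Finset.mem_product.1 (Finset.mem_product.1 hc).1).2 h
    · intro c hc h
      exact hcomp _ (hCR.1 (Finset.mem_product.1 hc).2) _
        (hCQ.1 (Finset.mem_product.1 (Finset.mem_product.1 hc).1).2) h
  -- If the index family is empty then the bad event is empty too: a point in it would supply an
  -- iteration, a step and centers.
  · refine le_trans (le_of_eq ?_) (zero_le)
    convert measure_empty (μ := μ)
    refine Set.eq_empty_of_forall_notMem fun ω hω => hpos ?_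
    obtain ⟨k, hk, h, q, hq, Q, hQ, r, hr, hω⟩ := hω
    obtain ⟨cQ, hcQ, -⟩ := hCQ.2 (fun p => Q p.1 p.2) hQ
    obtain ⟨cr, hcr, -⟩ := hCR.2 (fun p => r p.1 p.2) hr
    have hK : 0 < K := by simp at hk; omega
    have hc : 0 < ((CQ ×ˢ CQ) ×ˢ CR).card :=
      Finset.card_pos.2 ⟨((cQ, cQ), cr), by simp [hcQ, hcr]⟩
    have := h.pos
    positivity

/-- Links the algorithm's losses to the excess. Under completeness the Bellman backup is itself a
competitor in the infimum inside `bellmanError`. -/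
theorem sqLoss_sub_sqLoss_bellman (M : MDP S A H) (D : ℕ → Fin H → S × A) (k : ℕ)
    (r : Fin H → S × A → ℝ) (h : Fin H) (q : S × A → ℝ) (Q : Fin H → S × A → ℝ) :
    sqLoss D k r h q Q - sqLoss D k r h (M.bellman r Q h) Q =
      ∑ i ∈ Finset.range k, M.excess q r Q h (D i) := by
  simp only [sqLoss, MDP.excess, Finset.sum_sub_distrib]

theorem sqLoss_nonneg (D : ℕ → Fin H → S × A) (k : ℕ)
    (r : Fin H → S × A → ℝ) (h : Fin H) (q : S × A → ℝ) (Q : Fin H → S × A → ℝ) :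
    0 ≤ sqLoss D k r h q Q := Finset.sum_nonneg fun _ _ => sq_nonneg _

theorem iInf_sqLoss_le (D : ℕ → Fin H → S × A) (k : ℕ)
    (r : Fin H → S × A → ℝ) (h : Fin H) {q : S × A → ℝ} (hq : q ∈ 𝒬 h) (Q : Fin H → S × A → ℝ) :
    ⨅ q : 𝒬 h, sqLoss D k r h q.1 Q ≤ sqLoss D k r h q Q :=
  ciInf_le (f := fun q : 𝒬 h => sqLoss D k r h q.1 Q)
    ⟨0, by rintro _ ⟨q, rfl⟩; exact sqLoss_nonneg _ _ _ _ _ _⟩ ⟨q, hq⟩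

theorem bellmanError_nonneg (D : ℕ → Fin H → S × A) (k : ℕ)
    (r : Fin H → S × A → ℝ) {Q : Fin H → S × A → ℝ} (hQ : ∀ h, Q h ∈ 𝒬 h) :
    0 ≤ bellmanError 𝒬 D k r Q :=
  Finset.sum_nonneg fun h _ => sub_nonneg.2 (iInf_sqLoss_le D k r h (hQ h) Q)

/-- The estimated Bellman error controls the expected Bellman error. -/
theorem sum_residMean_le (hcomp : BellmanComplete M R 𝒬) (run : Run μ M R 𝒬 πE π₀ N K) {k : ℕ}
    {ω : Ω} {β : ℝ} {r Q : Fin H → S × A → ℝ} (hr : ∀ h, r h ∈ R h) (hQ : ∀ h, Q h ∈ 𝒬 h)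
    (hgood : ∀ h, 1 / 2 * ∑ i ∈ Finset.range k, run.residMean (Q h) r Q h i ω - β ≤
      ∑ i ∈ Finset.range k, M.excess (Q h) r Q h (run.τ i ω)) :
    ∑ h, ∑ i ∈ Finset.range k, run.residMean (Q h) r Q h i ω ≤
      2 * bellmanError 𝒬 (fun i => run.τ i ω) k r Q + 2 * (H * β) := by
  have : ∑ h : Fin H, (1 / 2 * ∑ i ∈ Finset.range k, run.residMean (Q h) r Q h i ω - β) ≤
      bellmanError 𝒬 (fun i => run.τ i ω) k r Q := by
    refine Finset.sum_le_sum fun h _ => (hgood h).trans ?_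
    rw [← sqLoss_sub_sqLoss_bellman M (fun i => run.τ i ω)]
    exact sub_le_sub_left (iInf_sqLoss_le _ _ _ _ (hcomp r hr Q hQ h) _) _
  rw [Finset.sum_sub_distrib, ← Finset.mul_sum] at this
  simp only [Finset.sum_const, Finset.card_univ, Fintype.card_fin, nsmul_eq_mul] at this
  linarith

/-- The estimated Bellman error of a fixed point of the Bellman operator is small. -/
theorem bellmanError_le_of_fixedPoint (run : Run μ M R 𝒬 πE π₀ N K) {k : ℕ}
    {ω : Ω} {β : ℝ} {r Q : Fin H → S × A → ℝ} (hQ : ∀ h, Q h ∈ 𝒬 h)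
    (hfix : ∀ h, Q h = M.bellman r Q h)
    (hgood : ∀ h, ∀ q ∈ 𝒬 h, 1 / 2 * ∑ i ∈ Finset.range k, run.residMean q r Q h i ω - β ≤
      ∑ i ∈ Finset.range k, M.excess q r Q h (run.τ i ω)) :
    bellmanError 𝒬 (fun i => run.τ i ω) k r Q ≤ H * β := by
  have : ∀ h ∈ (Finset.univ : Finset (Fin H)), sqLoss (fun i => run.τ i ω) k r h (Q h) Q -
      ⨅ q : 𝒬 h, sqLoss (fun i => run.τ i ω) k r h q.1 Q ≤ β := fun h _ => by
    have : Nonempty (𝒬 h) := ⟨⟨Q h, hQ h⟩⟩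
    have h1 : sqLoss (fun i => run.τ i ω) k r h (Q h) Q - β ≤
        ⨅ q : 𝒬 h, sqLoss (fun i => run.τ i ω) k r h q.1 Q := by
      refine le_ciInf fun q => ?_
      -- As `Q h` is its own backup, the excess of any competitor over it is a difference of losses.
      -- That excess is at least `-β`, since the mean part is nonnegative.
      have h2 := hgood h q.1 q.2
      rw [← sqLoss_sub_sqLoss_bellman M (fun i => run.τ i ω), ← hfix h] at h2
      have h3 : 0 ≤ ∑ i ∈ Finset.range k, run.residMean q.1 r Q h i ω :=
        Finset.sum_nonneg fun i _ => integral_nonneg fun _ => sq_nonneg _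
      linarith
    linarith
  refine (Finset.sum_le_sum this).trans ?_
  simp

end

/-! ### Concentration of the expert's empirical value. -/

section

variable {S A : Type*} [MeasurableSpace S] [MeasurableSpace A]
variable {H : ℕ} {R 𝒬 : Fin H → Set (S × A → ℝ)}
variable {Ω : Type*} [mΩ : MeasurableSpace Ω] {μ : Measure Ω} {M : MDP S A H}
  {πE π₀ : Policy S A H} {N K : ℕ}

/-- Jensen's inequality for `exp`. Averaging over the steps, instead of a union bound over them,
avoids a `log H` in the number of expert trajectories. -/
theorem sum_le_mul_log_of_sum_exp_le {H : ℕ} (hH : 0 < H) {x : Fin H → ℝ} {c : ℝ} (hc : 0 < c)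
    (h : ∑ h, Real.exp (x h) ≤ H * c) : ∑ h, x h ≤ H * Real.log c := by
  have hH' : (0 : ℝ) < H := by exact_mod_cast hH
  have h1 := convexOn_exp.map_sum_le (t := Finset.univ) (w := fun _ : Fin H => (1 / H : ℝ)) (p := x)
    (fun _ _ => by positivity) (by simp [hH'.ne']) (fun _ _ => Set.mem_univ _)
  simp only [smul_eq_mul, ← Finset.mul_sum] at h1
  have h2 : Real.exp (1 / H * ∑ h, x h) ≤ c := by
    refine h1.trans ?_
    rw [div_mul_eq_mul_div, one_mul, div_le_iff₀ hH']
    linarith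
  have h3 := (Real.le_log_iff_exp_le hc).2 h2
  rw [div_mul_eq_mul_div, one_mul, div_le_iff₀ hH'] at h3
  linarith

theorem Run.abs_expertValue_sub_le (run : Run μ M R 𝒬 πE π₀ N K) (ω : Ω)
    {r r' : Fin H → S × A → ℝ} {ρ : ℝ} (hρ0 : 0 ≤ ρ) (hρ : ∀ h x, |r h x - r' h x| ≤ ρ) :
    |run.expertValue ω r - run.expertValue ω r'| ≤ H * ρ := by
  unfold Run.expertValue
  rw [← mul_sub, ← Finset.sum_sub_distrib, abs_mul, abs_of_nonneg (by positivity)]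
  have h1 : |∑ j, (pathReward r (run.expert j ω) - pathReward r' (run.expert j ω))| ≤
      N * (H * ρ) := by
    refine (Finset.abs_sum_le_sum_abs _ _).trans
      ((Finset.sum_le_sum fun j _ => abs_pathReward_sub_le hρ _).trans ?_)
    simp
  rcases Nat.eq_zero_or_pos N with hN | hN
  · subst hN; simp; positivity
  · have hN' : (0 : ℝ) < N := by exact_mod_cast hN
    rw [div_mul_eq_mul_div, one_mul, div_le_iff₀ hN']
    linarith

/-- The exponential moment of the centered sum over the expert trajectories. -/
theorem Run.lintegral_exp_expert_le [IsProbabilityMeasure μ] (run : Run μ M R 𝒬 πE π₀ N K)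
    (h : Fin H) {f : S × A → ℝ} (hf : Measurable f) (hf1 : ∀ x, |f x| ≤ 1) {s : ℝ} (hs : 0 < s)
    (hs1 : s ≤ 1) :
    Measurable (fun ω => ENNReal.ofReal (Real.exp (∑ j, (s * f (run.expert j ω h) -
      (s * ∫ t, f (t h) ∂(M.trajLaw πE) + s ^ 2))))) ∧
    ∫⁻ ω, ENNReal.ofReal (Real.exp (∑ j, (s * f (run.expert j ω h) -
      (s * ∫ t, f (t h) ∂(M.trajLaw πE) + s ^ 2)))) ∂μ ≤ 1 := by
  have hem : ∀ j, Measurable (run.expert j) := fun j =>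
    (run.expert_measurable j).mono (run.ℱ.le 0) le_rfl
  let G : (Fin H → S × A) → ENNReal := fun t => ENNReal.ofReal (Real.exp (s * f (t h) -
      (s * ∫ t, f (t h) ∂(M.trajLaw πE) + s ^ 2)))
  have hfm : Measurable fun t : Fin H → S × A => f (t h) := hf.comp (measurable_pi_apply h)
  have hG : Measurable G := by fun_prop
  simp only [← prod_ofReal_exp]
  refine ⟨Finset.measurable_prod _ fun j _ => hG.comp (hem j), ?_⟩
  have hind : iIndepFun (fun j ω => G (run.expert j ω)) μ :=
    run.expert_indep.comp (fun _ => G) fun _ => hG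
  have e := lintegral_prod_eq_prod_lintegral_of_indepFun Finset.univ _ hind
    (fun j => hG.comp (hem j))
  refine e.trans_le (Finset.prod_le_one' fun j _ => ?_)
  rw [← lintegral_map hG (hem j), run.expert_law j]
  refine lintegral_exp_sub_le_one _ (f := fun t : Fin H → S × A => s * f (t h))
    (hfm.const_mul s) (fun t => ?_) ?_
  · rw [abs_mul, abs_of_pos hs]
    exact mul_le_one₀ hs1 (abs_nonneg _) (hf1 _)
  · rw [integral_const_mul]
    gcongr
    refine (integral_mono_of_nonneg (Filter.Eventually.of_forall fun t => sq_nonneg _)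
      (integrable_const (s ^ 2 : ℝ)) (Filter.Eventually.of_forall fun t => ?_)).trans (by simp)
    simp only [mul_pow]
    have : f (t h) ^ 2 ≤ 1 := by
      rw [← sq_abs]; exact pow_le_one₀ (abs_nonneg _) (hf1 _)
    nlinarith [sq_nonneg s]

/-- Concentration of the empirical expert value, uniformly over the reward class. -/
theorem Run.measure_expert_deviation_le [IsProbabilityMeasure μ] (hR : IsRewardClass R)
    (hreal : RewardRealizable M R) (run : Run μ M R 𝒬 πE π₀ N K) (hN : 0 < N) (hH : 0 < H)
    {ρ : ℝ} (hρ : 0 ≤ ρ)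
    (hcR : ∀ h, coveringNumber ρ (R h) ≠ ⊤) {n : ℝ} (hn : ∀ h, covNum ρ (R h) ≤ n) {s δ : ℝ}
    (hs : 0 < s) (hs1 : s ≤ 1) (hδ : 0 < δ) :
    μ {ω | ∃ r : Fin H → S × A → ℝ, (∀ h, r h ∈ R h) ∧
      H * s + H * Real.log (n / δ) / (s * N) + 2 * H * ρ <
        (run.expertValue ω r - M.value πE r) -
          (run.expertValue ω M.reward - M.value πE M.reward)} ≤ ENNReal.ofReal δ := by
  have hH' : (0 : ℝ) < H := by exact_mod_cast hH
  have hN' : (0 : ℝ) < N := by exact_mod_cast hN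
  have hn1 : 1 ≤ n := (one_le_covNum (hcR ⟨0, hH⟩) ⟨_, hreal _⟩).trans (hn ⟨0, hH⟩)
  choose C hC hCn using fun h => exists_isCover (hcR h)
  have hrew : IsUnitReward M.reward := hR.isUnitReward hreal
  -- Each step is treated separately with its own cover, and rewards are centered at the true reward
  -- so that the summands stay within `[-1, 1]`.
  let Z : Fin H → (S × A → ℝ) → Ω → ℝ := fun h c ω => ∑ j, (s * (fun x => c x - M.reward h x)
    (run.expert j ω h) - (s * ∫ t, (fun x => c x - M.reward h x) (t h) ∂(M.trajLaw πE) + s ^ 2))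
  have key : ∀ h, ∀ c ∈ C h, Measurable (fun ω => ENNReal.ofReal (Real.exp (Z h c ω))) ∧
      ∫⁻ ω, ENNReal.ofReal (Real.exp (Z h c ω)) ∂μ ≤ 1 := by
    intro h c hc
    have hc' := hR h c ((hC h).1 hc)
    refine run.lintegral_exp_expert_le h (hc'.1.sub (hrew h).1) (fun x => ?_) hs hs1
    have h1 := hc'.2 x
    have h2 := (hrew h).2 x
    simp only [Pi.sub_apply]
    rw [abs_le]; constructor <;> linarith [h1.1, h1.2, h2.1, h2.2]
  have hΦm : Measurable fun ω => ∑ h, ∑ c ∈ C h, ENNReal.ofReal (Real.exp (Z h c ω)) :=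
    Finset.measurable_sum _ fun h _ => Finset.measurable_sum _ fun c hc => (key h c hc).1
  have hΦ : ∫⁻ ω, ∑ h, ∑ c ∈ C h, ENNReal.ofReal (Real.exp (Z h c ω)) ∂μ ≤
      ENNReal.ofReal (H * n) := by
    rw [lintegral_finsetSum _ fun h _ => Finset.measurable_sum _ fun c hc => (key h c hc).1]
    have : ∀ h ∈ (Finset.univ : Finset (Fin H)),
        ∫⁻ ω, ∑ c ∈ C h, ENNReal.ofReal (Real.exp (Z h c ω)) ∂μ ≤ ENNReal.ofReal n :=
      fun h _ => by
        rw [lintegral_finsetSum _ fun c hc => (key h c hc).1]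
        refine (Finset.sum_le_sum fun c hc => (key h c hc).2).trans ?_
        have := hn h
        rw [← hCn h] at this
        simpa using ENNReal.ofReal_le_ofReal this
    refine (Finset.sum_le_sum this).trans (le_of_eq ?_)
    rw [ENNReal.ofReal_mul hH'.le]
    simp
  refine le_trans (measure_mono fun ω hω => ?_)
    (measure_ge_le_of_lintegral_le hΦm.aemeasurable (by positivity) hδ hΦ)
  obtain ⟨r, hr, hω⟩ := hω
  choose c hc hcr using fun h => (hC h).2 _ (hr h)
  have hcu : IsUnitReward c := fun h => hR h _ ((hC h).1 (hc h))
  have hru : IsUnitReward r := hR.isUnitReward hr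
  have d1 := (abs_le.1 (run.abs_expertValue_sub_le ω hρ hcr)).2
  have d2 := (abs_le.1 (abs_value_sub_le M πE hru hcu hcr)).1
  have e : ∑ h, Z h (c h) ω = s * N * ((run.expertValue ω c - M.value πE c) -
          (run.expertValue ω M.reward - M.value πE M.reward)) - H * N * s ^ 2 := by
    have e1 : ∑ h, ∫ t, (c h (t h) - M.reward h (t h)) ∂(M.trajLaw πE) =
        M.value πE c - M.value πE M.reward := by
      unfold MDP.value
      rw [← integral_sub (integrable_pathReward hcu _) (integrable_pathReward hrew _)]
      simp only [pathReward, ← Finset.sum_sub_distrib]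
      rw [integral_finsetSum]
      intro h _
      refine Integrable.of_bound (((hcu h).1.comp (measurable_pi_apply h)).sub
        ((hrew h).1.comp (measurable_pi_apply h))).aestronglyMeasurable 1
        (Filter.Eventually.of_forall fun t => ?_)
      have h1 := (hcu h).2 (t h)
      have h2 := (hrew h).2 (t h)
      rw [Real.norm_eq_abs, abs_le]; constructor <;> linarith [h1.1, h1.2, h2.1, h2.2]
    have e2 : ∑ h, ∑ j, (c h (run.expert j ω h) - M.reward h (run.expert j ω h)) =
        N * (run.expertValue ω c - run.expertValue ω M.reward) := by
      rw [Finset.sum_comm]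
      simp only [Run.expertValue, pathReward]
      rw [← mul_sub, ← Finset.sum_sub_distrib]
      simp only [← Finset.sum_sub_distrib]
      field_simp
    simp only [Z, Finset.sum_sub_distrib, Finset.sum_const, Finset.card_univ, Fintype.card_fin,
      nsmul_eq_mul, Finset.sum_add_distrib, ← Finset.mul_sum, mul_add] at e1 e2 ⊢
    rw [e1, e2]
    ring
  have hlow : H * Real.log (n / δ) < ∑ h, Z h (c h) ω := by
    have h1 : H * s + H * Real.log (n / δ) / (s * N) <
        (run.expertValue ω c - M.value πE c) -
          (run.expertValue ω M.reward - M.value πE M.reward) := by linarith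
    have h2 := mul_lt_mul_of_pos_left h1 (mul_pos hs hN')
    have h3 : s * N * (H * s + H * Real.log (n / δ) / (s * N)) =
      H * N * s ^ 2 + H * Real.log (n / δ) := by field_simp
    linarith
  -- A large total of the exponents forces a large sum of exponentials, whose expectation over all
  -- steps and centers is at most `H n`.
  have hexp : H * n / δ ≤ ∑ h, Real.exp (Z h (c h) ω) := by
    by_contra hlt
    rw [not_le] at hlt
    have := sum_le_mul_log_of_sum_exp_le hH (c := n / δ) (by positivity)
      (x := fun h => Z h (c h) ω) (by rw [← mul_div_assoc]; exact hlt.le)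
    linarith
  refine (ENNReal.ofReal_le_ofReal hexp).trans ?_
  rw [ENNReal.ofReal_sum_of_nonneg fun _ _ => (Real.exp_pos _).le]
  exact Finset.sum_le_sum fun h _ => Finset.single_le_sum
    (f := fun c => ENNReal.ofReal (Real.exp (Z h c ω))) (fun _ _ => zero_le) (hc h)

end

/-! ### The eluder coefficient, optimism and the regret decomposition. -/

section

variable {S A : Type*} [MeasurableSpace S] [MeasurableSpace A]
variable {H : ℕ} {R 𝒬 : Fin H → Set (S × A → ℝ)}
variable {Ω : Type*} [mΩ : MeasurableSpace Ω] {μ : Measure Ω} {M : MDP S A H}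
  {πE π₀ : Policy S A H} {N K : ℕ}

/-- Each summand on the left is at most `H`, and for `d = H K` the square root alone equals `H K`.
Hence the infimum in `dGEC` is over a nonempty set and is not the default value `0`. -/
theorem gecBound_self [NeZero H] (hR : IsRewardClass R) (h𝒬 : IsQClass 𝒬) (M : MDP S A H) (K : ℕ)
    {ε : ℝ} (hε : 0 ≤ ε) : GECBound M R 𝒬 K ε (H * K) := by
  intro r Q π hr hQ hπ m hm
  have h1 : ∑ k, (Q k 0 (M.s₁, (π k).act 0 M.s₁) - M.value (π k).toPolicy (r k)) ≤ H * K := by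
    refine (Finset.sum_le_sum (g := fun _ => (H : ℝ)) fun k _ => ?_).trans
      (by simp [mul_comm])
    have := ((h𝒬 0 _ (hQ k 0)).2.1 (M.s₁, (π k).act 0 M.s₁)).2
    have := value_nonneg M (π k).toPolicy (hR.isUnitReward (hr k))
    linarith
  have h2 : Real.sqrt ((H * K : ℝ) * H * K) = H * K := by
    rw [mul_assoc, ← sq, Real.sqrt_sq (by positivity)]
  rw [h2]
  have h3 : 0 ≤ m / 2 * ∑ k, ∑ i ∈ Finset.univ.filter (fun i => i < k),
      (∫ τ, ∑ h, (Q k h (τ h) - M.bellman (r k) (Q k) h (τ h)) ^ 2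
        ∂(M.trajLaw (π i).toPolicy)) :=
    mul_nonneg (by positivity) (Finset.sum_nonneg fun _ _ => Finset.sum_nonneg fun _ _ =>
      integral_nonneg fun _ => Finset.sum_nonneg fun _ _ => sq_nonneg _)
  have h4 : 0 ≤ (H * K : ℝ) / (2 * m) := by positivity
  have h5 : 0 ≤ ε * H * K := by positivity
  linarith

/-- Instead of showing that the infimum is attained, an admissible value below `2 d` is taken; the
factor is absorbed by the constants. -/
theorem exists_gecBound [NeZero H] (hR : IsRewardClass R) (h𝒬 : IsQClass 𝒬) (M : MDP S A H) (K : ℕ)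
    {ε d : ℝ} (hε : 0 ≤ ε) (hd : 0 < d) (hdG : dGEC M R 𝒬 K ε ≤ d) :
    ∃ d', 0 ≤ d' ∧ d' ≤ 2 * d ∧ GECBound M R 𝒬 K ε d' := by
  obtain ⟨d', hd', hlt⟩ := exists_lt_of_csInf_lt
    (s := {d : ℝ | 0 ≤ d ∧ GECBound M R 𝒬 K ε d}) (b := 2 * d)
    ⟨H * K, by positivity, gecBound_self hR h𝒬 M K hε⟩
    (lt_of_le_of_lt hdG (by linarith))
  exact ⟨d', hd'.1, hlt.le, hd'.2⟩

theorem sum_Icc_one_eq_sum_fin (K : ℕ) (f : ℕ → ℝ) :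
    ∑ k ∈ Finset.Icc 1 K, f k = ∑ k : Fin K, f (k.1 + 1) := by
  rw [Fin.sum_univ_eq_sum_range (fun k => f (k + 1)) K, Finset.range_eq_Ico,
    Finset.sum_Ico_add' f 0 K 1]
  rfl

/-- The eluder inequality involves the policies `π^1, …, π^{k-1}` only, while the dataset also
contains `τ^0`; its extra contribution is nonnegative. -/
theorem sum_filter_lt_le {K : ℕ} (k : Fin K) {a : ℕ → ℝ} (ha : ∀ i, 0 ≤ a i) :
    ∑ i ∈ Finset.univ.filter (fun i : Fin K => i < k), a (i.1 + 1) ≤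
      ∑ i ∈ Finset.range (k.1 + 1), a i := by
  rw [← Finset.sum_image (f := a) (g := fun i : Fin K => i.1 + 1)
    (fun i _ j _ hij => Fin.ext (by simpa using hij))]
  refine Finset.sum_le_sum_of_subset_of_nonneg (fun j hj => ?_) fun i _ _ => ha i
  simp only [Finset.mem_image, Finset.mem_filter, Finset.mem_univ, true_and, Fin.lt_def] at hj
  obtain ⟨i, hi, rfl⟩ := hj
  simp; omega

/-- Nonnegative Bellman errors and Q-values at most `H` bound the objective below by `-lam * H`, so
the infimum in `qOptError` is genuine. -/
theorem objective_le [NeZero H] (h𝒬 : IsQClass 𝒬) (run : Run μ M R 𝒬 πE π₀ N K) {lam : ℝ}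
    (hlam : 0 ≤ lam) (ω : Ω) {k : ℕ} (hk : k ∈ Finset.Icc 1 K) {Q : Fin H → S × A → ℝ}
    (hQ : ∀ h, Q h ∈ 𝒬 h) :
    objective M 𝒬 (fun i => run.τ i ω) lam k (run.r k ω) (run.Q k ω) ≤
      objective M 𝒬 (fun i => run.τ i ω) lam k (run.r k ω) Q + run.qOptError lam ω := by
  have hbdd : BddBelow (Set.range fun Q : {Q : Fin H → S × A → ℝ // ∀ h, Q h ∈ 𝒬 h} =>
      objective M 𝒬 (fun i => run.τ i ω) lam k (run.r k ω) Q.1) := by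
    refine ⟨-(lam * H), ?_⟩
    rintro _ ⟨Q, rfl⟩
    have h1 := bellmanError_nonneg (fun i => run.τ i ω) k (run.r k ω) Q.2
    have h2 := mul_le_mul_of_nonneg_left (h𝒬.iSup_mem (Q.2 0) M.s₁).2 hlam
    simp only [objective]
    linarith
  have h1 := ciInf_le hbdd ⟨Q, hQ⟩
  have h2 := le_ciSup (f := fun k : Finset.Icc 1 K =>
    (objective M 𝒬 (fun i => run.τ i ω) lam k.1 (run.r k.1 ω) (run.Q k.1 ω) -
      ⨅ Q : {Q : Fin H → S × A → ℝ // ∀ h, Q h ∈ 𝒬 h},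
        objective M 𝒬 (fun i => run.τ i ω) lam k.1 (run.r k.1 ω) Q.1))
    (Set.finite_range _).bddAbove ⟨k, hk⟩
  simp only at h1 h2
  have h3 : run.qOptError lam ω = ⨆ k : Finset.Icc 1 K,
    (objective M 𝒬 (fun i => run.τ i ω) lam k.1 (run.r k.1 ω) (run.Q k.1 ω) -
      ⨅ Q : {Q : Fin H → S × A → ℝ // ∀ h, Q h ∈ 𝒬 h},
        objective M 𝒬 (fun i => run.τ i ω) lam k.1 (run.r k.1 ω) Q.1) := rfl
  linarith

theorem qOptError_nonneg [NeZero H] (h𝒬 : IsQClass 𝒬) (run : Run μ M R 𝒬 πE π₀ N K) {lam : ℝ}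
    (hlam : 0 ≤ lam) (ω : Ω) : 0 ≤ run.qOptError lam ω := by
  rcases Nat.eq_zero_or_pos K with hK | hK
  · subst hK
    have : IsEmpty (Finset.Icc 1 0) := ⟨fun x => by simpa using x.2⟩
    rw [Run.qOptError, Real.iSup_of_isEmpty]
  · have hk : 1 ∈ Finset.Icc 1 K := by simp; omega
    have := objective_le h𝒬 run hlam ω hk (run.Q_mem 1 hk ω)
    linarith

/-- The regret of the greedy policies with respect to the adversarial rewards. -/
theorem sum_value_sub_value_le [NeZero H] (hR : IsRewardClass R) (h𝒬 : IsQClass 𝒬)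
    (hopt : QRealizable M R 𝒬) (hcomp : BellmanComplete M R 𝒬) (run : Run μ M R 𝒬 πE π₀ N K)
    {lam β ε d : ℝ} (hlam : 0 < lam) (hgec : GECBound M R 𝒬 K ε d) {ω : Ω}
    (hgood : ∀ k ∈ Finset.Icc 1 K, ∀ h, ∀ q ∈ 𝒬 h, ∀ Q : Fin H → S × A → ℝ, (∀ h, Q h ∈ 𝒬 h) →
      ∀ r : Fin H → S × A → ℝ, (∀ h, r h ∈ R h) →
      1 / 2 * ∑ i ∈ Finset.range k, run.residMean q r Q h i ω - β ≤
      ∑ i ∈ Finset.range k, M.excess q r Q h (run.τ i ω)) :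
    ∑ k ∈ Finset.Icc 1 K, (M.value πE (run.r k ω) -
      M.value (run.greedy k ω).toPolicy (run.r k ω)) ≤
      K * (run.qOptError lam ω / lam) + 2 * K * (H * β) / lam + d * lam / 2 +
        Real.sqrt (d * H * K) + ε * H * K := by
  set e := run.qOptError lam ω with he
  let BE : ℕ → ℝ := fun k => bellmanError 𝒬 (fun i => run.τ i ω) k (run.r k ω) (run.Q k ω)
  -- Optimism: the optimal Q-value function is a competitor with small estimated Bellman error, so
  -- `Q^k` must nearly reach its initial value. The slack `-BE k / lam` is kept for the cancellation
  -- below.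
  have hopti : ∀ k ∈ Finset.Icc 1 K, M.value πE (run.r k ω) ≤
      run.Q k ω 0 (M.s₁, (run.greedy k ω).act 0 M.s₁) + (H * β + e - BE k) / lam := by
    intro k hk
    have hr := run.r_mem k hk ω
    have hru := hR.isUnitReward hr
    have ho := hopt _ hr
    have h1 := value_le_iSup_optQ h𝒬 M hru ho πE 0 rfl
    have h2 := objective_le h𝒬 run hlam.le ω hk ho
    have h3 : ⨆ a, run.Q k ω 0 (M.s₁, a) = run.Q k ω 0 (M.s₁, (run.greedy k ω).act 0 M.s₁) :=
      iSup_eq_of_isMax fun a => run.isGreedy k hk ω 0 M.s₁ a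
    have h4 := bellmanError_le_of_fixedPoint run (k := k) (ω := ω) (β := β) ho
      (optQ_eq_bellman h𝒬 M hru ho) fun h q hq => hgood k hk h q hq _ ho _ hr
    simp only [objective, h3] at h2
    have h5 : lam * (⨆ a, M.optQ (run.r k ω) 0 (M.s₁, a)) ≤
      lam * run.Q k ω 0 (M.s₁, (run.greedy k ω).act 0 M.s₁) + (H * β + e - BE k) := by
      simp only [BE]; linarith
    refine h1.trans ?_
    have h6 : lam * (run.Q k ω 0 (M.s₁, (run.greedy k ω).act 0 M.s₁) +
      (H * β + e - BE k) / lam) = lam * run.Q k ω 0 (M.s₁, (run.greedy k ω).act 0 M.s₁) +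
        (H * β + e - BE k) := by field_simp
    exact le_of_mul_le_mul_left (h5.trans h6.ge) hlam
  -- Index `k : Fin K` stands for iteration `k + 1`. With `μ = 1 / lam`, the factor `1 / (2 lam)`
  -- meets the bound `2 BE` and cancels `-BE / lam`.
  have hG := hgec (fun k => run.r (k.1 + 1) ω) (fun k => run.Q (k.1 + 1) ω)
    (fun k => run.greedy (k.1 + 1) ω)
    (fun k => run.r_mem _ (by simp) ω) (fun k => run.Q_mem _ (by simp) ω)
    (fun k => run.isGreedy _ (by simp) ω) (1 / lam) (by positivity)
  have hE : ∀ k : Fin K, ∑ i ∈ Finset.univ.filter (fun i => i < k),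
      (∫ τ, ∑ h, (run.Q (k.1 + 1) ω h (τ h) -
        M.bellman (run.r (k.1 + 1) ω) (run.Q (k.1 + 1) ω) h (τ h)) ^ 2
        ∂(M.trajLaw (run.greedy (i.1 + 1) ω).toPolicy)) ≤ 2 * BE (k.1 + 1) + 2 * (H * β) := by
    intro k
    have hk : k.1 + 1 ∈ Finset.Icc 1 K := by simp
    have hr := run.r_mem _ hk ω
    have hQ := run.Q_mem _ hk ω
    refine le_trans ?_ (sum_residMean_le hcomp run hr hQ fun h =>
      hgood _ hk h _ (hQ h) _ hQ _ hr)
    rw [Finset.sum_comm]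
    refine le_trans (le_of_eq (Finset.sum_congr rfl fun i _ => ?_))
      (sum_filter_lt_le k (a := fun i => ∑ h, run.residMean (run.Q (k.1 + 1) ω h)
        (run.r (k.1 + 1) ω) (run.Q (k.1 + 1) ω) h i ω)
        fun i => Finset.sum_nonneg fun h _ => integral_nonneg fun _ => sq_nonneg _)
    simp only [Run.residMean, run.law_of_pos (Nat.succ_pos i.1), MDP.resid]
    rw [integral_finsetSum]
    intro h _
    exact Integrable.of_bound (((h𝒬.measurable_resid M (hQ h) (hcomp _ hr _ hQ h)).comp
      (measurable_pi_apply h)).pow_const 2).aestronglyMeasurable ((H : ℝ) ^ 2)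
      (Filter.Eventually.of_forall fun τ => by
        rw [Real.norm_eq_abs, abs_pow]
        exact pow_le_pow_left₀ (abs_nonneg _)
          (h𝒬.abs_resid_le M (hQ h) (hcomp _ hr _ hQ h) _) 2)
  have hE' := Finset.sum_le_sum fun k (_ : k ∈ Finset.univ) => hE k
  have hE'' := mul_le_mul_of_nonneg_left hE' (show 0 ≤ 1 / lam / 2 by positivity)
  have hS := Finset.sum_le_sum hopti
  rw [sum_Icc_one_eq_sum_fin] at hS ⊢
  rw [sum_Icc_one_eq_sum_fin] at hS
  simp only [Finset.sum_sub_distrib, Finset.sum_add_distrib, ← Finset.mul_sum,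
    ← Finset.sum_div, Finset.sum_const, Finset.card_univ, Fintype.card_fin, nsmul_eq_mul]
    at hS hG hE'' ⊢
  have e1 : d / (2 * (1 / lam)) = d * lam / 2 := by field_simp
  rw [e1] at hG
  have e2 : 1 / lam / 2 * (2 * ∑ k : Fin K, BE (k.1 + 1) + 2 * (H * (K * β))) =
    (∑ k : Fin K, BE (k.1 + 1)) / lam + K * (H * β) / lam := by field_simp
  have e3 : (H * (K * β) + K * e - ∑ k : Fin K, BE (k.1 + 1)) / lam =
    K * (H * β) / lam + K * (e / lam) - (∑ k : Fin K, BE (k.1 + 1)) / lam := by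
    field_simp
  have e4 : 2 * K * (H * β) / lam = K * (H * β) / lam + K * (H * β) / lam := by ring
  rw [e2] at hE''
  rw [e3] at hS
  rw [e4]
  linarith

theorem Run.imitationGap_eq (hR : IsRewardClass R) (hreal : RewardRealizable M R)
    (run : Run μ M R 𝒬 πE π₀ N K) (hK : 0 < K) (ω : Ω) :
    run.imitationGap ω = 1 / (K : ℝ) * ∑ k ∈ Finset.Icc 1 K, (M.value πE M.reward -
      M.value (run.greedy k ω).toPolicy M.reward) := by
  have hK' : (0 : ℝ) < K := by exact_mod_cast hK
  have hrew : IsUnitReward M.reward := hR.isUnitReward hreal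
  rw [Run.imitationGap, MDP.mixValue, integral_smul_measure,
    integral_finsetSum_measure fun k _ => integrable_pathReward hrew _]
  simp only [MDP.value, Finset.sum_sub_distrib, Finset.sum_const, Nat.card_Icc, nsmul_eq_mul]
  simp
  field_simp

/-- The regret of the reward player controls the gap with respect to the true reward. -/
theorem Run.imitationGap_le (hR : IsRewardClass R) (hreal : RewardRealizable M R)
    (run : Run μ M R 𝒬 πE π₀ N K) (hK : 0 < K) (ω : Ω) :
    run.imitationGap ω ≤ run.rewardOptError ω + 1 / (K : ℝ) * (
      ∑ k ∈ Finset.Icc 1 K, ((run.expertValue ω (run.r k ω) - M.value πE (run.r k ω)) -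
          (run.expertValue ω M.reward - M.value πE M.reward)) +
      ∑ k ∈ Finset.Icc 1 K,
        ((pathReward M.reward (run.τ k ω) - pathReward (run.r k ω) (run.τ k ω)) -
        (M.value (run.greedy k ω).toPolicy M.reward -
          M.value (run.greedy k ω).toPolicy (run.r k ω))) +
      ∑ k ∈ Finset.Icc 1 K, (M.value πE (run.r k ω) -
        M.value (run.greedy k ω).toPolicy (run.r k ω))) := by
  have hK' : (0 : ℝ) < K := by exact_mod_cast hK
  -- Boundedness is needed to compare with the true reward: an unbounded real supremum would default
  -- to `0`.
  have hbdd : BddAbove (Set.range fun r : {r : Fin H → S × A → ℝ // ∀ h, r h ∈ R h} =>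
      ∑ k ∈ Finset.Icc 1 K, (run.loss ω k (run.r k ω) - run.loss ω k r.1)) := by
    refine ⟨∑ k ∈ Finset.Icc 1 K, (2 * H : ℝ), ?_⟩
    rintro _ ⟨r, rfl⟩
    refine Finset.sum_le_sum fun k hk => ?_
    have h1 := abs_le.1 (abs_pathReward_sub_le (ρ := 1) (fun h x => by
      have h1 := (hR.isUnitReward (run.r_mem k hk ω) h).2 x
      have h2 := (hR.isUnitReward r.2 h).2 x
      rw [abs_le]; constructor <;> linarith [h1.1, h1.2, h2.1, h2.2]) (run.τ k ω) :
      |pathReward (run.r k ω) (run.τ k ω) - pathReward r.1 (run.τ k ω)| ≤ H * 1)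
    have h2 := abs_le.1 (run.abs_expertValue_sub_le ω (ρ := 1) zero_le_one (fun h x => by
      have h1 := (hR.isUnitReward (run.r_mem k hk ω) h).2 x
      have h2 := (hR.isUnitReward r.2 h).2 x
      rw [abs_le]; constructor <;> linarith [h1.1, h1.2, h2.1, h2.2]) :
      |run.expertValue ω (run.r k ω) - run.expertValue ω r.1| ≤ H * 1)
    simp only [Run.loss]
    linarith [h1.2, h2.1]
  have h1 := le_ciSup hbdd ⟨M.reward, hreal⟩
  have h2 := mul_le_mul_of_nonneg_left h1 (show 0 ≤ 1 / (K : ℝ) by positivity)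
  change _ ≤ run.rewardOptError ω at h2
  rw [run.imitationGap_eq hR hreal hK]
  refine le_trans (le_of_eq ?_) (add_le_add h2 le_rfl)
  rw [← mul_add]
  congr 1
  simp only [← Finset.sum_add_distrib]
  refine Finset.sum_congr rfl fun k _ => ?_
  simp only [Run.loss]
  ring

end

/-! ### Arithmetic of the constants. -/

section

theorem log_four : Real.log 4 = 2 * Real.log 2 := by
  rw [show (4 : ℝ) = 2 ^ 2 by norm_num, Real.log_pow]; norm_num

/-- Consequences of the lower bound on the number of iterations. -/
theorem iteration_bounds {H d n δ ε K NN c : ℝ} {m : ℕ} (hm : H = m) (hH : 1 ≤ H) (hd : 1 ≤ d)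
    (hn : 1 ≤ n) (hδ : 0 < δ) (hδ1 : δ ≤ 1) (hε : 0 < ε) (hε1 : ε ≤ 1) (hHn : 2 ≤ H * n)
    (hK : 0 < K) (hNN : 1 ≤ NN) (hNNn : NN ≤ n ^ m) (hc : 10 ^ 7 ≤ c)
    (h : c * ((H ^ 4 * d * Real.log (H * d * n / (δ * ε)) + H ^ 2 * Real.log (1 / δ)) / ε ^ 2)
      ≤ K) :
    d * H ^ 3 * Real.log (4 * K * H * NN / δ) ≤ K * ε ^ 2 / 40000 ∧
      144 * H ^ 2 * Real.log (4 / δ) ≤ K * ε ^ 2 ∧ 72 * d * H ≤ K * ε ^ 2 := by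
  have hH0 : 0 < H := by linarith
  have hd0 : 0 < d := by linarith
  have hn0 : 0 < n := by linarith
  have hN0 : 0 < NN := by linarith
  have h2 : 0.69 < Real.log 2 := by linarith [Real.log_two_gt_d9]
  set lH := Real.log H with hlH
  set ld := Real.log d with hld
  set ln := Real.log n with hln
  set lδ := Real.log (1 / δ) with hlδ
  set lε := Real.log (1 / ε) with hlε
  have pH : 0 ≤ lH := Real.log_nonneg hH
  have pd : 0 ≤ ld := Real.log_nonneg hd
  have pn : 0 ≤ ln := Real.log_nonneg hn
  have pδ : 0 ≤ lδ := Real.log_nonneg (by rw [le_div_iff₀ hδ]; linarith)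
  have pε : 0 ≤ lε := Real.log_nonneg (by rw [le_div_iff₀ hε]; linarith)
  have eδ : Real.log δ = -lδ := by rw [hlδ, Real.log_div one_ne_zero hδ.ne']; simp
  have eε : Real.log ε = -lε := by rw [hlε, Real.log_div one_ne_zero hε.ne']; simp
  have hℓ : Real.log (H * d * n / (δ * ε)) = lH + ld + ln + lδ + lε := by
    rw [Real.log_div (by positivity) (by positivity), Real.log_mul (by positivity) hn0.ne',
      Real.log_mul hH0.ne' hd0.ne', Real.log_mul hδ.ne' hε.ne', eδ, eε]
    ring
  rw [hℓ] at h
  set ℓ := lH + ld + ln + lδ + lε with hℓdef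
  -- This is where `2 ≤ H * n` enters: it keeps the logarithm away from zero, so that numerical
  -- constants can be absorbed into it.
  have hℓ2 : Real.log 2 ≤ ℓ := by
    have h1 : Real.log 2 ≤ lH + ln := by
      rw [← Real.log_mul hH0.ne' hn0.ne']; exact Real.log_le_log (by norm_num) hHn
    linarith
  have hℓ0 : 0 < ℓ := by linarith
  set a := H ^ 4 * d / ε ^ 2 with ha
  have ha0 : 0 < a := by positivity
  have haε : a * ε ^ 2 = H ^ 4 * d := by rw [ha]; field_simp
  have hX : 10 ^ 7 * (H ^ 4 * d * ℓ + H ^ 2 * lδ) ≤ K * ε ^ 2 := by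
    have h1 : c * (H ^ 4 * d * ℓ + H ^ 2 * lδ) ≤ K * ε ^ 2 := by
      rw [← mul_div_assoc, div_le_iff₀ (by positivity)] at h; exact h
    have h3 : 0 ≤ H ^ 4 * d * ℓ + H ^ 2 * lδ := by positivity
    exact (mul_le_mul_of_nonneg_right hc h3).trans h1
  have hHd : H ^ 4 * d * ℓ ≤ K * ε ^ 2 / 10 ^ 7 := by
    have : 0 ≤ H ^ 2 * lδ := by positivity
    rw [le_div_iff₀ (by positivity)]; linarith
  have hH2 : H ^ 2 ≤ H ^ 4 * d := by
    have h1 : H ^ 2 ≤ H ^ 4 := pow_le_pow_right₀ hH (by norm_num)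
    exact h1.trans (le_mul_of_one_le_right (by positivity) hd)
  have hH1 : d * H ≤ H ^ 4 * d := by
    have h1 : H ^ 1 ≤ H ^ 4 := pow_le_pow_right₀ hH (by norm_num)
    rw [pow_one] at h1
    rw [mul_comm]; exact mul_le_mul_of_nonneg_right h1 hd0.le
  have hH3 : d * H ^ 3 ≤ H ^ 4 * d := by
    have h1 : H ^ 3 ≤ H ^ 4 := pow_le_pow_right₀ hH (by norm_num)
    rw [mul_comm]; exact mul_le_mul_of_nonneg_right h1 hd0.le
  refine ⟨?_, ?_, ?_⟩
  -- Resolves the implicit condition in which `K` must dominate its own logarithm. Here `28 = 22 + 5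
  -- + 1`: 22 copies of `log 2`, the logarithms of `a`, `H` and `1 / δ`, and `H log n` from the
  -- product class.
  · have hL : Real.log (4 * K * H * NN / δ) ≤ 28 * H * ℓ + K / a / 2 ^ 20 := by
      have e1 : Real.log (4 * K * H * NN / δ) =
          2 * Real.log 2 + Real.log K + lH + Real.log NN + lδ := by
        rw [Real.log_div (by positivity) hδ.ne', Real.log_mul (by positivity) hN0.ne',
          Real.log_mul (by positivity) hH0.ne', Real.log_mul (by norm_num) hK.ne', eδ, log_four]
        ring
      have e2 : Real.log NN ≤ H * ln := by
        rw [hm, hln, ← Real.log_pow]; exact Real.log_le_log hN0 hNNn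
      have e3 : Real.log K = Real.log a + Real.log (K / a) := by
        rw [← Real.log_mul ha0.ne' (by positivity)]; congr 1; field_simp
      have e4 : Real.log a = 4 * lH + ld + 2 * lε := by
        rw [ha, Real.log_div (by positivity) (by positivity), Real.log_mul (by positivity) hd0.ne',
          Real.log_pow, Real.log_pow, eε]
        push_cast; ring
      -- The tangent to `log` at `2 ^ 20`: the slope is small enough for `K` to absorb the linear
      -- term, at the price of `20 log 2`.
      have e5 : Real.log (K / a) ≤ K / a / 2 ^ 20 + 20 * Real.log 2 := by
        have h1 := Real.log_le_sub_one_of_pos (show 0 < K / a / 2 ^ 20 by positivity)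
        rw [Real.log_div (by positivity) (by positivity), Real.log_pow] at h1
        push_cast at h1
        linarith
      have e6 : ℓ ≤ H * ℓ := le_mul_of_one_le_left hℓ0.le hH
      have e7 : H * ln ≤ H * ℓ := mul_le_mul_of_nonneg_left (by linarith) hH0.le
      rw [e1, e3, e4]
      linarith
    have h3 : d * H ^ 3 * (28 * H * ℓ) = 28 * (H ^ 4 * d * ℓ) := by ring
    have h4 : d * H ^ 3 * (K / a / 2 ^ 20) ≤ K * ε ^ 2 / 2 ^ 20 := by
      have h5 : K / a / 2 ^ 20 * (H ^ 4 * d) = K * ε ^ 2 / 2 ^ 20 := by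
        rw [← haε]; field_simp
      rw [← h5, mul_comm]
      exact mul_le_mul_of_nonneg_left hH3 (by positivity)
    have h6 := mul_le_mul_of_nonneg_left hL (show 0 ≤ d * H ^ 3 by positivity)
    have h7 : 0 < K * ε ^ 2 := by positivity
    rw [mul_add, h3] at h6
    linarith
  · have e1 : Real.log (4 / δ) = 2 * Real.log 2 + lδ := by
      rw [Real.log_div (by norm_num) hδ.ne', eδ, log_four]; ring
    have h3 : H ^ 2 * Real.log 2 ≤ H ^ 4 * d * ℓ :=
      mul_le_mul hH2 hℓ2 (by linarith) (by positivity)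
    have h4 : 0 ≤ H ^ 2 * lδ := by positivity
    have h5 : 0 ≤ H ^ 4 * d * ℓ := by positivity
    rw [e1]
    linarith
  · have h3 : d * H * 0.69 ≤ H ^ 4 * d * ℓ :=
      mul_le_mul hH1 (by linarith) (by norm_num) (by positivity)
    have h4 : 0 ≤ H ^ 2 * lδ := by positivity
    have h5 : 0 ≤ d * H := by positivity
    linarith

/-- Consequences of the choice of the covering radius. -/
theorem radius_bounds {H d ε ρ : ℝ} (hH : 1 ≤ H) (hd : 1 ≤ d) (hε : 0 < ε) (hε1 : ε ≤ 1)
    (hρ : ρ = 1 / 40000 * ε ^ 2 / (H ^ 3 * d + H)) :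
    0 < ρ ∧ H * ρ ≤ ε / 40000 ∧ d * H ^ 3 * ρ ≤ ε ^ 2 / 40000 := by
  have hH0 : 0 < H := by linarith
  have hd0 : 0 < d := by linarith
  have hD : 0 < H ^ 3 * d + H := by positivity
  have e : (H ^ 3 * d + H) * ρ = ε ^ 2 / 40000 := by rw [hρ]; field_simp
  have hρ0 : 0 < ρ := by rw [hρ]; positivity
  have h1 : 0 ≤ H ^ 3 * d * ρ := by positivity
  have h2 : 0 ≤ H * ρ := by positivity
  refine ⟨hρ0, ?_, ?_⟩
  · have : ε ^ 2 ≤ ε := by nlinarith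
    linarith
  · linarith

/-- The choice of the regularization parameter balances the two parts of the regret. -/
theorem regret_arith {H d ε ρ K L β lam B : ℝ} (hH : 1 ≤ H) (hd : 1 ≤ d) (hε : 0 < ε)
    (hK : 0 < K) (hL : 0 < L) (hρ : 0 < ρ)
    (hβ : β ≤ 36 * H ^ 2 * L + 19 * K * H * ρ)
    (hB : B = K * H ^ 3 * L + K ^ 2 * H ^ 3 * ρ)
    (hlam : lam = 6 * Real.sqrt (B / d))
    (h1 : d * H ^ 3 * L ≤ K * ε ^ 2 / 40000) (h2 : d * H ^ 3 * ρ ≤ ε ^ 2 / 40000)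
    (h3 : 72 * d * H ≤ K * ε ^ 2) {d' : ℝ} (hd' : d' ≤ 2 * d) :
    0 < lam ∧ 2 * K * (H * β) / lam + d' * lam / 2 + Real.sqrt (d' * H * K) ≤ K * (ε / 3) := by
  have hH0 : 0 < H := by linarith
  have hd0 : 0 < d := by linarith
  have hB0 : 0 < B := by rw [hB]; positivity
  have hs : 0 < Real.sqrt (B / d) := Real.sqrt_pos.2 (by positivity)
  have hlam0 : 0 < lam := by rw [hlam]; positivity
  refine ⟨hlam0, ?_⟩
  have hsq : lam ^ 2 = 36 * B / d := by
    rw [hlam, mul_pow, Real.sq_sqrt (by positivity)]; ring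
  have hdl : d * lam ^ 2 = 36 * B := by rw [hsq]; field_simp
  -- The factor `6` in `lam` is chosen to match the `36` in `β`; the two parts of the regret are
  -- then at most `2 d lam` and `d lam`, together `3 d lam ≤ K ε / 6`.
  have hKβ : K * (H * β) ≤ d * lam ^ 2 := by
    rw [hdl, hB]
    have e1 : K * (H * β) ≤ K * (H * (36 * H ^ 2 * L + 19 * K * H * ρ)) := by gcongr
    have e2 : H ^ 2 * (K ^ 2 * ρ) ≤ H ^ 3 * (K ^ 2 * ρ) := by
      have : H ^ 2 ≤ H ^ 3 := pow_le_pow_right₀ hH (by norm_num)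
      gcongr
    have e3 : 0 ≤ H ^ 3 * (K ^ 2 * ρ) := by positivity
    linarith
  have t1 : 2 * K * (H * β) / lam ≤ 2 * (d * lam) := by
    rw [div_le_iff₀ hlam0]; linarith
  have t2 : d' * lam / 2 ≤ d * lam := by nlinarith
  have t3 : d * lam ≤ K * ε / 18 := by
    refine (pow_le_pow_iff_left₀ (by positivity) (by positivity) two_ne_zero).1 ?_
    have e1 : d * B ≤ K ^ 2 * ε ^ 2 / 20000 := by
      have := mul_le_mul_of_nonneg_left h1 hK.le
      have := mul_le_mul_of_nonneg_left h2 (sq_nonneg K)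
      rw [hB]
      linarith
    have e2 : (d * lam) ^ 2 = 36 * (d * B) := by
      rw [mul_pow, sq d, mul_assoc, hdl]; ring
    rw [e2]
    have : 0 ≤ K ^ 2 * ε ^ 2 := by positivity
    have e3 : (K * ε / 18) ^ 2 = K ^ 2 * ε ^ 2 / 324 := by ring
    rw [e3]
    linarith
  have t4 : Real.sqrt (d' * H * K) ≤ K * ε / 6 := by
    refine Real.sqrt_le_iff.2 ⟨by positivity, ?_⟩
    have e1 : d' * H * K ≤ 2 * d * H * K := by gcongr
    have e2 := mul_le_mul_of_nonneg_left h3 hK.le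
    have e3 : (K * ε / 6) ^ 2 = K * (K * ε ^ 2) / 36 := by ring
    rw [e3]
    linarith
  linarith

end

/-! ### The good event, the degenerate case and the final bound. -/

section

variable {S A : Type*} [MeasurableSpace S] [MeasurableSpace A]
variable {H : ℕ} {R 𝒬 : Fin H → Set (S × A → ℝ)}
variable {Ω : Type*} [mΩ : MeasurableSpace Ω] {μ : Measure Ω} {M : MDP S A H}
  {πE π₀ : Policy S A H} {N K : ℕ}

theorem Run.measure_expert_deviation_le_of_le [IsProbabilityMeasure μ] (hR : IsRewardClass R)
    (hreal : RewardRealizable M R) (run : Run μ M R 𝒬 πE π₀ N K) (hH : 0 < H) {ε δ ρ : ℝ}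
    (hε : 0 < ε) (hε1 : ε ≤ 1) (hδ : 0 < δ) (hδ1 : δ ≤ 1) (hρ : 0 ≤ ρ)
    (hHρ : H * ρ ≤ ε / 40000) (hcR : ∀ h, coveringNumber ρ (R h) ≠ ⊤)
    (hN : 1000 * (H ^ 2 * Real.log ((⨆ h, covNum ρ (R h)) / δ) / ε ^ 2) ≤ N) :
    μ {ω | ∃ r : Fin H → S × A → ℝ, (∀ h, r h ∈ R h) ∧ ε / 6 <
        (run.expertValue ω r - M.value πE r) -
          (run.expertValue ω M.reward - M.value πE M.reward)} ≤ ENNReal.ofReal (δ / 4) := by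
  have hH' : (1 : ℝ) ≤ H := by exact_mod_cast hH
  have hH0 : (0 : ℝ) < H := by linarith
  set n := ⨆ h, covNum ρ (R h) with hn
  have hle : ∀ h, covNum ρ (R h) ≤ n := fun h =>
    le_ciSup (f := fun h => covNum ρ (R h)) (Set.finite_range _).bddAbove h
  rcases lt_or_ge n 2 with hn2 | hn2
  -- With one center per step, every reward is `2ρ`-close to the true one and the deviation is at
  -- most `4 H ρ < ε / 6` surely. The condition on `N` may be void here, since `log (n / δ)` can
  -- vanish.
  · refine le_trans (le_of_eq ?_) (zero_le)
    convert measure_empty (μ := μ)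
    refine Set.eq_empty_of_forall_notMem fun ω hω => ?_
    obtain ⟨r, hr, hω⟩ := hω
    have hclose : ∀ h x, |r h x - M.reward h x| ≤ 2 * ρ := fun h x =>
      abs_sub_le_of_covNum_lt_two (hcR h) ((hle h).trans_lt hn2) (hr h) (hreal h) x
    have h1 := (abs_le.1 (run.abs_expertValue_sub_le ω (by positivity) hclose)).2
    have h2 := (abs_le.1 (abs_value_sub_le M πE (hR.isUnitReward hr) (hR.isUnitReward hreal)
      hclose)).1
    linarith
  · have h2 : 0.69 < Real.log 2 := by linarith [Real.log_two_gt_d9]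
    have hl : Real.log (n / δ) = Real.log n + Real.log (1 / δ) := by
      rw [Real.log_div (by positivity) hδ.ne', Real.log_div one_ne_zero hδ.ne']; simp; ring
    have hln : Real.log 2 ≤ Real.log n := Real.log_le_log (by norm_num) hn2
    have hlδ : 0 ≤ Real.log (1 / δ) := Real.log_nonneg (by rw [le_div_iff₀ hδ]; linarith)
    -- For `n ≥ 2` the `log 4` from splitting `δ` is at most `2 log n`.
    have hl4 : Real.log (n / (δ / 4)) ≤ 3 * Real.log (n / δ) := by
      rw [show n / (δ / 4) = 4 * (n / δ) by field_simp, Real.log_mul (by norm_num) (by positivity),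
        log_four]
      linarith
    have hX : 1000 * (H ^ 2 * Real.log (n / δ)) ≤ N * ε ^ 2 := by
      rw [← mul_div_assoc, div_le_iff₀ (by positivity)] at hN; exact hN
    have hN0 : (0 : ℝ) < N := by
      have h3 : 0 < 1000 * (H ^ 2 * Real.log (n / δ)) := by
        have : 0 < Real.log (n / δ) := by linarith
        positivity
      have h4 := h3.trans_le hX
      by_contra hc
      rw [not_lt] at hc
      nlinarith [sq_nonneg ε]
    have hs1 : ε / (24 * H) ≤ 1 := by
      rw [div_le_one (by positivity)]; linarith
    refine le_trans (measure_mono fun ω hω => ?_)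
      (run.measure_expert_deviation_le hR hreal (by exact_mod_cast hN0) hH hρ hcR hle
        (s := ε / (24 * H)) (δ := δ / 4) (by positivity) hs1 (by positivity))
    obtain ⟨r, hr, hω⟩ := hω
    refine ⟨r, hr, lt_of_le_of_lt ?_ hω⟩
    have e1 : H * (ε / (24 * H)) = ε / 24 := by field_simp
    have e2 : H * Real.log (n / (δ / 4)) / (ε / (24 * H) * N) =
        24 * H ^ 2 * Real.log (n / (δ / 4)) / (ε * N) := by field_simp
    have e3 : 24 * H ^ 2 * Real.log (n / (δ / 4)) / (ε * N) ≤ 72 / 1000 * ε := by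
      rw [div_le_iff₀ (by positivity)]
      have := mul_le_mul_of_nonneg_left hl4 (show 0 ≤ 24 * (H : ℝ) ^ 2 by positivity)
      linarith
    rw [e1, e2]
    linarith

/-- The scale `s = ε / (12 H²)` makes both the variance term and the logarithmic term at most `K ε /
12`. -/
theorem Run.measure_pathReward_deviation_le_of_le [IsProbabilityMeasure μ] (hR : IsRewardClass R)
    (hreal : RewardRealizable M R) (run : Run μ M R 𝒬 πE π₀ N K) (hH : 0 < H) {ε δ : ℝ}
    (hε : 0 < ε) (hε1 : ε ≤ 1) (hδ : 0 < δ)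
    (hK : 144 * (H : ℝ) ^ 2 * Real.log (4 / δ) ≤ K * ε ^ 2) :
    μ {ω | K * (ε / 6) < ∑ k ∈ Finset.Icc 1 K,
      ((pathReward M.reward (run.τ k ω) - pathReward (run.r k ω) (run.τ k ω)) -
        (M.value (run.greedy k ω).toPolicy M.reward -
          M.value (run.greedy k ω).toPolicy (run.r k ω)))} ≤ ENNReal.ofReal (δ / 4) := by
  have hH' : (1 : ℝ) ≤ H := by exact_mod_cast hH
  have hH0 : (0 : ℝ) < H := by linarith
  have hsH : ε / (12 * H ^ 2) * H ≤ 1 := by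
    rw [show ε / (12 * H ^ 2) * H = ε / (12 * H) by field_simp, div_le_one (by positivity)]
    linarith
  refine le_trans (measure_mono fun ω hω => ?_)
    (run.measure_pathReward_deviation_le hR hreal (s := ε / (12 * H ^ 2)) (δ := δ / 4)
      (by positivity) hsH (by positivity))
  simp only [Set.mem_ofPred_eq] at hω ⊢
  refine le_trans ?_ hω.le
  have e1 : K * (ε / (12 * H ^ 2)) * (H : ℝ) ^ 2 = K * ε / 12 := by field_simp
  have e2 : Real.log (1 / (δ / 4)) / (ε / (12 * H ^ 2)) = 12 * H ^ 2 * Real.log (4 / δ) / ε := by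
    rw [show 1 / (δ / 4) = 4 / δ by field_simp]; field_simp
  have e3 : 12 * H ^ 2 * Real.log (4 / δ) / ε ≤ K * ε / 12 := by
    rw [div_le_iff₀ hε]; linarith
  rw [e1, e2]
  linarith

/-- If the classes are essentially singletons and `H = 1`, then every greedy policy is nearly
optimal. -/
theorem Run.imitationGap_le_of_covNum_lt_two [NeZero H] (hH : H = 1) (hR : IsRewardClass R)
    (h𝒬 : IsQClass 𝒬) (hreal : RewardRealizable M R) (hopt : QRealizable M R 𝒬)
    (run : Run μ M R 𝒬 πE π₀ N K) (hK : 0 < K) {ρ : ℝ} (hρ : 0 ≤ ρ)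
    (hcR : ∀ h, coveringNumber ρ (R h) ≠ ⊤) (hcQ : ∀ h, coveringNumber ρ (𝒬 h) ≠ ⊤)
    (hR2 : ∀ h, covNum ρ (R h) < 2) (hQ2 : ∀ h, covNum ρ (𝒬 h) < 2) (ω : Ω) :
    run.imitationGap ω ≤ run.rewardOptError ω + 8 * ρ := by
  subst hH
  have hK' : (0 : ℝ) < K := by exact_mod_cast hK
  have hrew : IsUnitReward M.reward := hR.isUnitReward hreal
  have ho := hopt _ hreal
  refine (run.imitationGap_le hR hreal hK ω).trans (add_le_add le_rfl ?_)
  rw [div_mul_eq_mul_div, one_mul, div_le_iff₀ hK', ← Finset.sum_add_distrib,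
    ← Finset.sum_add_distrib]
  -- The `8ρ` is made of `2ρ` for the expert average, `2ρ` for the rollout, and twice `2ρ` for
  -- passing from `optQ` to `Q^k` and back, at the maximum and at the greedy action.
  refine (Finset.sum_le_sum (g := fun _ => 8 * ρ) fun k hk => ?_).trans (by simp [mul_comm])
  have hr := run.r_mem k hk ω
  have hclose : ∀ h x, |run.r k ω h x - M.reward h x| ≤ 2 * ρ := fun h x =>
    abs_sub_le_of_covNum_lt_two (hcR h) (hR2 h) (hr h) (hreal h) x
  have h1 := (abs_le.1 (run.abs_expertValue_sub_le ω (by positivity) hclose)).2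
  have h2 := (abs_le.1 (abs_pathReward_sub_le hclose (run.τ k ω))).1
  have hqc : ∀ x, |run.Q k ω 0 x - M.optQ M.reward 0 x| ≤ 2 * ρ :=
    abs_sub_le_of_covNum_lt_two (hcQ 0) (hQ2 0) (run.Q_mem k hk ω 0) (ho 0)
  have h3 := (abs_le.1 (h𝒬.abs_iSup_sub_le (run.Q_mem k hk ω 0) (ho 0) hqc M.s₁)).1
  rw [iSup_eq_of_isMax fun a => run.isGreedy k hk ω 0 M.s₁ a] at h3
  have h4 := value_le_iSup_optQ h𝒬 M hrew ho πE 0 rfl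
  have h5 := (abs_le.1 (hqc (M.s₁, (run.greedy k ω).act 0 M.s₁))).2
  have hb : M.optQ M.reward 0 = M.reward 0 := by
    rw [optQ_eq_bellman h𝒬 M hrew ho]
    funext x
    simp [bellman_eq, nextV_of_not_lt]
  have h6 : M.value (run.greedy k ω).toPolicy M.reward =
      M.reward 0 (M.s₁, (run.greedy k ω).act 0 M.s₁) := by
    rw [value_eq_integral_qValue M _ hrew 0 rfl]
    have e : ∀ a, M.qValue (run.greedy k ω).toPolicy M.reward 0 (M.s₁, a) =
        M.reward 0 (M.s₁, a) := fun a => by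
      rw [qValue_eq]
      simp only [trajValue_tailFrom_last M _ _ (0 : Fin 1) (by simp), integral_zero, add_zero]
    simp only [e]
    exact integral_dirac' (fun a => M.reward 0 (M.s₁, a)) _
      ((hrew 0).1.comp measurable_prodMk_left).stronglyMeasurable
  rw [hb] at h3 h4 h5
  simp only [Nat.cast_one] at h1 h2
  linarith

theorem measure_union_le_ofReal {E₁ E₂ E₃ E : Set Ω} {δ : ℝ} (hδ : 0 ≤ δ)
    (h₁ : μ E₁ ≤ ENNReal.ofReal (δ / 4)) (h₂ : μ E₂ ≤ ENNReal.ofReal (δ / 4))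
    (h₃ : μ E₃ ≤ ENNReal.ofReal (δ / 4)) (h : E ⊆ E₁ ∪ E₂ ∪ E₃) : μ E ≤ ENNReal.ofReal δ := by
  have h4 : 0 ≤ δ / 4 := by positivity
  calc μ E ≤ μ E₁ + μ E₂ + μ E₃ := (measure_mono h).trans
        ((measure_union_le _ _).trans (add_le_add (measure_union_le _ _) le_rfl))
    _ ≤ ENNReal.ofReal (δ / 4) + ENNReal.ofReal (δ / 4) + ENNReal.ofReal (δ / 4) := by gcongr
    _ = ENNReal.ofReal (δ / 4 + δ / 4 + δ / 4) := by
        rw [← ENNReal.ofReal_add h4 h4, ← ENNReal.ofReal_add (by positivity) h4]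
    _ ≤ ENNReal.ofReal δ := ENNReal.ofReal_le_ofReal (by linarith)

/-- The high-probability guarantee of OPT-AIL with explicit constants. -/
theorem Run.measure_imitationGap_le [NeZero H] (hR : IsRewardClass R) (h𝒬 : IsQClass 𝒬)
    (hreal : RewardRealizable M R) (hopt : QRealizable M R 𝒬) (hcomp : BellmanComplete M R 𝒬)
    [IsProbabilityMeasure μ] (run : Run μ M R 𝒬 πE π₀ N K) {ε δ d ρ lam : ℝ}
    (hε : 0 < ε) (hε1 : ε ≤ 1) (hδ : 0 < δ) (hδ1 : δ ≤ 1) (hd : 1 ≤ d)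
    (hdG : dGEC M R 𝒬 K (ε / (6 * H)) ≤ d)
    (hρ : ρ = 1 / 40000 * ε ^ 2 / (H ^ 3 * d + H))
    (hcR : ∀ h, coveringNumber ρ (R h) ≠ ⊤) (hcQ : ∀ h, coveringNumber ρ (𝒬 h) ≠ ⊤)
    (hlam : lam = 6 * Real.sqrt
      ((K * H ^ 3 * Real.log (4 * K * H * covNum ρ (prodClass 𝒬) *
          covNum ρ (prodClass R) / δ) + K ^ 2 * H ^ 3 * ρ) / d))
    (hN : 1000 * (H ^ 2 * Real.log ((⨆ h, covNum ρ (R h)) / δ) / ε ^ 2) ≤ N)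
    (hK : 10 ^ 7 * ((H ^ 4 * d * Real.log
          (H * d * (⨆ h, covNum ρ (𝒬 h) * covNum ρ (R h)) / (δ * ε)) +
        H ^ 2 * Real.log (1 / δ)) / ε ^ 2) ≤ K) :
    μ {ω | ¬ (run.imitationGap ω ≤
        ε + run.rewardOptError ω + run.qOptError lam ω / lam)} ≤ ENNReal.ofReal δ := by
  have hHpos : 0 < H := NeZero.pos H
  have hH : (1 : ℝ) ≤ H := by exact_mod_cast hHpos
  have hH0 : (0 : ℝ) < H := by linarith
  obtain ⟨hρ0, hHρ, hdρ⟩ := radius_bounds hH hd hε hε1 hρ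
  have hlam0 : 0 ≤ lam := by rw [hlam]; positivity
  -- For `δ = 1` the claim is trivial. For `δ < 1` the term `log (1 / δ)` forces `K > 0`.
  rcases eq_or_lt_of_le hδ1 with rfl | hδ1'
  · simpa using prob_le_one
  have hcQ1 : ∀ h, 1 ≤ covNum ρ (𝒬 h) := fun h =>
    one_le_covNum (hcQ h) ⟨_, hopt _ hreal h⟩
  have hcR1 : ∀ h, 1 ≤ covNum ρ (R h) := fun h => one_le_covNum (hcR h) ⟨_, hreal h⟩
  set n := ⨆ h, covNum ρ (𝒬 h) * covNum ρ (R h) with hn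
  have hle : ∀ h, covNum ρ (𝒬 h) * covNum ρ (R h) ≤ n := fun h =>
    le_ciSup (f := fun h => covNum ρ (𝒬 h) * covNum ρ (R h)) (Set.finite_range _).bddAbove h
  have hn1 : 1 ≤ n := (one_le_mul_of_one_le_of_one_le (hcQ1 0) (hcR1 0)).trans (hle 0)
  have hK0 : (0 : ℝ) < K := by
    refine lt_of_lt_of_le ?_ hK
    have h1 : 0 < Real.log (1 / δ) := Real.log_pos (by rw [lt_div_iff₀ hδ]; linarith)
    have h2 : 0 ≤ Real.log (H * d * n / (δ * ε)) := by
      refine Real.log_nonneg ?_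
      rw [le_div_iff₀ (by positivity), one_mul]
      have a1 : δ * ε ≤ 1 := mul_le_one₀ hδ1 hε.le hε1
      have a2 : 1 ≤ H * d * n :=
        one_le_mul_of_one_le_of_one_le (one_le_mul_of_one_le_of_one_le hH hd) hn1
      linarith
    positivity
  have hKpos : 0 < K := by exact_mod_cast hK0
  -- The logarithm in the condition on `K` has a positive lower bound only if `H n ≥ 2`; otherwise
  -- `H = 1` and all the classes are singletons up to `2ρ`.
  rcases lt_or_ge ((H : ℝ) * n) 2 with hHn | hHn
  · have hH1 : H = 1 := by
      by_contra hne
      have : (2 : ℝ) ≤ H := by exact_mod_cast (show 2 ≤ H by omega)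
      nlinarith
    have hn2 : n < 2 := by
      have : n ≤ H * n := le_mul_of_one_le_left (by linarith) hH
      linarith
    have hR2 : ∀ h, covNum ρ (R h) < 2 := fun h => by
      have := le_mul_of_one_le_left (zero_le_one.trans (hcR1 h)) (hcQ1 h)
      linarith [hle h]
    have hQ2 : ∀ h, covNum ρ (𝒬 h) < 2 := fun h => by
      have := le_mul_of_one_le_right (zero_le_one.trans (hcQ1 h)) (hcR1 h)
      linarith [hle h]
    refine le_trans (le_of_eq ?_) (zero_le)
    convert measure_empty (μ := μ)
    refine Set.eq_empty_of_forall_notMem fun ω hω => hω ?_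
    have h1 := run.imitationGap_le_of_covNum_lt_two hH1 hR h𝒬 hreal hopt hKpos hρ0.le hcR hcQ
      hR2 hQ2 ω
    have h2 : 0 ≤ run.qOptError lam ω / lam := div_nonneg (qOptError_nonneg h𝒬 run hlam0 ω) hlam0
    have h3 : ρ ≤ H * ρ := le_mul_of_one_le_left hρ0.le hH
    linarith
  set NQ := covNum ρ (prodClass 𝒬) with hNQ
  set NR := covNum ρ (prodClass R) with hNR
  have hNQ1 : 1 ≤ NQ := one_le_covNum (coveringNumber_prodClass_ne_top hcQ)
    ⟨fun p => M.optQ M.reward p.1 p.2, hopt _ hreal⟩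
  have hNR1 : 1 ≤ NR := one_le_covNum (coveringNumber_prodClass_ne_top hcR)
    ⟨fun p => M.reward p.1 p.2, hreal⟩
  have hNN1 : 1 ≤ NQ * NR := one_le_mul_of_one_le_of_one_le hNQ1 hNR1
  have hNN : NQ * NR ≤ n ^ H := by
    calc NQ * NR ≤ (∏ h, covNum ρ (𝒬 h)) * ∏ h, covNum ρ (R h) :=
          mul_le_mul (covNum_prodClass_le hcQ) (covNum_prodClass_le hcR) (by linarith)
            (Finset.prod_nonneg fun h _ => zero_le_one.trans (hcQ1 h))
      _ = ∏ h, covNum ρ (𝒬 h) * covNum ρ (R h) := Finset.prod_mul_distrib.symm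
      _ ≤ ∏ _h : Fin H, n := Finset.prod_le_prod
          (fun h _ => mul_nonneg (zero_le_one.trans (hcQ1 h)) (zero_le_one.trans (hcR1 h)))
          fun h _ => hle h
      _ = n ^ H := by simp
  obtain ⟨hb1, hb2, hb3⟩ := iteration_bounds (m := H) rfl hH hd hn1 hδ hδ1 hε hε1 hHn hK0 hNN1 hNN
    le_rfl hK
  set L := Real.log (4 * K * H * NQ * NR / δ) with hL
  have hL' : Real.log (4 * K * H * (NQ * NR) / δ) = L := by rw [hL]; ring_nf
  rw [hL'] at hb1
  have hK1 : (1 : ℝ) ≤ K := by exact_mod_cast hKpos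
  have hKH : (1 : ℝ) ≤ K * H := one_le_mul_of_one_le_of_one_le hK1 hH
  have hbase : 1 < 4 * K * H * NQ * NR / δ := by
    rw [lt_div_iff₀ hδ]
    have : 1 ≤ (K * H) * (NQ * NR) := one_le_mul_of_one_le_of_one_le hKH hNN1
    nlinarith
  have hL0 : 0 < L := Real.log_pos hbase
  obtain ⟨d', hd'0, hd'd, hgec⟩ := exists_gecBound hR h𝒬 M K (by positivity) (by linarith) hdG
  -- The squared cover of `𝒬` is paid for by doubling `L`, whose argument is at least `NQ`.
  have hlog : Real.log (K * H * (NQ * NQ * NR) / (δ / 4)) ≤ 2 * L := by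
    have e : 2 * L = Real.log ((4 * K * H * NQ * NR / δ) ^ 2) := by
      rw [Real.log_pow, hL]; norm_num
    rw [e]
    refine Real.log_le_log (by positivity) ?_
    have e2 : K * H * (NQ * NQ * NR) / (δ / 4) = (4 * K * H * NQ * NR / δ) * NQ := by
      field_simp
    have e3 : NQ ≤ 4 * K * H * NQ * NR / δ := by
      rw [le_div_iff₀ hδ]
      have a1 : NQ * δ ≤ NQ := mul_le_of_le_one_right (by linarith) hδ1
      have a2 : NQ ≤ NQ * ((K * H) * NR) := le_mul_of_one_le_right (by linarith)
        (one_le_mul_of_one_le_of_one_le hKH hNR1)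
      have a3 : 0 ≤ NQ * ((K * H) * NR) := by positivity
      linarith
    rw [e2, sq]
    exact mul_le_mul_of_nonneg_left e3 (by linarith)
  set β := 18 * H ^ 2 * Real.log (K * H * (NQ * NQ * NR) / (δ / 4)) + 19 * K * H * ρ with hβ
  have hβle : β ≤ 36 * H ^ 2 * L + 19 * K * H * ρ := by
    have := mul_le_mul_of_nonneg_left hlog (show 0 ≤ 18 * (H : ℝ) ^ 2 by positivity)
    rw [hβ]; linarith
  obtain ⟨hlampos, harith⟩ := regret_arith hH hd hε hK0 hL0 hρ0 hβle rfl hlam hb1 hdρ hb3 hd'd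
  refine measure_union_le_ofReal hδ.le
    (run.measure_expert_deviation_le_of_le hR hreal hHpos hε hε1 hδ hδ1 hρ0.le hHρ hcR hN)
    (run.measure_pathReward_deviation_le_of_le hR hreal hHpos hε hε1 hδ hb2)
    (run.measure_uniform_excess_deviation_le h𝒬 hcomp hρ0.le (δ := δ / 4) (by positivity)
      hcR hcQ) fun ω hω => ?_
  by_contra hgood
  rw [Set.mem_union, Set.mem_union, not_or, not_or] at hgood
  obtain ⟨⟨g1, g2⟩, g3⟩ := hgood
  simp only [Set.mem_ofPred_eq, not_exists, not_and, not_lt] at g1 g2 g3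
  refine hω ?_
  have hreg := sum_value_sub_value_le hR h𝒬 hopt hcomp run hlampos hgec (ω := ω) (β := β)
    fun k hk h q hq Q hQ r hr => g3 k hk h q hq Q hQ r hr
  have hexp : ∑ k ∈ Finset.Icc 1 K,
      ((run.expertValue ω (run.r k ω) - M.value πE (run.r k ω)) -
          (run.expertValue ω M.reward - M.value πE M.reward)) ≤ K * (ε / 6) :=
    (Finset.sum_le_sum fun k hk => g1 _ (run.r_mem k hk ω)).trans (by simp)
  have hgap := run.imitationGap_le hR hreal hKpos ω
  -- The error budget per iteration: `ε / 6` for the expert, `ε / 6` for the rollouts, `ε / 3` for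
  -- the balanced regret and the square root, and `ε / 6` for the additive term of the eluder
  -- inequality.
  have hsum := add_le_add (add_le_add hexp g2) hreg
  have e1 : ε / (6 * H) * H * K = K * (ε / 6) := by field_simp
  have htot : ∀ x : ℝ, x ≤ K * ε + K * (run.qOptError lam ω / lam) →
      1 / (K : ℝ) * x ≤ ε + run.qOptError lam ω / lam := fun x hx => by
    rw [div_mul_eq_mul_div, one_mul, div_le_iff₀ hK0]; linarith
  have hfin := htot _ (hsum.trans (by
    have : 0 ≤ K * ε := by positivity
    linarith))
  linarith

end

end OptAil

end

theorem theorem1 :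
    ∃ c₁ c₂ cN cK : ℝ, 0 < c₁ ∧ 0 < c₂ ∧ 0 < cN ∧ 0 < cK ∧
      ∀ {S A Ω : Type*} [MeasurableSpace S] [MeasurableSpace A] [MeasurableSpace Ω]
        (H : ℕ) [NeZero H] (M : OptAil.MDP S A H)
        (R 𝒬 : Fin H → Set (S × A → ℝ)),
        OptAil.IsRewardClass R → OptAil.IsQClass 𝒬 →
        OptAil.RewardRealizable M R → OptAil.QRealizable M R 𝒬 → OptAil.BellmanComplete M R 𝒬 →
      ∀ (πE π₀ : OptAil.Policy S A H) (N K : ℕ)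
        (μ : MeasureTheory.Measure Ω) [MeasureTheory.IsProbabilityMeasure μ]
        (run : OptAil.Run μ M R 𝒬 πE π₀ N K)
        (ε δ d ρ lam : ℝ), 0 < ε → ε ≤ 1 → 0 < δ → δ ≤ 1 →
        1 ≤ d → OptAil.dGEC M R 𝒬 K (ε / (6 * H)) ≤ d →
        ρ = c₂ * ε ^ 2 / (H ^ 3 * d + H) →
        (∀ h, OptAil.coveringNumber ρ (R h) ≠ ⊤) →
        (∀ h, OptAil.coveringNumber ρ (𝒬 h) ≠ ⊤) →
        lam = c₁ * Real.sqrt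
          ((K * H ^ 3 * Real.log (4 * K * H * OptAil.covNum ρ (OptAil.prodClass 𝒬) *
              OptAil.covNum ρ (OptAil.prodClass R) / δ) + K ^ 2 * H ^ 3 * ρ) / d) →
        cN * (H ^ 2 * Real.log ((⨆ h, OptAil.covNum ρ (R h)) / δ) / ε ^ 2) ≤ N →
        cK * ((H ^ 4 * d * Real.log
              (H * d * (⨆ h, OptAil.covNum ρ (𝒬 h) * OptAil.covNum ρ (R h)) / (δ * ε)) +
            H ^ 2 * Real.log (1 / δ)) / ε ^ 2) ≤ K →
        μ {ω | ¬ (run.imitationGap ω ≤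
            ε + run.rewardOptError ω + run.qOptError lam ω / lam)} ≤ ENNReal.ofReal δ := by
  refine ⟨6, 1 / 40000, 1000, 10 ^ 7, by norm_num, by norm_num, by norm_num, by norm_num, ?_⟩
  intro S A Ω _ _ _ H _ M R 𝒬 hR h𝒬 hreal hopt hcomp πE π₀ N K μ _ run ε δ d ρ lam hε hε1 hδ hδ1
    hd hdG hρ hcR hcQ hlam hN hK
  exact run.measure_imitationGap_le hR h𝒬 hreal hopt hcomp hε hε1 hδ hδ1 hd hdG hρ hcR hcQ hlam
    hN hK
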